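/- A betweenness structure is a nonempty finite set $X$ with a ternary relation $\beta\subseteq X^3$, where $(x\,y\,z)$ means $(x,y,z)\in\beta$, such that for all $x,y,z,w\in X$: $(x\,x\,z)$; $(x\,y\,z)\Rightarrow(z\,y\,x)$; $(x\,y\,z)\wedge(y\,x\,z)\Rightarrow x=y$; and $(x\,y\,z)\wedge(x\,w\,y)\Rightarrow(x\,w\,z)\wedge(w\,y\,z)$. A three-element set $\{x,y,z\}\subseteq X$ is collinear if one of its points is between the two others, and a triangle otherwise. The co-size is the number of triangles, and the triangle hypergraph is the 3-uniform hypergraph on $X$ whose edges are the triangles. The structure is linear if it has no triangles. $B(n,m)$ is the class of betweenness structures with $n$ points and co-size $m$ (empty if $m<0$). Isomorphism means a bijection preserving the betweenness relation in both directions. A 3-uniform hypergraph is a tight star if there is a 2-element set $K$ of points such that $E\cap F=K$ for any two distinct edges $E,F$. A connected graph with positive edge weights (equal to $1$ unless stated otherwise) and with graph metric $d$ induces the betweenness structure $(x\,y\,z)\Leftrightarrow d(x,z)=d(x,y)+d(y,z)$ on its vertex set. Let $P$ be the path $x_1x_2\dots x_{n-2}$, let $y,z$ be two further vertices, and let $I_n^2=I_n^4=\{i\in\mathbb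 N:1\le i\le\lceil\frac{n-3}{2}\rceil\}$, $I_n^3=\{i\in\mathbb N:1\le i\le n-3\}$. The following structures are those induced by the following graphs on $\{x_1,\dots,x_{n-2},y,z\}$. - $\mathcal Q_n^2$: add to $P$ the edges $yx_1$, $zx_1$, $yz$. $\mathcal Q_n^3$: add to $P$ the edges $yx_1$, $zx_1$. - $\mathcal R_{n,i}^4$: delete $x_ix_{i+1}$ from $P$ and add the edges $yx_i$, $zx_i$, $yx_{i+1}$, $zx_{i+1}$. $\mathcal R_{n,i}^3$: the same, but $yx_{i+1}$ and $zx_{i+1}$ have weight $2$. $\mathcal R_{n,i}^2$: the graph of $\mathcal R_{n,i}^4$ with the additional edge $yz$. - $\mathcal S_n^4$: add to $P$ the edges $x_1y$, $x_{n-2}z$, and $yz$ of weight $n-3$. $\mathcal S_n^3$: add to $P$ the edge $x_1y$, the edge $x_{n-2}z$ of weight $2$ and the edge $yz$ of weight $n-2$. $\mathcal S_n^2$: add to $P$ the edges $x_1y$, $x_{n-2}z$, and $yz$ of weight $n-2$. For $n\ge 6$ and $1\le i\le\lceil\frac{n-5}{2}\rceil$, $\mathcal T_{n,i}$ is induced by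 the graph on $\{x_1,\dots,x_{n-4},y,z,u,v\}$ with edges $x_jx_{j+1}$ ($1\le j\le n-5$, $j\ne i$), $x_iy$, $x_iz$, $yu$, $yv$, $zu$, $zv$, $ux_{i+1}$, $vx_{i+1}$. **Theorem.** Let $c$ be an integer and $N_c=11-c$. For all integers $n\geq 0$: 1. If $c>4$ and $n\ne c$, then $B(n,n-c)=\emptyset$. If $c>4$ and $n=c$, then $B(n,n-c)=B(n,0)$ is nonempty and consists of all linear betweenness structures with $n$ points. 2. If $2\le c\le4$, then $B(n,n-c)\ne\emptyset$ if and only if $n\ge c$. If moreover $n\ge N_c$, then a betweenness structure $\mathcal B$ belongs to $B(n,n-c)$ if and only if - for $c=4$: $\mathcal B$ is isomorphic to $\mathcal R_{n,i}^4$ for some $i\in I_n^4$, or to $\mathcal S_n^4$; - for $c=3$: $\mathcal B$ is isomorphic to $\mathcal Q_n^3$, or to $\mathcal R_{n,i}^3$ for some $i\in I_n^3$, or to $\mathcal S_n^3$; - for $c=2$: $\mathcal B$ is isomorphic to $\mathcal Q_n^2$, or to $\mathcal R_{n,i}^2$ for some $i\in I_n^2$, or to $\mathcal S_n^2$. 3.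 If $c<2$ and $n\ge N_c$, then $B(n,n-c)=\emptyset$. 4. If $c\le4$ and $n=N_c-1$, then $B(n,n-c)\ne\emptyset$; moreover, there is a $\mathcal B\in B(n,n-c)$ whose triangle hypergraph is not a tight star. In fact, the range $1\le i\le\lceil\frac{n-5}{2}\rceil$ is then nonempty, and for every $i$ in it $\mathcal T_{n,i}\in B(n,n-c)$ and the triangle hypergraph of $\mathcal T_{n,i}$ is not a tight star. -/

import Mathlib

universe u v

noncomputable section

/-- A betweenness structure: a nonempty finite ground set with a ternary relation;
`Btw x y z` reads "`y` is between `x` and `z`". -/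
structure BetweennessStructure where
  /-- The ground set. -/
  carrier : Type u
  [finite : Finite carrier]
  [nonempty : Nonempty carrier]
  /-- The betweenness relation. -/
  Btw : carrier → carrier → carrier → Prop

namespace BetweennessStructure

attribute [instance] BetweennessStructure.finite BetweennessStructure.nonempty

/-- The order: the number of points. -/
def order (𝓑 : BetweennessStructure.{u}) : ℕ := Nat.card 𝓑.carrier

/-- Almost-metrizable betweenness structures: properties (P1)-(P4), the last one being the
four relations property. -/
structure AlmostMetrizable (𝓑 : BetweennessStructure.{u}) : Prop where
  refl_left : ∀ x z, 𝓑.Btw x x z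
  symm : ∀ x y z, 𝓑.Btw x y z → 𝓑.Btw z y x
  antisymm : ∀ x y z, 𝓑.Btw x y z → 𝓑.Btw y x z → x = y
  four_relations : ∀ x y z w, 𝓑.Btw x y z → 𝓑.Btw x w y → 𝓑.Btw x w z ∧ 𝓑.Btw w y z

/-- A set of points `{x, y, z}` with `y` between `x` and `z` for some labelling of its points.
Used for three-element sets only. -/
def Collinear (𝓑 : BetweennessStructure.{u}) (T : Set 𝓑.carrier) : Prop :=
  ∃ x y z, T = {x, y, z} ∧ 𝓑.Btw x y z

/-- The triangle hypergraph: all points, and as edges the non-collinear unordered triples. -/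
def triangleHypergraph (𝓑 : BetweennessStructure.{u}) : Hypergraph 𝓑.carrier where
  vertexSet := Set.univ
  edgeSet := {T | T.ncard = 3 ∧ ¬ 𝓑.Collinear T}
  subset_vertexSet_of_mem_edgeSet' := fun _ _ => Set.subset_univ _

/-- The co-size: the number of triangles. -/
def cosize (𝓑 : BetweennessStructure.{u}) : ℕ := 𝓑.triangleHypergraph.edgeSet.ncard

/-- Linear: every unordered triple of points is collinear. -/
def IsLinear (𝓑 : BetweennessStructure.{u}) : Prop :=
  ∀ T : Set 𝓑.carrier, T.ncard = 3 → 𝓑.Collinear T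

/-- Isomorphism of betweenness structures. -/
def IsIsomorphic (𝓑 : BetweennessStructure.{u}) (𝓒 : BetweennessStructure.{v}) : Prop :=
  ∃ e : 𝓑.carrier ≃ 𝓒.carrier, ∀ x y z, 𝓑.Btw x y z ↔ 𝓒.Btw (e x) (e y) (e z)

/-- `ofOrderCosize n m` is the class `B(n, m)` of almost-metrizable betweenness structures of
order `n` and co-size `m` (empty for negative `m`). -/
def ofOrderCosize (n : ℕ) (m : ℤ) : Set BetweennessStructure.{u} :=
  {𝓑 | 𝓑.AlmostMetrizable ∧ 𝓑.order = n ∧ (𝓑.cosize : ℤ) = m}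

end BetweennessStructure

/-- A hypergraph is a Δ-star with kernel `K` if any two distinct edges meet exactly in `K`. -/
def Hypergraph.IsDeltaStar {V : Type u} (H : Hypergraph V) (K : Set V) : Prop :=
  K ⊆ H.vertexSet ∧ ∀ E ∈ H.edgeSet, ∀ F ∈ H.edgeSet, E ≠ F → E ∩ F = K

/-- A 3-uniform hypergraph is a tight star if it is a Δ-star with a kernel of size `2`. -/
def Hypergraph.IsTightStar {V : Type u} (H : Hypergraph V) : Prop :=
  ∃ K : Set V, K.ncard = 2 ∧ H.IsDeltaStar K

/-- A simple graph with a positive real weight on each edge; values of `weight` at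
non-edges are irrelevant. -/
structure WeightedGraph (V : Type u) where
  /-- The underlying simple graph. -/
  graph : SimpleGraph V
  /-- The edge weighting. -/
  weight : Sym2 V → ℝ
  weight_pos : ∀ e ∈ graph.edgeSet, 0 < weight e

namespace WeightedGraph

/-- A simple graph as a weighted graph with all weights equal to `1`. -/
def ofSimple {V : Type u} (G : SimpleGraph V) : WeightedGraph V where
  graph := G
  weight := fun _ => 1
  weight_pos := fun _ _ => one_pos

variable {V : Type u}

/-- The graph metric of a (connected) weighted graph: the least total weight of a walk. As the
weights are positive, this is the length of a shortest path. -/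
def dist (W : WeightedGraph V) (a b : V) : ℝ :=
  ⨅ p : W.graph.Walk a b, (p.edges.map W.weight).sum

/-- The betweenness structure induced by a weighted graph, i.e. by its graph metric. -/
def betweenness [Finite V] [Nonempty V] (W : WeightedGraph V) : BetweennessStructure.{u} where
  carrier := V
  Btw := fun x y z => W.dist x z = W.dist x y + W.dist y z

end WeightedGraph

/-- The vertices `x₁, …, xₘ, y, z`; the constructor `x` is indexed from `0`. -/
inductive PathVertex (m : ℕ) : Type
  | x (j : Fin m)
  | y
  | z

namespace PathVertex

instance (m : ℕ) : Nonempty (PathVertex m) := ⟨y⟩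

instance (m : ℕ) : Finite (PathVertex m) :=
  Finite.of_surjective (Sum.elim x ![y, z] : Fin m ⊕ Fin 2 → PathVertex m) fun
    | x j => ⟨.inl j, rfl⟩
    | y => ⟨.inr 0, rfl⟩
    | z => ⟨.inr 1, rfl⟩

/-- `a.IsX j` says that `a` is the vertex `xⱼ`, with `j` counted from `1`. -/
def IsX {m : ℕ} (a : PathVertex m) (j : ℕ) : Prop := ∃ k : Fin m, a = x k ∧ (k : ℕ) + 1 = j

/-- `a` is one of the vertices `y`, `z`. -/
def IsYZ {m : ℕ} (a : PathVertex m) : Prop := a = y ∨ a = z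

end PathVertex

/-- The vertices `x₁, …, xₘ, y, z, u, v`; the constructor `x` is indexed from `0`. -/
inductive TVertex (m : ℕ) : Type
  | x (j : Fin m)
  | y
  | z
  | u
  | v

namespace TVertex

instance (m : ℕ) : Nonempty (TVertex m) := ⟨y⟩

instance (m : ℕ) : Finite (TVertex m) :=
  Finite.of_surjective (Sum.elim x ![y, z, u, v] : Fin m ⊕ Fin 4 → TVertex m) fun
    | x j => ⟨.inl j, rfl⟩
    | y => ⟨.inr 0, rfl⟩
    | z => ⟨.inr 1, rfl⟩
    | u => ⟨.inr 2, rfl⟩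
    | v => ⟨.inr 3, rfl⟩

/-- `a.IsX j` says that `a` is the vertex `xⱼ`, with `j` counted from `1`. -/
def IsX {m : ℕ} (a : TVertex m) (j : ℕ) : Prop := ∃ k : Fin m, a = x k ∧ (k : ℕ) + 1 = j

end TVertex

namespace BetweennessStructure

open PathVertex

/-! In the graphs below, edges are listed in one orientation; `SimpleGraph.fromRel` symmetrizes. -/

/-- `Q_n^2`: the path `x₁ … x_{n-2}` with the edges `yx₁`, `zx₁`, `yz`. -/
def Q2 (n : ℕ) : BetweennessStructure.{0} :=
  (WeightedGraph.ofSimple (SimpleGraph.fromRel fun a b : PathVertex (n - 2) =>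
    (∃ j, a.IsX j ∧ b.IsX (j + 1)) ∨ (a.IsYZ ∧ b.IsX 1) ∨ (a = y ∧ b = z))).betweenness

/-- `Q_n^3`: the path `x₁ … x_{n-2}` with the edges `yx₁`, `zx₁`. -/
def Q3 (n : ℕ) : BetweennessStructure.{0} :=
  (WeightedGraph.ofSimple (SimpleGraph.fromRel fun a b : PathVertex (n - 2) =>
    (∃ j, a.IsX j ∧ b.IsX (j + 1)) ∨ (a.IsYZ ∧ b.IsX 1))).betweenness

/-- `R_{n,i}^2`: the path without `xᵢxᵢ₊₁`, with the edges `yxᵢ`, `zxᵢ`, `yxᵢ₊₁`, `zxᵢ₊₁`,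
`yz`. -/
def R2 (n i : ℕ) : BetweennessStructure.{0} :=
  (WeightedGraph.ofSimple (SimpleGraph.fromRel fun a b : PathVertex (n - 2) =>
    (∃ j, j ≠ i ∧ a.IsX j ∧ b.IsX (j + 1)) ∨ (a.IsYZ ∧ (b.IsX i ∨ b.IsX (i + 1))) ∨
      (a = y ∧ b = z))).betweenness

open Classical in
/-- `R_{n,i}^3`: the path without `xᵢxᵢ₊₁`, with the edges `yxᵢ`, `zxᵢ` of weight `1` and the
edges `yxᵢ₊₁`, `zxᵢ₊₁` of weight `2`. -/
def R3 (n i : ℕ) : BetweennessStructure.{0} :=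
  WeightedGraph.betweenness (V := PathVertex (n - 2))
    { graph := SimpleGraph.fromRel fun a b =>
        (∃ j, j ≠ i ∧ a.IsX j ∧ b.IsX (j + 1)) ∨ (a.IsYZ ∧ (b.IsX i ∨ b.IsX (i + 1)))
      weight := fun e => if ∃ a b, e = s(a, b) ∧ a.IsYZ ∧ b.IsX (i + 1) then 2 else 1
      weight_pos := fun e _ => by beta_reduce; split_ifs <;> norm_num }

/-- `R_{n,i}^4`: the path without `xᵢxᵢ₊₁`, with the edges `yxᵢ`, `zxᵢ`, `yxᵢ₊₁`, `zxᵢ₊₁`. -/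
def R4 (n i : ℕ) : BetweennessStructure.{0} :=
  (WeightedGraph.ofSimple (SimpleGraph.fromRel fun a b : PathVertex (n - 2) =>
    (∃ j, j ≠ i ∧ a.IsX j ∧ b.IsX (j + 1)) ∨ (a.IsYZ ∧ (b.IsX i ∨ b.IsX (i + 1))))).betweenness

open Classical in
/-- `S_n^2`: the path `x₁ … x_{n-2}` with the edges `x₁y`, `x_{n-2}z` and the edge `yz` of weight
`n - 2`. -/
def S2 (n : ℕ) (hn : 3 ≤ n) : BetweennessStructure.{0} :=
  WeightedGraph.betweenness (V := PathVertex (n - 2))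
    { graph := SimpleGraph.fromRel fun a b =>
        (∃ j, a.IsX j ∧ b.IsX (j + 1)) ∨ (a.IsX 1 ∧ b = y) ∨ (a.IsX (n - 2) ∧ b = z) ∨
          (a = y ∧ b = z)
      weight := fun e => if e = s(y, z) then (n : ℝ) - 2 else 1
      weight_pos := fun e _ => by
        have : (3 : ℝ) ≤ n := by exact_mod_cast hn
        split_ifs <;> linarith }

open Classical in
/-- `S_n^3`: the path `x₁ … x_{n-2}` with the edge `x₁y`, the edge `x_{n-2}z` of weight `2` and the
edge `yz` of weight `n - 2`. -/
def S3 (n : ℕ) (hn : 4 ≤ n) : BetweennessStructure.{0} :=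
  WeightedGraph.betweenness (V := PathVertex (n - 2))
    { graph := SimpleGraph.fromRel fun a b =>
        (∃ j, a.IsX j ∧ b.IsX (j + 1)) ∨ (a.IsX 1 ∧ b = y) ∨ (a.IsX (n - 2) ∧ b = z) ∨
          (a = y ∧ b = z)
      weight := fun e =>
        if e = s(y, z) then (n : ℝ) - 2
        else if ∃ a, e = s(a, z) ∧ a.IsX (n - 2) then 2 else 1
      weight_pos := fun e _ => by
        have : (4 : ℝ) ≤ n := by exact_mod_cast hn
        split_ifs <;> linarith }

open Classical in
/-- `S_n^4`: the path `x₁ … x_{n-2}` with the edges `x₁y`, `x_{n-2}z` and the edge `yz` of weight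
`n - 3`. -/
def S4 (n : ℕ) (hn : 5 ≤ n) : BetweennessStructure.{0} :=
  WeightedGraph.betweenness (V := PathVertex (n - 2))
    { graph := SimpleGraph.fromRel fun a b =>
        (∃ j, a.IsX j ∧ b.IsX (j + 1)) ∨ (a.IsX 1 ∧ b = y) ∨ (a.IsX (n - 2) ∧ b = z) ∨
          (a = y ∧ b = z)
      weight := fun e => if e = s(y, z) then (n : ℝ) - 3 else 1
      weight_pos := fun e _ => by
        have : (5 : ℝ) ≤ n := by exact_mod_cast hn
        split_ifs <;> linarith }

/-- `T_{n,i}`: the path `x₁ … x_{n-4}` without `xᵢxᵢ₊₁`, with the edges `xᵢy`, `xᵢz`, `yu`, `yv`,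
`zu`, `zv`, `uxᵢ₊₁`, `vxᵢ₊₁`. -/
def T (n i : ℕ) : BetweennessStructure.{0} :=
  (WeightedGraph.ofSimple (SimpleGraph.fromRel fun a b : TVertex (n - 4) =>
    (∃ j, j ≠ i ∧ a.IsX j ∧ b.IsX (j + 1)) ∨
    (a.IsX i ∧ (b = .y ∨ b = .z)) ∨
    ((a = .y ∨ a = .z) ∧ (b = .u ∨ b = .v)) ∨
    ((a = .u ∨ a = .v) ∧ b.IsX (i + 1)))).betweenness

end BetweennessStructure

end

open BetweennessStructure

/-! Write m for the co-size. With m = n - c, the hypothesis n ≥ 11 - c says exactly that m ≤ 2n -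
11. The central claim, `AlmostMetrizable.exists_kernel`, is that for n ≥ 6 this bound forces all
triangles to contain two common points y and z.

Given such a pair, deleting y or deleting z leaves a linear structure on at least five points, and
such a structure is an ordered line (`AlmostMetrizable.exists_coordinate`). The two lines agree on
the other n - 2 points, up to reversal. So the structure is encoded by the gaps s and t into which y
and z fall, together with the collinear triples {y, z, x_j} (`Frame`, `HasType`). If the structure
is not linear, the four relations property leaves two possibilities. Either s = t, and only the x's
bordering that gap can be collinear with y and z, by lying between them (`Frame.diagonal`); or y and
z sit at opposite ends, and only the two extreme x's can be collinear with them
(`Frame.off_diagonal`). Hence a positive co-size is n - 2, n - 3 or n - 4, which gives the emptiness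
statements. The first possibility yields the families Q and R, the second the family S.

The common pair is found by induction on n. If deleting some p keeps the bound and leaves a
triangle, the smaller structure has a pair contained in at least n - 5 triangles. Deleting a point
of that pair then leaves too few triangles for a positive co-size, hence none, so the pair lies in
all triangles of the whole structure. If no such p exists, counting degrees leaves a single case
without a common pair: seven points and three triangles that share one point and are otherwise
disjoint. `AlmostMetrizable.not_perfect_matching` excludes it.

Conversely, the listed graphs have explicit integer metrics, checked by a criterion on single edges
(`WeightedGraph.IsMetric`). The bound is sharp because T has two pairs of twins {y, z} and {u, v},
each contributing n - 5 triangles: 2n - 10 in all, with no common pair. -/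

namespace BetweennessStructure

/-! ### Linear structures on at least five points -/

variable {𝓑 : BetweennessStructure.{u}}

/-- No one of `a`, `b`, `c` is between the two others. -/
def Tri (𝓑 : BetweennessStructure.{u}) (a b c : 𝓑.carrier) : Prop :=
  ¬ 𝓑.Btw a b c ∧ ¬ 𝓑.Btw b c a ∧ ¬ 𝓑.Btw c a b

theorem Tri.rotate {a b c : 𝓑.carrier} (h : 𝓑.Tri a b c) : 𝓑.Tri b c a :=
  ⟨h.2.1, h.2.2, h.1⟩

theorem Tri.swap (hB : 𝓑.AlmostMetrizable) {a b c : 𝓑.carrier} (h : 𝓑.Tri a b c) :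
    𝓑.Tri b a c :=
  ⟨fun g => h.2.2 (hB.symm _ _ _ g), fun g => h.2.1 (hB.symm _ _ _ g),
    fun g => h.1 (hB.symm _ _ _ g)⟩

theorem AlmostMetrizable.refl_right (hB : 𝓑.AlmostMetrizable) (x z : 𝓑.carrier) :
    𝓑.Btw x z z := hB.symm _ _ _ (hB.refl_left z x)

theorem AlmostMetrizable.eq_of_btw_self (hB : 𝓑.AlmostMetrizable) {x y : 𝓑.carrier}
    (h : 𝓑.Btw x y x) : x = y := hB.antisymm x y x h (hB.refl_right y x)

theorem Tri.ne₁₂ (hB : 𝓑.AlmostMetrizable) {a b c : 𝓑.carrier} (h : 𝓑.Tri a b c) : a ≠ b := by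
  rintro rfl; exact h.1 (hB.refl_left _ _)

theorem Tri.ne₂₃ (hB : 𝓑.AlmostMetrizable) {a b c : 𝓑.carrier} (h : 𝓑.Tri a b c) : b ≠ c :=
  h.rotate.ne₁₂ hB

theorem Tri.ne₁₃ (hB : 𝓑.AlmostMetrizable) {a b c : 𝓑.carrier} (h : 𝓑.Tri a b c) : a ≠ c :=
  (h.rotate.rotate.ne₁₂ hB).symm

/-- All triples of points of `S` are collinear. -/
def LinearOn (𝓑 : BetweennessStructure.{u}) (S : Finset 𝓑.carrier) : Prop :=
  ∀ a ∈ S, ∀ b ∈ S, ∀ c ∈ S, ¬ 𝓑.Tri a b c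

theorem LinearOn.cases {S : Finset 𝓑.carrier} (hS : 𝓑.LinearOn S) {a b c : 𝓑.carrier}
    (ha : a ∈ S) (hb : b ∈ S) (hc : c ∈ S) : 𝓑.Btw a b c ∨ 𝓑.Btw b c a ∨ 𝓑.Btw c a b := by
  have := hS a ha b hb c hc
  unfold Tri at this
  tauto

/-- The 4-cycle with its graph metric is linear without being ordered. It does not extend to a fifth
point: the ways in which `e` can be collinear with the four sides and the two diagonals contradict
each other. -/
theorem AlmostMetrizable.not_cycle_aux (hB : 𝓑.AlmostMetrizable) {S : Finset 𝓑.carrier}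
    (hS : 𝓑.LinearOn S) {a b c d e : 𝓑.carrier} (ha : a ∈ S) (hb : b ∈ S) (hc : c ∈ S) (hd : d ∈ S)
    (he : e ∈ S) (hab : a ≠ b) (had : a ≠ d) (hbc : b ≠ c) (hbd : b ≠ d) (hcd : c ≠ d)
    (hae : a ≠ e) (hbe : b ≠ e) (hce : c ≠ e) (hde : d ≠ e)
    (h1 : 𝓑.Btw a b c) (h2 : 𝓑.Btw b c d) (h3 : 𝓑.Btw c d a) (h4 : 𝓑.Btw d a b) : False := by
  have A := hB.antisymm
  have Y := hB.symm
  have F := hB.four_relations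
  have c1 := hS.cases ha hb he
  have c2 := hS.cases hb hc he
  have c3 := hS.cases hc hd he
  have c4 := hS.cases hd ha he
  have c5 := hS.cases ha hc he
  have c6 := hS.cases hb hd he
  grind

/-- If the conclusion fails, linearity forces b a d and a d c, so that a, b, c, d form a 4-cycle. A
fifth point rules this out, which is where the size of `S` enters. -/
theorem AlmostMetrizable.outer_trans (hB : 𝓑.AlmostMetrizable) {S : Finset 𝓑.carrier}
    (hS : 𝓑.LinearOn S) (h5 : 5 ≤ S.card) {a b c d : 𝓑.carrier}
    (ha : a ∈ S) (hb : b ∈ S) (hc : c ∈ S) (hd : d ∈ S) (hbc : b ≠ c)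
    (h1 : 𝓑.Btw a b c) (h2 : 𝓑.Btw b c d) : 𝓑.Btw a b d := by
  classical
  by_contra h
  have A := hB.antisymm
  have Y := hB.symm
  have F := hB.four_relations
  have hab : a ≠ b := by rintro rfl; exact h (hB.refl_left _ _)
  have hbd : b ≠ d := by rintro rfl; exact h (hB.refl_right _ _)
  have hac : a ≠ c := by rintro rfl; exact hbc (hB.eq_of_btw_self h1).symm
  have hcd : c ≠ d := by rintro rfl; exact h h1
  have had : a ≠ d := by rintro rfl; grind
  obtain ⟨e, he, hne⟩ : ∃ e ∈ S, e ∉ ({a, b, c, d} : Finset 𝓑.carrier) := by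
    by_contra! hcon
    have := Finset.card_le_card (fun x hx => hcon x hx : S ⊆ ({a, b, c, d} : Finset 𝓑.carrier))
    have := Finset.card_le_four (a := a) (b := b) (c := c) (d := d)
    omega
  simp only [Finset.mem_insert, Finset.mem_singleton, not_or] at hne
  obtain ⟨n1, n2, n3, n4⟩ := hne
  have c1 := hS.cases ha hb hd
  have c2 := hS.cases ha hc hd
  have h4 : 𝓑.Btw b a d := by grind
  have h3 : 𝓑.Btw a d c := by grind
  exact hB.not_cycle_aux hS ha hb hc hd he hab had hbc hbd hcd (Ne.symm n1) (Ne.symm n2)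
    (Ne.symm n3) (Ne.symm n4) h1 h2 (Y _ _ _ h3) (Y _ _ _ h4)

end BetweennessStructure

/-- `q` lies between `p` and `r`. -/
def Nat.Between (p q r : ℕ) : Prop := p ≤ q ∧ q ≤ r ∨ r ≤ q ∧ q ≤ p

namespace BetweennessStructure

variable {𝓑 : BetweennessStructure.{u}}

/-- `f` arranges the points of `S` along a line. -/
structure Coordinate (𝓑 : BetweennessStructure.{u}) (S : Finset 𝓑.carrier)
    (f : 𝓑.carrier → ℕ) : Prop where
  injOn : Set.InjOn f S
  btw_iff : ∀ a ∈ S, ∀ b ∈ S, ∀ c ∈ S, (𝓑.Btw a b c ↔ Nat.Between (f a) (f b) (f c))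

/-- Seen from a base point a, "x is between a and y" is a partial order, and a maximal point e is an
end of the line. If e were strictly between x and y, then collinearity of a, e, x would place x or y
beyond e. -/
theorem AlmostMetrizable.exists_endpoint (hB : 𝓑.AlmostMetrizable) {S : Finset 𝓑.carrier}
    (hS : 𝓑.LinearOn S) (h5 : 5 ≤ S.card) :
    ∃ e ∈ S, ∀ x ∈ S, ∀ y ∈ S, 𝓑.Btw e x y ∨ 𝓑.Btw e y x := by
  obtain ⟨a, ha⟩ : S.Nonempty := Finset.card_pos.1 (by omega)
  let r : 𝓑.carrier → 𝓑.carrier → Prop := fun x y => 𝓑.Btw a x y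
  let P : PartialOrder 𝓑.carrier :=
    { le := r
      le_refl := fun x => hB.refl_right a x
      le_trans := fun x y z h1 h2 => (hB.four_relations a y z x h2 h1).1
      le_antisymm := fun x y h1 h2 =>
        hB.antisymm x y a (hB.symm _ _ _ h2) (hB.symm _ _ _ h1) }
  obtain ⟨e, he⟩ := S.exists_maximal ⟨a, ha⟩
  have hmax : ∀ y ∈ S, 𝓑.Btw a e y → y = e := fun y hy h =>
    le_antisymm (he.2 hy h : y ≤ e) (h : e ≤ y)
  refine ⟨e, he.1, fun x hx y hy => ?_⟩
  have Y := hB.symm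
  by_contra! hcon
  have hxe : 𝓑.Btw x e y := by
    rcases hS.cases he.1 hx hy with h | h | h
    · exact absurd h hcon.1
    · exact absurd (Y _ _ _ h) hcon.2
    · exact Y _ _ _ h
  have hye : y ≠ e := by rintro rfl; exact hcon.2 (hB.refl_left _ _)
  have hxe' : x ≠ e := by rintro rfl; exact hcon.1 (hB.refl_left _ _)
  rcases hS.cases ha he.1 hx with h | h | h
  · exact hxe' (hmax x hx h)
  · have h' := hB.outer_trans hS h5 ha hx he.1 hy hxe' (Y _ _ _ h) hxe
    exact hye (hmax y hy (hB.four_relations y x a e (Y _ _ _ h') (Y _ _ _ hxe) |>.1 |> Y _ _ _))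
  · exact hye (hmax y hy (hB.four_relations x e y a hxe h).2)

/-- Menger: a linear structure on at least five points is ordered. -/
theorem AlmostMetrizable.exists_coordinate (hB : 𝓑.AlmostMetrizable) {S : Finset 𝓑.carrier}
    (hS : 𝓑.LinearOn S) (h5 : 5 ≤ S.card) : ∃ f, 𝓑.Coordinate S f := by
  classical
  obtain ⟨e, he, htot⟩ := hB.exists_endpoint hS h5
  -- The coordinate is the rank, counted from the endpoint `e`.
  let f : 𝓑.carrier → ℕ := fun x => {w ∈ S | 𝓑.Btw e w x}.card
  have hmono : ∀ x y, 𝓑.Btw e x y → f x ≤ f y := fun x y h =>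
    Finset.card_le_card fun w hw => by
      simp only [Finset.mem_filter] at hw ⊢
      exact ⟨hw.1, (hB.four_relations e x y w h hw.2).1⟩
  have hanti : ∀ x y, 𝓑.Btw e x y → 𝓑.Btw e y x → x = y := fun x y h1 h2 =>
    hB.antisymm x y e (hB.symm _ _ _ h2) (hB.symm _ _ _ h1)
  have hstrict : ∀ x ∈ S, ∀ y ∈ S, 𝓑.Btw e x y → x ≠ y → f x < f y := fun x hx y hy h hne => by
    refine Finset.card_lt_card ⟨fun w hw => ?_, fun hsub => ?_⟩
    · simp only [Finset.mem_filter] at hw ⊢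
      exact ⟨hw.1, (hB.four_relations e x y w h hw.2).1⟩
    · have := hsub (Finset.mem_filter.2 ⟨hy, hB.refl_right e y⟩)
      exact hne (hanti x y h (Finset.mem_filter.1 this).2)
  have hiff : ∀ x ∈ S, ∀ y ∈ S, (𝓑.Btw e x y ↔ f x ≤ f y) := fun x hx y hy => by
    refine ⟨hmono x y, fun h => ?_⟩
    rcases htot x hx y hy with h' | h'
    · exact h'
    · by_cases hxy : x = y
      · subst hxy; exact h'
      · have := hstrict y hy x hx h' (Ne.symm hxy)
        omega
  have hmid : ∀ x ∈ S, ∀ y ∈ S, ∀ z ∈ S, f x ≤ f y → f y ≤ f z → 𝓑.Btw x y z :=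
    fun x hx y hy z hz h1 h2 =>
      (hB.four_relations e y z x ((hiff y hy z hz).2 h2) ((hiff x hx y hy).2 h1)).2
  have hinj : Set.InjOn f S := fun x hx y hy h =>
    hanti x y ((hiff x hx y hy).2 h.le) ((hiff y hy x hx).2 h.ge)
  refine ⟨f, hinj, fun x hx y hy z hz => ⟨fun h => ?_, fun h => ?_⟩⟩
  · by_contra hcon
    unfold Nat.Between at hcon
    -- If the coordinate of `y` is not in the middle, then `hmid` puts one of the other two points
    -- in the middle, and antisymmetry identifies it with `y`.
    have key : f y < f x ∧ f y < f z ∨ f x < f y ∧ f z < f y := by omega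
    have Y := hB.symm
    have M := fun x hx y hy z hz h1 h2 => hB.symm _ _ _ (hmid x hx y hy z hz h1 h2)
    rcases key with ⟨h1, h2⟩ | ⟨h1, h2⟩
    · rcases le_total (f x) (f z) with h3 | h3
      · have := hB.antisymm _ _ _ h (hmid y hy x hx z hz h1.le h3)
        subst this; omega
      · have := hB.antisymm _ _ _ (Y _ _ _ h) (hmid y hy z hz x hx h2.le h3)
        subst this; omega
    · rcases le_total (f x) (f z) with h3 | h3
      · have := hB.antisymm _ _ _ (Y _ _ _ h) (Y _ _ _ (hmid x hx z hz y hy h3 h2.le))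
        subst this; omega
      · have := hB.antisymm _ _ _ h (Y _ _ _ (hmid z hz x hx y hy h3 h1.le))
        subst this; omega
  · rcases h with ⟨h1, h2⟩ | ⟨h1, h2⟩
    · exact hmid x hx y hy z hz h1 h2
    · exact hB.symm _ _ _ (hmid z hz y hy x hx h1 h2)

end BetweennessStructure

/-! ### Frames: two linear orders differing only in y and z -/

/-- The place of a vertex when `y` and `z` are put after the first `s` of the `x`s. -/
def PathVertex.slot {N : ℕ} (s : ℕ) : PathVertex N → ℕ
  | .x j => 2 * j + 1
  | .y => 2 * s
  | .z => 2 * s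

theorem Fin.exists_lt_iff_of_antitone {N : ℕ} (P : Fin N → Prop)
    (hP : ∀ i j, i ≤ j → P j → P i) : ∃ s ≤ N, ∀ j : Fin N, P j ↔ (j : ℕ) < s := by
  classical
  have hex : ∃ k, ∀ h : k < N, ¬ P ⟨k, h⟩ := ⟨N, fun h => absurd h (lt_irrefl N)⟩
  refine ⟨Nat.find hex, Nat.find_min' hex fun h => absurd h (lt_irrefl N), fun j => ⟨fun h => ?_, fun h => ?_⟩⟩
  · by_contra hcon
    have hlt : Nat.find hex < N := by have := j.2; omega
    exact Nat.find_spec hex hlt (hP ⟨_, hlt⟩ j (by simpa [Fin.le_def] using hcon) h)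
  · have := Nat.find_min hex h
    push Not at this
    exact this.2

namespace BetweennessStructure

variable {𝓑 : BetweennessStructure.{u}}

theorem Coordinate.mono {S S' : Finset 𝓑.carrier} {f : 𝓑.carrier → ℕ} (hf : 𝓑.Coordinate S f)
    (h : S' ⊆ S) : 𝓑.Coordinate S' f :=
  ⟨hf.injOn.mono h, fun a ha b hb c hc => hf.btw_iff a (h ha) b (h hb) c (h hc)⟩

theorem Coordinate.exists_reverse {S : Finset 𝓑.carrier} {f : 𝓑.carrier → ℕ}
    (hf : 𝓑.Coordinate S f) :
    ∃ g, 𝓑.Coordinate S g ∧ ∀ a ∈ S, ∀ b ∈ S, (g a < g b ↔ f b < f a) := by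
  have hle : ∀ a ∈ S, f a ≤ S.sup f := fun a ha => Finset.le_sup ha
  refine ⟨fun a => S.sup f - f a, ⟨fun a ha b hb h => ?_, fun a ha b hb c hc => ?_⟩,
    fun a ha b hb => ?_⟩
  · have := hle a ha
    have := hle b hb
    have h' : S.sup f - f a = S.sup f - f b := h
    exact hf.injOn ha hb (by omega)
  · rw [hf.btw_iff a ha b hb c hc]
    have := hle a ha
    have := hle b hb
    have := hle c hc
    unfold Nat.Between
    omega
  · have := hle a ha
    have := hle b hb
    dsimp only
    omega

/-- Betweenness determines a coordinate up to reversal: every point lies between the two `f`-extreme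
points `p` and `q`, so the order of `g p` and `g q` fixes the direction of `g`. -/
theorem Coordinate.monotone_or_antitone {S : Finset 𝓑.carrier} {f g : 𝓑.carrier → ℕ}
    (hf : 𝓑.Coordinate S f) (hg : 𝓑.Coordinate S g) :
    (∀ a ∈ S, ∀ b ∈ S, f a < f b → g a < g b) ∨ (∀ a ∈ S, ∀ b ∈ S, f a < f b → g b < g a) := by
  rcases S.eq_empty_or_nonempty with rfl | hne
  · left; simp
  obtain ⟨p, hp, hmin⟩ := S.exists_min_image f hne
  obtain ⟨q, hq, hmax⟩ := S.exists_max_image f hne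
  have key : ∀ h : 𝓑.carrier → ℕ, 𝓑.Coordinate S h → h p ≤ h q →
      ∀ a ∈ S, ∀ b ∈ S, f a < f b → h a < h b := by
    intro h hh hpq a ha b hb hab
    have hne : h a ≠ h b := fun e => by
      have := hh.injOn ha hb e
      subst this; omega
    have h1 := (hh.btw_iff p hp a ha b hb).1
      ((hf.btw_iff p hp a ha b hb).2 (.inl ⟨hmin a ha, hab.le⟩))
    have h2 := (hh.btw_iff p hp b hb q hq).1
      ((hf.btw_iff p hp b hb q hq).2 (.inl ⟨hmin b hb, hmax b hb⟩))
    unfold Nat.Between at h1 h2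
    have : h p = h q → h a = h b := fun e => by omega
    omega
  rcases le_total (g p) (g q) with h | h
  · exact .inl (key g hg h)
  · right
    obtain ⟨k, hk, hkg⟩ := hg.exists_reverse
    intro a ha b hb hab
    refine (hkg a ha b hb).1 (key k hk ?_ a ha b hb hab)
    by_contra hcon
    have := (hkg q hq p hp).1 (by omega)
    omega

theorem Coordinate.exists_enum {S : Finset 𝓑.carrier} {f : 𝓑.carrier → ℕ}
    (hf : 𝓑.Coordinate S f) {N : ℕ} (hN : S.card = N) : ∃ x : Fin N → 𝓑.carrier, (∀ j, x j ∈ S) ∧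
      (∀ i j, f (x i) < f (x j) ↔ i < j) ∧ ∀ v ∈ S, ∃ j, x j = v := by
  classical
  have hTc : (S.image f).card = N := (Finset.card_image_of_injOn hf.injOn).trans hN
  let φ := (S.image f).orderEmbOfFin hTc
  have hφ : ∀ j, ∃ v ∈ S, f v = φ j := fun j =>
    Finset.mem_image.1 (Finset.orderEmbOfFin_mem (S.image f) hTc j)
  choose x hxS hx using hφ
  refine ⟨x, hxS, fun i j => by rw [hx, hx]; exact φ.lt_iff_lt, fun v hv => ?_⟩
  have : f v ∈ Set.range φ := by
    rw [Finset.range_orderEmbOfFin]; simpa using ⟨v, hv, rfl⟩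
  obtain ⟨j, hj⟩ := this
  exact ⟨j, hf.injOn (hxS j) hv ((hx j).trans hj)⟩

/-- The points of `S` other than `e y` and `e z` are arranged on a line as
`e (x 0), e (x 1), …`; adding `e y` after the first `s` of them, or `e z` after the first `t`
of them, gives a linear arrangement as well. -/
structure Frame (𝓑 : BetweennessStructure.{u}) (S : Finset 𝓑.carrier) (N s t : ℕ)
    (e : PathVertex N → 𝓑.carrier) : Prop where
  inj : Function.Injective e
  mem_iff : ∀ v, v ∈ S ↔ ∃ a, e a = v
  le_left : s ≤ N
  le_right : t ≤ N
  btw_y : ∀ a b c, a ≠ .z → b ≠ .z → c ≠ .z →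
    (𝓑.Btw (e a) (e b) (e c) ↔ Nat.Between (a.slot s) (b.slot s) (c.slot s))
  btw_z : ∀ a b c, a ≠ .y → b ≠ .y → c ≠ .y →
    (𝓑.Btw (e a) (e b) (e c) ↔ Nat.Between (a.slot t) (b.slot t) (c.slot t))

/-- Each triangle contains both `y` and `z`, so erasing either one leaves a linear set of at least
five points, which has a coordinate. On the points common to both sets the two coordinates agree
after reversing one if necessary. The slots `s` and `t` count the x's before `y` in the first
coordinate and before `z` in the second. -/
theorem AlmostMetrizable.exists_frame (hB : 𝓑.AlmostMetrizable) {S : Finset 𝓑.carrier}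
    {y z : 𝓑.carrier} (hy : y ∈ S) (hz : z ∈ S) (hyz : y ≠ z) (h6 : 6 ≤ S.card)
    (hT : ∀ a ∈ S, ∀ b ∈ S, ∀ c ∈ S, 𝓑.Tri a b c → (a = y ∨ b = y ∨ c = y) ∧ (a = z ∨ b = z ∨ c = z)) :
    ∃ N s t e, N + 2 = S.card ∧ 𝓑.Frame S N s t e ∧ e .y = y ∧ e .z = z := by
  classical
  have lin_z : 𝓑.LinearOn (S.erase z) := fun a ha b hb c hc h => by
    simp only [Finset.mem_erase] at ha hb hc
    have := (hT a ha.2 b hb.2 c hc.2 h).2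
    tauto
  have lin_y : 𝓑.LinearOn (S.erase y) := fun a ha b hb c hc h => by
    simp only [Finset.mem_erase] at ha hb hc
    have := (hT a ha.2 b hb.2 c hc.2 h).1
    tauto
  obtain ⟨f, hf⟩ := hB.exists_coordinate lin_z (by rw [Finset.card_erase_of_mem hz]; omega)
  obtain ⟨g₀, hg₀⟩ := hB.exists_coordinate lin_y (by rw [Finset.card_erase_of_mem hy]; omega)
  set S' := (S.erase y).erase z with hS'
  have sub_y : S' ⊆ S.erase y := Finset.erase_subset _ _
  have sub_z : S' ⊆ S.erase z := by
    intro a ha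
    simp only [hS', Finset.mem_erase] at ha ⊢
    tauto
  obtain ⟨g, hg, hfg⟩ : ∃ g, 𝓑.Coordinate (S.erase y) g ∧
      ∀ a ∈ S', ∀ b ∈ S', f a < f b → g a < g b := by
    rcases (hf.mono sub_z).monotone_or_antitone (hg₀.mono sub_y) with h | h
    · exact ⟨g₀, hg₀, h⟩
    · obtain ⟨k, hk, hkg⟩ := hg₀.exists_reverse
      exact ⟨k, hk, fun a ha b hb hab => (hkg a (sub_y ha) b (sub_y hb)).2 (h a ha b hb hab)⟩
  set N := S'.card with hN
  have hcard : N + 2 = S.card := by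
    have h1 := Finset.card_erase_of_mem hy
    have h2 : N = (S.erase y).card - 1 :=
      Finset.card_erase_of_mem (Finset.mem_erase.2 ⟨hyz.symm, hz⟩ : z ∈ S.erase y)
    omega
  obtain ⟨x, hxS, hxlt, hxsurj⟩ := (hf.mono sub_z).exists_enum hN.symm
  have gxlt : ∀ i j, g (x i) < g (x j) ↔ i < j := fun i j => by
    refine ⟨fun h => ?_, fun h => hfg _ (hxS i) _ (hxS j) ((hxlt i j).2 h)⟩
    by_contra hcon
    rcases eq_or_lt_of_le (not_lt.1 hcon) with h' | h'
    · rw [h'] at h; omega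
    · have := hfg _ (hxS j) _ (hxS i) ((hxlt j i).2 h')
      omega
  have hxinj : Function.Injective x := fun i j h => by
    have h1 := hxlt i j
    have h2 := hxlt j i
    rw [h] at h1 h2
    simp only [lt_self_iff_false, false_iff, not_lt] at h1 h2
    exact le_antisymm h2 h1
  have hxy : ∀ j, x j ≠ y := fun j h => by have := hxS j; simp [hS', h] at this
  have hxz : ∀ j, x j ≠ z := fun j h => by have := hxS j; simp [hS', h] at this
  have memx : ∀ j, x j ∈ S := fun j => Finset.mem_of_mem_erase (sub_y (hxS j))
  obtain ⟨s, hsN, hs⟩ := Fin.exists_lt_iff_of_antitone (fun j => f (x j) < f y)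
    fun i j hij h => by
      rcases eq_or_lt_of_le hij with rfl | h'
      · exact h
      · exact ((hxlt i j).2 h').trans h
  obtain ⟨t, htN, ht⟩ := Fin.exists_lt_iff_of_antitone (fun j => g (x j) < g z)
    fun i j hij h => by
      rcases eq_or_lt_of_le hij with rfl | h'
      · exact h
      · exact ((gxlt i j).2 h').trans h
  have hfne : ∀ j, f (x j) ≠ f y := fun j h =>
    hxy j (hf.injOn (sub_z (hxS j)) (Finset.mem_coe.2 (Finset.mem_erase.2 ⟨hyz, hy⟩)) h)
  have hgne : ∀ j, g (x j) ≠ g z := fun j h =>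
    hxz j (hg.injOn (sub_y (hxS j)) (Finset.mem_coe.2 (Finset.mem_erase.2 ⟨hyz.symm, hz⟩)) h)
  let e : PathVertex N → 𝓑.carrier := fun a => match a with
    | .x j => x j
    | .y => y
    | .z => z
  have fle : ∀ a b : PathVertex N, a ≠ .z → b ≠ .z →
      (f (e a) ≤ f (e b) ↔ a.slot s ≤ b.slot s) := by
    rintro (i | _ | _) (j | _ | _) ha hb <;> simp only [PathVertex.slot, e, ne_eq, not_true_eq_false, le_refl] at *
    · rw [← not_lt, hxlt, Fin.lt_def]; omega
    · have := hs i; have := hfne i; omega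
    · have := hs j; have := hfne j; omega
  have gle : ∀ a b : PathVertex N, a ≠ .y → b ≠ .y →
      (g (e a) ≤ g (e b) ↔ a.slot t ≤ b.slot t) := by
    rintro (i | _ | _) (j | _ | _) ha hb <;> simp only [PathVertex.slot, e, ne_eq, not_true_eq_false, le_refl] at *
    · rw [← not_lt, gxlt, Fin.lt_def]; omega
    · have := ht i; have := hgne i; omega
    · have := ht j; have := hgne j; omega
  have mem_z : ∀ a : PathVertex N, a ≠ .z → e a ∈ S.erase z := by
    rintro (i | _ | _) ha
    · exact sub_z (hxS i)
    · exact Finset.mem_erase.2 ⟨hyz, hy⟩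
    · exact absurd rfl ha
  have mem_y : ∀ a : PathVertex N, a ≠ .y → e a ∈ S.erase y := by
    rintro (i | _ | _) ha
    · exact sub_y (hxS i)
    · exact absurd rfl ha
    · exact Finset.mem_erase.2 ⟨hyz.symm, hz⟩
  refine ⟨N, s, t, e, hcard, ⟨?_, ?_, hsN, htN, ?_, ?_⟩, rfl, rfl⟩
  · rintro (i | _ | _) (j | _ | _) h
    · exact congrArg _ (hxinj h)
    · exact absurd h (hxy i)
    · exact absurd h (hxz i)
    · exact absurd h.symm (hxy j)
    · rfl
    · exact absurd h hyz
    · exact absurd h.symm (hxz j)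
    · exact absurd h.symm hyz
    · rfl
  · intro v
    constructor
    · intro hv
      by_cases h1 : v = y
      · exact ⟨.y, h1.symm⟩
      by_cases h2 : v = z
      · exact ⟨.z, h2.symm⟩
      obtain ⟨j, hj⟩ := hxsurj v (by simp [hS', h1, h2, hv])
      exact ⟨.x j, hj⟩
    · rintro ⟨j | _ | _, rfl⟩
      exacts [memx j, hy, hz]
  · intro a b c ha hb hc
    rw [hf.btw_iff _ (mem_z a ha) _ (mem_z b hb) _ (mem_z c hc)]
    simp only [Nat.Between, fle a b ha hb, fle b c hb hc, fle c b hc hb, fle b a hb ha]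
  · intro a b c ha hb hc
    rw [hg.btw_iff _ (mem_y a ha) _ (mem_y b hb) _ (mem_y c hc)]
    simp only [Nat.Between, gle a b ha hb, gle b c hb hc, gle c b hc hb, gle b a hb ha]

end BetweennessStructure

/-! ### Where y and z can be placed in a nonlinear frame -/

namespace BetweennessStructure

variable {𝓑 : BetweennessStructure.{u}}

namespace Frame

variable {S : Finset 𝓑.carrier} {N s t : ℕ} {e : PathVertex N → 𝓑.carrier}

theorem mem (F : 𝓑.Frame S N s t e) (a : PathVertex N) : e a ∈ S := (F.mem_iff _).2 ⟨a, rfl⟩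

/-- A triple that misses `y` or `z` lies in one of the two ordered sets and is collinear. -/
theorem exists_of_tri (hB : 𝓑.AlmostMetrizable) (F : 𝓑.Frame S N s t e) {a b c : 𝓑.carrier}
    (ha : a ∈ S) (hb : b ∈ S) (hc : c ∈ S) (h : 𝓑.Tri a b c) :
    ∃ j, 𝓑.Tri (e .y) (e .z) (e (.x j)) ∧
      ∀ v, v = e .y ∨ v = e .z ∨ v = e (.x j) ↔ v = a ∨ v = b ∨ v = c := by
  obtain ⟨a, rfl⟩ := (F.mem_iff _).1 ha
  obtain ⟨b, rfl⟩ := (F.mem_iff _).1 hb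
  obtain ⟨c, rfl⟩ := (F.mem_iff _).1 hc
  by_cases hz : a ≠ .z ∧ b ≠ .z ∧ c ≠ .z
  · exfalso
    obtain ⟨h1, h2, h3⟩ := h
    rw [F.btw_y _ _ _ hz.1 hz.2.1 hz.2.2] at h1
    rw [F.btw_y _ _ _ hz.2.1 hz.2.2 hz.1] at h2
    rw [F.btw_y _ _ _ hz.2.2 hz.1 hz.2.1] at h3
    unfold Nat.Between at h1 h2 h3
    omega
  by_cases hy : a ≠ .y ∧ b ≠ .y ∧ c ≠ .y
  · exfalso
    obtain ⟨h1, h2, h3⟩ := h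
    rw [F.btw_z _ _ _ hy.1 hy.2.1 hy.2.2] at h1
    rw [F.btw_z _ _ _ hy.2.1 hy.2.2 hy.1] at h2
    rw [F.btw_z _ _ _ hy.2.2 hy.1 hy.2.1] at h3
    unfold Nat.Between at h1 h2 h3
    omega
  have n1 := h.ne₁₂ hB
  have n2 := h.ne₂₃ hB
  have n3 := h.ne₁₃ hB
  rcases a with i | _ | _ <;> rcases b with j | _ | _ <;> rcases c with k | _ | _ <;>
    simp only [ne_eq, not_true_eq_false, reduceCtorEq, not_false_eq_true, and_self, and_true, and_false] at *
  · exact ⟨i, h.rotate, by tauto⟩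
  · exact ⟨i, h.rotate.swap hB, by tauto⟩
  · exact ⟨j, (h.swap hB).rotate, by tauto⟩
  · exact ⟨k, h, by tauto⟩
  · exact ⟨j, h.rotate.rotate, by tauto⟩
  · exact ⟨k, h.swap hB, by tauto⟩

theorem linearOn (hB : 𝓑.AlmostMetrizable) (F : 𝓑.Frame S N s t e)
    (h : ∀ j, ¬ 𝓑.Tri (e .y) (e .z) (e (.x j))) : 𝓑.LinearOn S := fun _ ha _ hb _ hc hT =>
  have ⟨j, hj, _⟩ := F.exists_of_tri hB ha hb hc hT
  h j hj

theorem btw_xxy (F : 𝓑.Frame S N s t e) (i j : Fin N) :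
    𝓑.Btw (e (.x i)) (e (.x j)) (e .y) ↔ (i : ℕ) ≤ j ∧ (j : ℕ) < s ∨ (j : ℕ) ≤ i ∧ s ≤ j := by
  rw [F.btw_y _ _ _ (by simp) (by simp) (by simp)]
  simp only [PathVertex.slot, Nat.Between]
  omega

theorem btw_xxz (F : 𝓑.Frame S N s t e) (i j : Fin N) :
    𝓑.Btw (e (.x i)) (e (.x j)) (e .z) ↔ (i : ℕ) ≤ j ∧ (j : ℕ) < t ∨ (j : ℕ) ≤ i ∧ t ≤ j := by
  rw [F.btw_z _ _ _ (by simp) (by simp) (by simp)]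
  simp only [PathVertex.slot, Nat.Between]
  omega

theorem btw_xyx (F : 𝓑.Frame S N s t e) (i j : Fin N) :
    𝓑.Btw (e (.x i)) (e .y) (e (.x j)) ↔ (i : ℕ) < s ∧ s ≤ j ∨ (j : ℕ) < s ∧ s ≤ i := by
  rw [F.btw_y _ _ _ (by simp) (by simp) (by simp)]
  simp only [PathVertex.slot, Nat.Between]
  omega

theorem btw_xzx (F : 𝓑.Frame S N s t e) (i j : Fin N) :
    𝓑.Btw (e (.x i)) (e .z) (e (.x j)) ↔ (i : ℕ) < t ∧ t ≤ j ∨ (j : ℕ) < t ∧ t ≤ i := by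
  rw [F.btw_z _ _ _ (by simp) (by simp) (by simp)]
  simp only [PathVertex.slot, Nat.Between]
  omega

/-- When `y` and `z` share a gap, a single relation x_j y z or x_j z y spreads: by the four
relations property every x_k becomes collinear with `y` and `z`, so `S` would be linear. An x_j
between `y` and `z` must border the gap, since a point x_i nearer to the gap on the same side would
have to coincide with x_j. -/
theorem diagonal (hB : 𝓑.AlmostMetrizable) (F : 𝓑.Frame S N s s e) (hS : ¬ 𝓑.LinearOn S)
    (j : Fin N) : ¬ 𝓑.Btw (e (.x j)) (e .y) (e .z) ∧ ¬ 𝓑.Btw (e (.x j)) (e .z) (e .y) ∧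
      (𝓑.Btw (e .y) (e (.x j)) (e .z) → (j : ℕ) + 1 = s ∨ (j : ℕ) = s) := by
  have Y := hB.symm
  have R := hB.four_relations
  have A := hB.antisymm
  have n1 : ¬ 𝓑.Btw (e (.x j)) (e .y) (e .z) := by
    intro h
    refine hS (F.linearOn hB fun k hk => ?_)
    have g1 := F.btw_xxy j k
    have g2 := F.btw_xxz k j
    have g3 := F.btw_xzx j k
    -- The point x_k is between x_j and the gap, or behind x_j, or on the other side of the gap.
    have : 𝓑.Btw (e (.x j)) (e (.x k)) (e .y) ∨ 𝓑.Btw (e (.x k)) (e (.x j)) (e .z) ∨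
        𝓑.Btw (e (.x j)) (e .z) (e (.x k)) := by rw [g1, g2, g3]; omega
    rcases this with g | g | g
    · exact hk.2.2 (R _ _ _ _ h g).2
    · exact hk.2.2 (Y _ _ _ (R _ _ _ _ (Y _ _ _ g) (Y _ _ _ h)).1)
    · exact hk.1 (R _ _ _ _ g h).2
  have n2 : ¬ 𝓑.Btw (e (.x j)) (e .z) (e .y) := by
    intro h
    refine hS (F.linearOn hB fun k hk => ?_)
    have g1 := F.btw_xxz j k
    have g2 := F.btw_xxy k j
    have g3 := F.btw_xyx j k
    have : 𝓑.Btw (e (.x j)) (e (.x k)) (e .z) ∨ 𝓑.Btw (e (.x k)) (e (.x j)) (e .y) ∨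
        𝓑.Btw (e (.x j)) (e .y) (e (.x k)) := by rw [g1, g2, g3]; omega
    rcases this with g | g | g
    · exact hk.1 (Y _ _ _ (R _ _ _ _ h g).2)
    · exact hk.1 (R _ _ _ _ (Y _ _ _ g) (Y _ _ _ h)).1
    · exact (hk.swap hB).1 (R _ _ _ _ g h).2
  refine ⟨n1, n2, fun h => ?_⟩
  by_contra hcon
  -- The witness is the neighbour of the gap on the side of x_j.
  obtain ⟨i, hi⟩ : ∃ i : Fin N, i ≠ j ∧ ((j : ℕ) ≤ i ∧ (i : ℕ) < s ∨ (i : ℕ) ≤ j ∧ s ≤ i) := by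
    have h1 := j.2
    have h2 := F.le_left
    by_cases hj : (j : ℕ) < s
    · refine ⟨⟨s - 1, by omega⟩, ?_, ?_⟩
      · simp [Fin.ext_iff]; omega
      · simp; omega
    · refine ⟨⟨s, by omega⟩, ?_, ?_⟩
      · simp [Fin.ext_iff]; omega
      · simp; omega
  have g1 := (F.btw_xxy j i).2 hi.2
  have g2 := (F.btw_xxz j i).2 hi.2
  exact hi.1 (F.inj.eq_iff.1 (A _ _ _ (R _ _ _ _ h (Y _ _ _ g1)).2 g2) |> PathVertex.x.inj)

/-- An x_j placed after `y` and before `z` cannot be between them, as this would make `S` linear. If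
some x preceded `y`, then x_{s-1} y x_s and x_{s-1} x_s z would put x_s between `y` and `z`; so `y`
comes first and, symmetrically, `z` comes last. If x_j y z holds with j > 0, then x_0 is between x_j
and `y`, hence between x_j and `z`, contradicting the order. -/
theorem off_diagonal (hB : 𝓑.AlmostMetrizable) (F : 𝓑.Frame S N s t e) (hst : s < t)
    (hS : ¬ 𝓑.LinearOn S) : s = 0 ∧ t = N ∧ ∀ j : Fin N, ¬ 𝓑.Btw (e .y) (e (.x j)) (e .z) ∧
      (𝓑.Btw (e (.x j)) (e .y) (e .z) → (j : ℕ) = 0) ∧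
      (𝓑.Btw (e (.x j)) (e .z) (e .y) → (j : ℕ) + 1 = N) := by
  have Y := hB.symm
  have R := hB.four_relations
  have A := hB.antisymm
  have htN := F.le_right
  have n1 : ∀ j : Fin N, s ≤ j → (j : ℕ) < t → ¬ 𝓑.Btw (e .y) (e (.x j)) (e .z) := by
    intro j hsj hjt h
    refine hS (F.linearOn hB fun k hk => ?_)
    have g1 := F.btw_xxy j k
    have g2 := F.btw_xxz j k
    have g3 := F.btw_xyx k j
    have g4 := F.btw_xxz k j
    have g5 := F.btw_xzx k j
    have g6 := F.btw_xxy k j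
    -- The four cases are: x_k between the gap of `y` and x_j, between x_j and the gap of `z`,
    -- before `y`, after `z`.
    have : 𝓑.Btw (e (.x j)) (e (.x k)) (e .y) ∨ 𝓑.Btw (e (.x j)) (e (.x k)) (e .z) ∨
        (𝓑.Btw (e (.x k)) (e .y) (e (.x j)) ∧ 𝓑.Btw (e (.x k)) (e (.x j)) (e .z)) ∨
        (𝓑.Btw (e (.x k)) (e .z) (e (.x j)) ∧ 𝓑.Btw (e (.x k)) (e (.x j)) (e .y)) := by
      rw [g1, g2, g3, g4, g5, g6]; omega
    rcases this with g | g | ⟨g, g'⟩ | ⟨g, g'⟩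
    · exact hk.2.1 (Y _ _ _ (R _ _ _ _ h (Y _ _ _ g)).1)
    · exact hk.2.1 (R _ _ _ _ (Y _ _ _ h) (Y _ _ _ g)).1
    · exact hk.2.2 (R _ _ _ _ g' g).1
    · exact hk.1 (Y _ _ _ (R _ _ _ _ g' g).1)
  have hs : s = 0 := by
    by_contra hs
    let i : Fin N := ⟨s - 1, by omega⟩
    let j : Fin N := ⟨s, by omega⟩
    have g1 : 𝓑.Btw (e (.x i)) (e .y) (e (.x j)) := by rw [F.btw_xyx]; simp [i, j]; omega
    have g2 : 𝓑.Btw (e (.x i)) (e (.x j)) (e .z) := by rw [F.btw_xxz]; simp [i, j]; omega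
    exact n1 j le_rfl hst (R _ _ _ _ g2 g1).2
  have ht : t = N := by
    by_contra ht
    let i : Fin N := ⟨t, by omega⟩
    let j : Fin N := ⟨s, by omega⟩
    have g1 : 𝓑.Btw (e (.x i)) (e .z) (e (.x j)) := by rw [F.btw_xzx]; simp [i, j]; omega
    have g2 : 𝓑.Btw (e (.x i)) (e (.x j)) (e .y) := by rw [F.btw_xxy]; simp [i, j]; omega
    exact n1 j le_rfl hst (Y _ _ _ (R _ _ _ _ g2 g1).2)
  refine ⟨hs, ht, fun j => ⟨n1 j (by omega) (by omega), fun h => ?_, fun h => ?_⟩⟩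
  · by_contra hj
    let l : Fin N := ⟨0, by omega⟩
    have g1 : 𝓑.Btw (e (.x j)) (e (.x l)) (e .y) := by rw [F.btw_xxy]; simp [l]; omega
    have g2 := (R _ _ _ _ h g1).1
    rw [F.btw_xxz] at g2
    simp [l] at g2
    omega
  · by_contra hj
    let l : Fin N := ⟨N - 1, by omega⟩
    have g1 : 𝓑.Btw (e (.x j)) (e (.x l)) (e .z) := by rw [F.btw_xxz]; simp [l]; omega
    have g2 := (R _ _ _ _ h g1).1
    rw [F.btw_xxy] at g2
    simp [l] at g2
    omega

/-- Interchanging `y` and `z`. -/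
theorem swap (F : 𝓑.Frame S N s t e) : 𝓑.Frame S N t s
    (fun a => match a with | .x j => e (.x j) | .y => e .z | .z => e .y) := by
  have hi := F.inj
  refine ⟨?_, ?_, F.le_right, F.le_left, ?_, ?_⟩
  · rintro (i | _ | _) (j | _ | _) h <;> have := hi h <;> simp_all
  · intro v
    rw [F.mem_iff]
    constructor
    · rintro ⟨j | _ | _, rfl⟩
      exacts [⟨.x j, rfl⟩, ⟨.z, rfl⟩, ⟨.y, rfl⟩]
    · rintro ⟨j | _ | _, rfl⟩
      exacts [⟨.x j, rfl⟩, ⟨.z, rfl⟩, ⟨.y, rfl⟩]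
  · rintro (i | _ | _) (j | _ | _) (k | _ | _) ha hb hc <;>
      first
      | contradiction
      | exact F.btw_z _ _ _ (by simp) (by simp) (by simp)
  · rintro (i | _ | _) (j | _ | _) (k | _ | _) ha hb hc <;>
      first
      | contradiction
      | exact F.btw_y _ _ _ (by simp) (by simp) (by simp)

/-- Reversing the order of the `x`s. -/
theorem reverse (F : 𝓑.Frame S N s t e) : 𝓑.Frame S N (N - s) (N - t)
    (fun a => match a with | .x j => e (.x j.rev) | .y => e .y | .z => e .z) := by
  have hi := F.inj
  have h1 := F.le_left
  have h2 := F.le_right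
  refine ⟨?_, ?_, Nat.sub_le _ _, Nat.sub_le _ _, ?_, ?_⟩
  · rintro (i | _ | _) (j | _ | _) h <;> have := hi h <;> simp_all
  · intro v
    rw [F.mem_iff]
    constructor
    · rintro ⟨j | _ | _, rfl⟩
      exacts [⟨.x j.rev, by simp⟩, ⟨.y, rfl⟩, ⟨.z, rfl⟩]
    · rintro ⟨j | _ | _, rfl⟩
      exacts [⟨.x j.rev, rfl⟩, ⟨.y, rfl⟩, ⟨.z, rfl⟩]
  · rintro (i | _ | _) (j | _ | _) (k | _ | _) ha hb hc <;>
      first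
      | contradiction
      | (refine (F.btw_y _ _ _ (by simp) (by simp) (by simp)).trans ?_
         simp only [PathVertex.slot, Nat.Between, Fin.val_rev]
         omega)
  · rintro (i | _ | _) (j | _ | _) (k | _ | _) ha hb hc <;>
      first
      | contradiction
      | (refine (F.btw_z _ _ _ (by simp) (by simp) (by simp)).trans ?_
         simp only [PathVertex.slot, Nat.Between, Fin.val_rev]
         omega)

end Frame

end BetweennessStructure

/-! ### Counting triangles; types as isomorphism invariants -/

namespace BetweennessStructure

variable {𝓑 : BetweennessStructure.{u}}

open Classical in
/-- The triangles contained in `S`. -/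
noncomputable def triangles (𝓑 : BetweennessStructure.{u}) (S : Finset 𝓑.carrier) :
    Finset (Finset 𝓑.carrier) :=
  {T ∈ S.powerset | ∃ a b c, T = {a, b, c} ∧ 𝓑.Tri a b c}

open Classical in
theorem mem_triangles {S T : Finset 𝓑.carrier} :
    T ∈ 𝓑.triangles S ↔ T ⊆ S ∧ ∃ a b c, T = {a, b, c} ∧ 𝓑.Tri a b c := by
  simp [triangles]

open Classical in
theorem mem_triangles_of_tri {S : Finset 𝓑.carrier} {a b c : 𝓑.carrier} (ha : a ∈ S)
    (hb : b ∈ S) (hc : c ∈ S) (h : 𝓑.Tri a b c) : {a, b, c} ∈ 𝓑.triangles S :=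
  mem_triangles.2 ⟨by simp [Finset.insert_subset_iff, ha, hb, hc], a, b, c, rfl, h⟩

open Classical in
theorem AlmostMetrizable.card_of_mem_triangles (hB : 𝓑.AlmostMetrizable) {S T : Finset 𝓑.carrier}
    (h : T ∈ 𝓑.triangles S) : T.card = 3 := by
  obtain ⟨-, a, b, c, rfl, h'⟩ := mem_triangles.1 h
  exact Finset.card_eq_three.2 ⟨a, b, c, h'.ne₁₂ hB, h'.ne₁₃ hB, h'.ne₂₃ hB, rfl⟩

open Classical in
theorem triangles_erase (S : Finset 𝓑.carrier) (p : 𝓑.carrier) :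
    𝓑.triangles (S.erase p) = {T ∈ 𝓑.triangles S | p ∉ T} := by
  ext T
  simp only [mem_triangles, Finset.subset_erase, Finset.mem_filter]
  tauto

open Classical in
theorem linearOn_iff {S : Finset 𝓑.carrier} : 𝓑.LinearOn S ↔ 𝓑.triangles S = ∅ := by
  rw [Finset.eq_empty_iff_forall_notMem]
  constructor
  · intro h T hT
    obtain ⟨hTS, a, b, c, rfl, h'⟩ := mem_triangles.1 hT
    simp only [Finset.insert_subset_iff, Finset.singleton_subset_iff] at hTS
    exact h a hTS.1 b hTS.2.1 c hTS.2.2 h'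
  · intro h a ha b hb c hc h'
    exact h _ (mem_triangles_of_tri ha hb hc h')

theorem AlmostMetrizable.collinear_iff (hB : 𝓑.AlmostMetrizable) {a b c : 𝓑.carrier}
    (hab : a ≠ b) (hac : a ≠ c) (hbc : b ≠ c) :
    𝓑.Collinear {a, b, c} ↔ ¬ 𝓑.Tri a b c := by
  have Y := hB.symm
  constructor
  · rintro ⟨x, y, z, hT, h⟩ ⟨h1, h2, h3⟩
    have hx : ∀ w : 𝓑.carrier, w = a ∨ w = b ∨ w = c ↔ w = x ∨ w = y ∨ w = z := fun w => by
      have := Set.ext_iff.1 hT w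
      simpa using this
    have ha := (hx a).1 (by simp)
    have hb := (hx b).1 (by simp)
    have hc := (hx c).1 (by simp)
    rcases ha with rfl | rfl | rfl <;> rcases hb with rfl | rfl | rfl <;>
      rcases hc with rfl | rfl | rfl <;> first | contradiction | grind
  · intro h
    unfold Tri at h
    by_cases h1 : 𝓑.Btw a b c
    · exact ⟨a, b, c, rfl, h1⟩
    by_cases h2 : 𝓑.Btw b c a
    · exact ⟨b, c, a, by ext; simp; tauto, h2⟩
    · exact ⟨c, a, b, by ext; simp; tauto, by tauto⟩

theorem AlmostMetrizable.mem_edgeSet_iff (hB : 𝓑.AlmostMetrizable) {T : Set 𝓑.carrier} :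
    T ∈ 𝓑.triangleHypergraph.edgeSet ↔ ∃ a b c, T = {a, b, c} ∧ 𝓑.Tri a b c := by
  change T.ncard = 3 ∧ ¬ 𝓑.Collinear T ↔ _
  constructor
  · rintro ⟨h, h'⟩
    obtain ⟨a, b, c, hab, hac, hbc, rfl⟩ := Set.ncard_eq_three.1 h
    rw [hB.collinear_iff hab hac hbc, not_not] at h'
    exact ⟨a, b, c, rfl, h'⟩
  · rintro ⟨a, b, c, rfl, h⟩
    rw [hB.collinear_iff (h.ne₁₂ hB) (h.ne₁₃ hB) (h.ne₂₃ hB), not_not]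
    exact ⟨Set.ncard_eq_three.2 ⟨a, b, c, h.ne₁₂ hB, h.ne₁₃ hB, h.ne₂₃ hB, rfl⟩, h⟩

open Classical in
theorem AlmostMetrizable.cosize_eq (hB : 𝓑.AlmostMetrizable) {S : Finset 𝓑.carrier}
    (hS : ∀ a, a ∈ S) : 𝓑.cosize = (𝓑.triangles S).card := by
  have : 𝓑.triangleHypergraph.edgeSet = (fun T : Finset 𝓑.carrier => (T : Set 𝓑.carrier)) ''
      (𝓑.triangles S : Set (Finset 𝓑.carrier)) := by
    ext T
    rw [hB.mem_edgeSet_iff]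
    constructor
    · rintro ⟨a, b, c, rfl, h⟩
      exact ⟨{a, b, c}, mem_triangles_of_tri (hS _) (hS _) (hS _) h, by simp⟩
    · rintro ⟨T, hT, rfl⟩
      obtain ⟨-, a, b, c, rfl, h⟩ := mem_triangles.1 hT
      exact ⟨a, b, c, by simp, h⟩
  rw [cosize, this, Set.ncard_image_of_injective _ Finset.coe_injective, Set.ncard_coe_finset]

open Classical in
theorem Frame.card_triangles {S : Finset 𝓑.carrier} {N s t : ℕ} {e : PathVertex N → 𝓑.carrier}
    (hB : 𝓑.AlmostMetrizable) (F : 𝓑.Frame S N s t e) :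
    (𝓑.triangles S).card = ({j | 𝓑.Tri (e .y) (e .z) (e (.x j))} : Finset (Fin N)).card := by
  symm
  refine Finset.card_bij (fun j _ => {e .y, e .z, e (.x j)}) (fun j hj => ?_) (fun i _ j _ h => ?_)
    (fun T hT => ?_)
  · exact mem_triangles_of_tri (F.mem _) (F.mem _) (F.mem _) (Finset.mem_filter.1 hj).2
  · have := Finset.ext_iff.1 h (e (.x i))
    simp [F.inj.eq_iff] at this
    exact this
  · obtain ⟨hTS, a, b, c, rfl, h⟩ := mem_triangles.1 hT
    simp only [Finset.insert_subset_iff, Finset.singleton_subset_iff] at hTS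
    obtain ⟨j, hj, hj'⟩ := F.exists_of_tri hB hTS.1 hTS.2.1 hTS.2.2 h
    refine ⟨j, by simpa using hj, ?_⟩
    ext v
    simpa using hj' v

/-- `S` has a frame in which `A`, `B`, `C` describe the positions of those `x`s that lie between
`y` and `z`, that are separated from `z` by `y`, and that are separated from `y` by `z`. -/
def HasType (𝓑 : BetweennessStructure.{u}) (S : Finset 𝓑.carrier) (N s t : ℕ)
    (A B C : ℕ → Prop) : Prop :=
  ∃ e, 𝓑.Frame S N s t e ∧ ∀ j : Fin N, (𝓑.Btw (e .y) (e (.x j)) (e .z) ↔ A j) ∧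
    (𝓑.Btw (e (.x j)) (e .y) (e .z) ↔ B j) ∧ (𝓑.Btw (e (.x j)) (e .z) (e .y) ↔ C j)

namespace HasType

variable {S : Finset 𝓑.carrier} {N s t : ℕ} {A B C : ℕ → Prop}

theorem congr (h : 𝓑.HasType S N s t A B C) {s' t' : ℕ} {A' B' C' : ℕ → Prop} (hs : s = s')
    (ht : t = t') (hA : ∀ j < N, (A j ↔ A' j)) (hB : ∀ j < N, (B j ↔ B' j))
    (hC : ∀ j < N, (C j ↔ C' j)) : 𝓑.HasType S N s' t' A' B' C' := by
  subst hs ht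
  obtain ⟨e, F, he⟩ := h
  exact ⟨e, F, fun j => ⟨(he j).1.trans (hA j j.2), (he j).2.1.trans (hB j j.2),
    (he j).2.2.trans (hC j j.2)⟩⟩

theorem swap (hB : 𝓑.AlmostMetrizable) (h : 𝓑.HasType S N s t A B C) :
    𝓑.HasType S N t s A C B := by
  obtain ⟨e, F, he⟩ := h
  exact ⟨_, F.swap, fun j => ⟨⟨fun g => (he j).1.1 (hB.symm _ _ _ g),
    fun g => hB.symm _ _ _ ((he j).1.2 g)⟩, (he j).2.2, (he j).2.1⟩⟩

theorem reverse (h : 𝓑.HasType S N s t A B C) :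
    𝓑.HasType S N (N - s) (N - t) (fun j => A (N - (j + 1))) (fun j => B (N - (j + 1)))
      (fun j => C (N - (j + 1))) := by
  obtain ⟨e, F, he⟩ := h
  refine ⟨_, F.reverse, fun j => ?_⟩
  have := he j.rev
  rwa [Fin.val_rev] at this

open Classical in
theorem card_triangles (hB : 𝓑.AlmostMetrizable) (h : 𝓑.HasType S N s t A B C) :
    (𝓑.triangles S).card = ({j | ¬ (A j ∨ B j ∨ C j)} : Finset (Fin N)).card := by
  obtain ⟨e, F, he⟩ := h
  rw [F.card_triangles hB]
  congr 1
  ext j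
  have Y := hB.symm
  obtain ⟨h1, h2, h3⟩ := he j
  simp only [Finset.mem_filter, Finset.mem_univ, true_and]
  have e1 : 𝓑.Btw (e .y) (e .z) (e (.x j)) ↔ 𝓑.Btw (e (.x j)) (e .z) (e .y) := ⟨Y _ _ _, Y _ _ _⟩
  have e2 : 𝓑.Btw (e .z) (e (.x j)) (e .y) ↔ 𝓑.Btw (e .y) (e (.x j)) (e .z) := ⟨Y _ _ _, Y _ _ _⟩
  rw [← h1, ← h2, ← h3, Tri, e1, e2]
  tauto

theorem card_triangles_eq (hB : 𝓑.AlmostMetrizable) (h : 𝓑.HasType S N s t A B C)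
    (J : Finset ℕ) (hJ : ∀ j < N, A j ∨ B j ∨ C j ↔ j ∈ J) (hJN : ∀ j ∈ J, j < N) :
    (𝓑.triangles S).card = N - J.card := by
  classical
  rw [h.card_triangles hB]
  have : (({j | ¬ (A j ∨ B j ∨ C j)} : Finset (Fin N)).map Fin.valEmbedding) =
      Finset.range N \ J := by
    ext k
    simp only [Finset.mem_map, Finset.mem_filter, Finset.mem_univ, true_and, Finset.mem_sdiff,
      Finset.mem_range, Fin.valEmbedding_apply]
    constructor
    · rintro ⟨j, hj, rfl⟩
      exact ⟨j.2, fun h' => hj ((hJ j j.2).2 h')⟩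
    · rintro ⟨hk, hk'⟩
      exact ⟨⟨k, hk⟩, fun h' => hk' ((hJ k hk).1 h'), rfl⟩
  rw [← Finset.card_map Fin.valEmbedding, this,
    Finset.card_sdiff_of_subset (fun j hj => Finset.mem_range.2 (hJN j hj)), Finset.card_range]

theorem order_eq (h : 𝓑.HasType S N s t A B C) (hS : ∀ a, a ∈ S) : 𝓑.order = N + 2 := by
  obtain ⟨e, F, -⟩ := h
  let E : PathVertex N ≃ Fin N ⊕ Fin 2 :=
    { toFun := fun a => match a with | .x j => .inl j | .y => .inr 0 | .z => .inr 1
      invFun := Sum.elim .x ![.y, .z]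
      left_inv := by rintro (j | _ | _) <;> rfl
      right_inv := by rintro (j | j) <;> [rfl; (fin_cases j <;> rfl)] }
  have hbij : Function.Bijective e := ⟨F.inj, fun v => (F.mem_iff v).1 (hS v)⟩
  rw [order, ← Nat.card_congr (Equiv.ofBijective e hbij), Nat.card_congr E]
  simp

/-- A type determines the whole relation: triples avoiding `y` or `z` are read off from the slots,
and the triples {y, z, x_j} from `A`, `B`, `C`. -/
theorem exists_isIsomorphic {𝓒 : BetweennessStructure.{v}} (hB : 𝓑.AlmostMetrizable)
    (hC : 𝓒.AlmostMetrizable) {S' : Finset 𝓒.carrier} (h : 𝓑.HasType S N s t A B C)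
    (h' : 𝓒.HasType S' N s t A B C) (hS : ∀ a, a ∈ S) (hS' : ∀ a, a ∈ S') :
    𝓑.IsIsomorphic 𝓒 := by
  obtain ⟨e, F, he⟩ := h
  obtain ⟨f, G, hf⟩ := h'
  let E := Equiv.ofBijective e ⟨F.inj, fun v => (F.mem_iff v).1 (hS v)⟩
  let E' := Equiv.ofBijective f ⟨G.inj, fun v => (G.mem_iff v).1 (hS' v)⟩
  have Y : ∀ a b c, 𝓑.Btw a b c ↔ 𝓑.Btw c b a := fun a b c => ⟨hB.symm _ _ _, hB.symm _ _ _⟩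
  have Y' : ∀ a b c, 𝓒.Btw a b c ↔ 𝓒.Btw c b a := fun a b c => ⟨hC.symm _ _ _, hC.symm _ _ _⟩
  have key : ∀ a b c, 𝓑.Btw (e a) (e b) (e c) ↔ 𝓒.Btw (f a) (f b) (f c) := by
    intro a b c
    by_cases hab : a = b
    · subst hab; exact iff_of_true (hB.refl_left _ _) (hC.refl_left _ _)
    by_cases hbc : b = c
    · subst hbc; exact iff_of_true (hB.refl_right _ _) (hC.refl_right _ _)
    by_cases hac : a = c
    · subst hac
      exact iff_of_false (fun h => hab (F.inj (hB.eq_of_btw_self h)))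
        (fun h => hab (G.inj (hC.eq_of_btw_self h)))
    by_cases hz : a ≠ .z ∧ b ≠ .z ∧ c ≠ .z
    · rw [F.btw_y _ _ _ hz.1 hz.2.1 hz.2.2, G.btw_y _ _ _ hz.1 hz.2.1 hz.2.2]
    by_cases hy : a ≠ .y ∧ b ≠ .y ∧ c ≠ .y
    · rw [F.btw_z _ _ _ hy.1 hy.2.1 hy.2.2, G.btw_z _ _ _ hy.1 hy.2.1 hy.2.2]
    rcases a with i | _ | _ <;> rcases b with j | _ | _ <;> rcases c with k | _ | _ <;>
      simp only [ne_eq, not_true_eq_false, reduceCtorEq, not_false_eq_true, and_self, and_true,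
        and_false] at *
    · rw [(he i).2.1, (hf i).2.1]
    · rw [(he i).2.2, (hf i).2.2]
    · rw [(he j).1, (hf j).1]
    · rw [Y, (he k).2.2, Y', (hf k).2.2]
    · rw [Y, (he j).1, Y', (hf j).1]
    · rw [Y, (he k).2.1, Y', (hf k).2.1]
  refine ⟨E.symm.trans E', fun x y z => ?_⟩
  obtain ⟨a, rfl⟩ := E.surjective x
  obtain ⟨b, rfl⟩ := E.surjective y
  obtain ⟨c, rfl⟩ := E.surjective z
  simp only [Equiv.trans_apply, Equiv.symm_apply_apply]
  exact key a b c

end HasType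

/-- Two normal forms of the nonlinear structures all of whose triangles contain `y` and `z`. -/
theorem Frame.hasType {S : Finset 𝓑.carrier} {N s t : ℕ} {e : PathVertex N → 𝓑.carrier}
    (hB : 𝓑.AlmostMetrizable) (F : 𝓑.Frame S N s t e) (hS : ¬ 𝓑.LinearOn S) :
    (∃ (α β : Prop) (s : ℕ), s ≤ N ∧ 𝓑.HasType S N s s (fun j => j + 1 = s ∧ α ∨ j = s ∧ β)
      (fun _ => False) (fun _ => False)) ∨
    (∃ α β : Prop, 𝓑.HasType S N 0 N (fun _ => False) (fun j => j = 0 ∧ α)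
      (fun j => j + 1 = N ∧ β)) := by
  have off : ∀ s t e, 𝓑.Frame S N s t e → s < t → ∃ α β : Prop, 𝓑.HasType S N 0 N
      (fun _ => False) (fun j => j = 0 ∧ α) (fun j => j + 1 = N ∧ β) := by
    intro s t e F hst
    obtain ⟨rfl, rfl, h⟩ := F.off_diagonal hB hst hS
    refine ⟨∃ j, 𝓑.Btw (e (.x j)) (e .y) (e .z), ∃ j, 𝓑.Btw (e (.x j)) (e .z) (e .y), e, F,
      fun j => ⟨iff_of_false (h j).1 id, ⟨fun g => ⟨(h j).2.1 g, j, g⟩, ?_⟩,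
        ⟨fun g => ⟨(h j).2.2 g, j, g⟩, ?_⟩⟩⟩
    · rintro ⟨hj, k, hk⟩
      have := (h k).2.1 hk
      rwa [show j = k from Fin.ext (by omega)]
    · rintro ⟨hj, k, hk⟩
      have := (h k).2.2 hk
      rwa [show j = k from Fin.ext (by omega)]
  rcases lt_trichotomy s t with hst | rfl | hst
  · exact .inr (off s t e F hst)
  · left
    have h := F.diagonal hB hS
    refine ⟨∃ j : Fin N, (j : ℕ) + 1 = s ∧ 𝓑.Btw (e .y) (e (.x j)) (e .z),
      ∃ j : Fin N, (j : ℕ) = s ∧ 𝓑.Btw (e .y) (e (.x j)) (e .z), s, F.le_left, e, F,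
      fun j => ⟨⟨fun g => ?_, ?_⟩, iff_of_false (h j).1 id, iff_of_false (h j).2.1 id⟩⟩
    · exact ((h j).2.2 g).imp (fun h' => ⟨h', j, h', g⟩) (fun h' => ⟨h', j, h', g⟩)
    · rintro (⟨hj, k, hk, g⟩ | ⟨hj, k, hk, g⟩) <;> rwa [show j = k from Fin.ext (by omega)]
  · exact .inr (off t s _ F.swap hst)

/-- Every triangle is {y, z, x_j}, and in both normal forms at most two values of j give a collinear
triple. -/
theorem Frame.card_le {S : Finset 𝓑.carrier} {N s t : ℕ} {e : PathVertex N → 𝓑.carrier}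
    (hB : 𝓑.AlmostMetrizable) (F : 𝓑.Frame S N s t e) (hS : ¬ 𝓑.LinearOn S) :
    N ≤ (𝓑.triangles S).card + 2 ∧ (𝓑.triangles S).card ≤ N := by
  classical
  have key : ∀ {s t A B C}, 𝓑.HasType S N s t A B C → ∀ p q : ℕ,
      (∀ j, A j ∨ B j ∨ C j → j = p ∨ j = q) →
      N ≤ (𝓑.triangles S).card + 2 ∧ (𝓑.triangles S).card ≤ N := by
    intro s t A B C h p q hpq
    have h1 := h.card_triangles_eq hB
      ((Finset.range N).filter fun j => A j ∨ B j ∨ C j) (by simp; tauto) (by simp; tauto)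
    have h2 := Finset.card_le_card (s := (Finset.range N).filter fun j => A j ∨ B j ∨ C j)
      (t := {p, q}) fun j hj => by
        simpa using hpq j (Finset.mem_filter.1 hj).2
    have h3 := Finset.card_le_two (a := p) (b := q)
    omega
  rcases F.hasType hB hS with ⟨α, β, s, -, h⟩ | ⟨α, β, h⟩
  -- Truncation of `s - 1` at `s = 0` is harmless, because `j + 1 = s` has no solution then.
  · exact key h (s - 1) s fun j hj => by
      rcases hj with (⟨h, -⟩ | ⟨h, -⟩) | h | h
      · left; omega
      · exact .inr h
      · exact h.elim
      · exact h.elim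
  · exact key h 0 (N - 1) fun j hj => by
      rcases hj with h | ⟨h, -⟩ | ⟨h, -⟩
      · exact h.elim
      · exact .inl h
      · right; omega

end BetweennessStructure

/-! ### Three triangles through one point of a seven-point structure -/

namespace BetweennessStructure

variable {𝓑 : BetweennessStructure.{u}}

/-- For i < j, call (i, j) of kind L, R or M if x_i, x_j or p, respectively, is the middle one of p,
x_i, x_j, and matched if the three form a triangle. Kinds L and R pass to subintervals, and M passes
to larger intervals. So an interval that contains a matched pair is M unless its ends are matched.
The pairs (0,5), (0,4), (1,5) are not matched: otherwise the subinterval (0,4), (0,3) or (2,5),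
respectively, still contains a matched pair, is therefore M, and makes the larger interval M. Now
(0,4) and (1,5) contain matched pairs, so both are M. This makes (0,1) of kind R, (4,5) of kind L
and (1,4) of kind M. The partners of 0 and 5 can then only be 2 and 3, so 1 is matched with 4, a
contradiction. -/
theorem AlmostMetrizable.not_perfect_matching (hB : 𝓑.AlmostMetrizable) (p : 𝓑.carrier)
    (x : Fin 6 → 𝓑.carrier) (hx : ∀ i j k, 𝓑.Btw (x i) (x j) (x k) ↔ Nat.Between i j k)
    (hT : ∀ i j k, 𝓑.Tri p (x i) (x j) → 𝓑.Tri p (x i) (x k) → j = k)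
    (hT' : ∀ i, ∃ j, 𝓑.Tri p (x i) (x j)) : False := by
  have A := hB.antisymm
  have Y := hB.symm
  have F := hB.four_relations
  have hlt : ∀ i j k, i ≤ j → j ≤ k → 𝓑.Btw (x i) (x j) (x k) := fun i j k h1 h2 =>
    (hx i j k).2 (.inl ⟨h1, h2⟩)
  obtain ⟨L, hL⟩ : ∃ L : Fin 6 → Fin 6 → Prop, ∀ i j, L i j ↔ 𝓑.Btw p (x i) (x j) :=
    ⟨_, fun _ _ => Iff.rfl⟩
  obtain ⟨R, hR⟩ : ∃ R : Fin 6 → Fin 6 → Prop, ∀ i j, R i j ↔ 𝓑.Btw (x i) (x j) p :=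
    ⟨_, fun _ _ => Iff.rfl⟩
  obtain ⟨M, hM⟩ : ∃ M : Fin 6 → Fin 6 → Prop, ∀ i j, M i j ↔ 𝓑.Btw (x i) p (x j) :=
    ⟨_, fun _ _ => Iff.rfl⟩
  obtain ⟨T, hTT⟩ : ∃ T : Fin 6 → Fin 6 → Prop, ∀ i j, T i j ↔ 𝓑.Tri p (x i) (x j) :=
    ⟨_, fun _ _ => Iff.rfl⟩
  have Tsymm : ∀ i j, T i j → T j i := fun i j h =>
    (hTT _ _).2 (((hTT _ _).1 h).swap hB).rotate
  have Tirr : ∀ i, ¬ T i i := fun i h => ((hTT _ _).1 h).ne₂₃ hB rfl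
  have Tuniq : ∀ i j k, T i j → T i k → j = k := fun i j k h h' =>
    hT i j k ((hTT _ _).1 h) ((hTT _ _).1 h')
  have Tex : ∀ i, ∃ j, T i j := fun i => (hT' i).imp fun j h => (hTT _ _).2 h
  have Texc : ∀ i j, T i j ∨ L i j ∨ R i j ∨ M i j := fun i j => by
    rw [hTT, hL, hR, hM, Tri]
    have := Y (x j) p (x i)
    tauto
  have TL : ∀ i j, T i j → ¬ L i j ∧ ¬ R i j ∧ ¬ M i j := fun i j h => by
    rw [hTT] at h
    rw [hL, hR, hM]
    exact ⟨h.1, h.2.1, fun g => h.2.2 (Y _ _ _ g)⟩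
  have LR : ∀ i j, i < j → L i j → R i j → False := fun i j hij h1 h2 => by
    rw [hL] at h1
    rw [hR] at h2
    have h := A _ _ _ (Y _ _ _ h1) h2
    have := (hx j i j).1 (by rw [h]; exact hB.refl_left _ _)
    unfold Nat.Between at this
    omega
  have Ld : ∀ i j k l, i ≤ j → j < k → k ≤ l → L i l → L j k := fun i j k l h1 h2 h3 h => by
    rw [hL] at h ⊢
    have h4 := (F _ _ _ _ (Y _ _ _ h) (Y _ _ _ (hlt i k l (by omega) h3))).2
    exact Y _ _ _ (F _ _ _ _ h4 (Y _ _ _ (hlt i j k h1 h2.le))).1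
  have Rd : ∀ i j k l, i ≤ j → j < k → k ≤ l → R i l → R j k := fun i j k l h1 h2 h3 h => by
    rw [hR] at h ⊢
    have h4 := (F _ _ _ _ h (hlt i j l h1 (by omega))).2
    exact (F _ _ _ _ h4 (hlt j k l h2.le h3)).1
  have Mu : ∀ i j k l, i ≤ j → j < k → k ≤ l → M j k → M i l := fun i j k l h1 h2 h3 h => by
    rw [hM] at h ⊢
    have h4 := (F _ _ _ _ (Y _ _ _ (hlt i j k h1 h2.le)) (Y _ _ _ h)).1
    exact (F _ _ _ _ (hlt i k l (by omega) h3) (Y _ _ _ h4)).1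
  have ML : ∀ i j k, i < j → j < k → M i j → L j k := fun i j k h1 h2 h => by
    rw [hM] at h
    exact (hL _ _).2 (F _ _ _ _ (hlt i j k h1.le h2.le) h).2
  have MR : ∀ i j k, i < j → j < k → M j k → R i j := fun i j k h1 h2 h => by
    rw [hM] at h
    exact (hR _ _).2 (Y _ _ _ (F _ _ _ _ (Y _ _ _ (hlt i j k h1.le h2.le)) (Y _ _ _ h)).2)
  have MRM : ∀ i j k, M i k → R i j → M j k := fun i j k h h' => by
    rw [hM] at h ⊢
    exact (F _ _ _ _ h ((hR _ _).1 h')).2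
  have MLM : ∀ i j k, M i k → L j k → M i j := fun i j k h h' => by
    rw [hM] at h ⊢
    exact Y _ _ _ (F _ _ _ _ (Y _ _ _ h) (Y _ _ _ ((hL _ _).1 h'))).2
  have notLR : ∀ i j k l, i ≤ j → j < k → k ≤ l → T j k → ¬ L i l ∧ ¬ R i l := by
    intro i j k l h1 h2 h3 h
    exact ⟨fun g => (TL j k h).1 (Ld i j k l h1 h2 h3 g),
      fun g => (TL j k h).2.1 (Rd i j k l h1 h2 h3 g)⟩
  -- Only the propositional rules for the four kinds are kept; the finite search runs on selected
  -- instances of them.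
  clear hx hT hT' A Y F hlt hL hR hM hTT
  have t0 := Tex 0
  have t1 := Tex 1
  have t2 := Tex 2
  have t3 := Tex 3
  have t5 := Tex 5
  simp only [Fin.exists_fin_succ, Fin.exists_fin_zero, or_false] at t0 t1 t2 t3 t5
  simp only [Fin.isValue, Fin.reduceSucc, Tirr, false_or, or_false] at t0 t1 t2 t3 t5
  have c05 := Texc 0 5
  have c04 := Texc 0 4
  have c15 := Texc 1 5
  have c03 := Texc 0 3
  have c25 := Texc 2 5
  have r01 := MR 0 1 5 (by decide) (by decide)
  have l45 := ML 0 4 5 (by decide) (by decide)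
  have m1 := MRM 0 1 4
  have m2 := MLM 1 4 5
  have lr1 := LR 0 1 (by decide)
  have lr2 := LR 4 5 (by decide)
  have d1 := Ld 0 0 1 3 (by decide) (by decide) (by decide)
  have d2 := Rd 2 4 5 5 (by decide) (by decide) (by decide)
  have d3 := Ld 0 0 1 4 (by decide) (by decide) (by decide)
  have d4 := Rd 1 4 5 5 (by decide) (by decide) (by decide)
  have u1 := Mu 0 0 3 4 (by decide) (by decide) (by decide)
  have u2 := Mu 1 2 5 5 (by decide) (by decide) (by decide)
  have u3 := Mu 0 0 4 5 (by decide) (by decide) (by decide)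
  have u4 := Mu 0 1 5 5 (by decide) (by decide) (by decide)
  clear Texc Tex LR Ld Rd Mu ML MR MRM MLM
  grind

end BetweennessStructure

/-! ### A pair of points common to all triangles -/

open Classical in
-- Double counting of the incidences between `W` and the members of `𝒯`.
theorem Finset.mul_card_le_of_le_card_inter {α : Type*} {𝒯 : Finset (Finset α)} {W : Finset α}
    {k : ℕ} (h : ∀ T ∈ 𝒯, k ≤ (W ∩ T).card)
    (h' : ∀ a ∈ W, ({T ∈ 𝒯 | a ∈ T} : Finset (Finset α)).card ≤ 1) : 𝒯.card * k ≤ W.card := by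
  have h1 := Finset.sum_card_inter_le (B := 𝒯) (n := 1) h'
  have h2 := Finset.card_nsmul_le_sum 𝒯 (fun T => (W ∩ T).card) k h
  simp only [smul_eq_mul, mul_one] at h1 h2
  exact h2.trans h1

namespace BetweennessStructure

variable {𝓑 : BetweennessStructure.{u}}

open Classical in
theorem AlmostMetrizable.exists_third (hB : 𝓑.AlmostMetrizable) {S T : Finset 𝓑.carrier}
    (hT : T ∈ 𝓑.triangles S) {p q : 𝓑.carrier} (hp : p ∈ T) (hq : q ∈ T) (hpq : p ≠ q) :
    ∃ r ∈ S, T = {p, q, r} ∧ 𝓑.Tri p q r := by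
  obtain ⟨hTS, a, b, c, rfl, h⟩ := mem_triangles.1 hT
  simp only [Finset.insert_subset_iff, Finset.singleton_subset_iff] at hTS
  obtain ⟨ha, hb, hc⟩ := hTS
  simp only [Finset.mem_insert, Finset.mem_singleton] at hp hq
  have h1 := h.rotate
  have h2 := h1.rotate
  rcases hp with rfl | rfl | rfl <;> rcases hq with rfl | rfl | rfl <;>
    first
    | contradiction
    | exact ⟨_, hc, by ext; simp; try tauto, by first | exact h | exact h.swap hB⟩
    | exact ⟨_, ha, by ext; simp; try tauto, by first | exact h1 | exact h1.swap hB⟩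
    | exact ⟨_, hb, by ext; simp; try tauto, by first | exact h2 | exact h2.swap hB⟩

open Classical in
-- Without `q` the structure is linear, so the other six points are ordered. The three triangles
-- minus `q` are disjoint pairs and match these six points perfectly.
theorem AlmostMetrizable.not_sunflower (hB : 𝓑.AlmostMetrizable) {S : Finset 𝓑.carrier}
    (hS : S.card = 7) (h3 : (𝓑.triangles S).card = 3) {q : 𝓑.carrier} (hq : q ∈ S)
    (hqT : ∀ T ∈ 𝓑.triangles S, q ∈ T)
    (hdeg : ∀ r ∈ S, r ≠ q → ({T ∈ 𝓑.triangles S | r ∈ T} : Finset _).card ≤ 1) : False := by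
  have hlin : 𝓑.LinearOn (S.erase q) := by
    rw [linearOn_iff, triangles_erase, Finset.filter_eq_empty_iff]
    exact fun T hT h => h (hqT T hT)
  have hcard : (S.erase q).card = 6 := by rw [Finset.card_erase_of_mem hq, hS]
  obtain ⟨f, hf⟩ := hB.exists_coordinate hlin (by omega)
  obtain ⟨x, hxS, hxlt, hsurj⟩ := hf.exists_enum hcard
  have hxS' : ∀ i, x i ∈ S ∧ x i ≠ q := fun i => by
    have := Finset.mem_erase.1 (hxS i)
    exact ⟨this.2, this.1⟩
  have hxle : ∀ i j, f (x i) ≤ f (x j) ↔ i ≤ j := fun i j => by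
    rw [← not_lt, hxlt, not_lt]
  have hinj : Function.Injective x := fun i j h =>
    le_antisymm ((hxle i j).1 (by rw [h])) ((hxle j i).1 (by rw [h]))
  refine hB.not_perfect_matching q x (fun i j k => ?_) (fun i j k h1 h2 => ?_) (fun i => ?_)
  · rw [hf.btw_iff _ (hxS i) _ (hxS j) _ (hxS k)]
    simp only [Nat.Between, hxle, Fin.le_def]
  · have := Finset.card_le_one.1 (hdeg (x i) (hxS' i).1 (hxS' i).2) {q, x i, x j}
      (Finset.mem_filter.2 ⟨mem_triangles_of_tri hq (hxS' i).1 (hxS' j).1 h1, by simp⟩)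
      {q, x i, x k}
      (Finset.mem_filter.2 ⟨mem_triangles_of_tri hq (hxS' i).1 (hxS' k).1 h2, by simp⟩)
    have hm : x j ∈ ({q, x i, x k} : Finset 𝓑.carrier) := this ▸ (by simp)
    simp only [Finset.mem_insert, Finset.mem_singleton] at hm
    rcases hm with hm | hm | hm
    · exact absurd hm (hxS' j).2
    · exact absurd hm.symm (h1.ne₂₃ hB)
    · exact hinj hm
  · by_contra! hcon
    have hno : ∀ T ∈ 𝓑.triangles S, x i ∉ T := fun T hT hi => by
      obtain ⟨r, hr, -, h⟩ := hB.exists_third hT (hqT T hT) hi (hxS' i).2.symm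
      obtain ⟨j, rfl⟩ := hsurj r (Finset.mem_erase.2 ⟨(h.ne₁₃ hB).symm, hr⟩)
      exact hcon j h
    -- If x_i were unmatched, three disjoint pairs would fit into five points.
    have key := Finset.mul_card_le_of_le_card_inter (𝒯 := 𝓑.triangles S)
      (W := (S.erase q).erase (x i)) (k := 2) (fun T hT => ?_) (fun a ha => ?_)
    · rw [Finset.card_erase_of_mem (hxS i), hcard, h3] at key
      omega
    · have : ((S.erase q).erase (x i)) ∩ T = T.erase q := by
        ext v
        have hv := @(mem_triangles.1 hT).1 v
        simp only [Finset.mem_inter, Finset.mem_erase]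
        constructor
        · tauto
        · rintro ⟨h1, h2⟩
          exact ⟨⟨fun h => hno T hT (h ▸ h2), h1, hv h2⟩, h2⟩
      rw [this, Finset.card_erase_of_mem (hqT T hT), hB.card_of_mem_triangles hT]
    · simp only [Finset.mem_erase] at ha
      exact hdeg a ha.2.2 ha.2.1

open Classical in
theorem AlmostMetrizable.frame_of_kernel (hB : 𝓑.AlmostMetrizable) {S : Finset 𝓑.carrier}
    (h6 : 6 ≤ S.card)
    (h : ∃ y ∈ S, ∃ z ∈ S, y ≠ z ∧ ∀ T ∈ 𝓑.triangles S, y ∈ T ∧ z ∈ T) :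
    ∃ N s t e, N + 2 = S.card ∧ 𝓑.Frame S N s t e := by
  obtain ⟨y, hy, z, hz, hyz, hT⟩ := h
  obtain ⟨N, s, t, e, hN, F, -⟩ := hB.exists_frame hy hz hyz h6 fun a ha b hb c hc h => by
    have := hT _ (mem_triangles_of_tri ha hb hc h)
    simp only [Finset.mem_insert, Finset.mem_singleton] at this
    rwa [eq_comm (a := a), eq_comm (a := b), eq_comm (a := c), eq_comm (a := a), eq_comm (a := b),
      eq_comm (a := c)]
  exact ⟨N, s, t, e, hN, F⟩

theorem AlmostMetrizable.card_le_of_kernel (hB : 𝓑.AlmostMetrizable) {S : Finset 𝓑.carrier}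
    (h6 : 6 ≤ S.card)
    (h : ∃ y ∈ S, ∃ z ∈ S, y ≠ z ∧ ∀ T ∈ 𝓑.triangles S, y ∈ T ∧ z ∈ T)
    (hS : (𝓑.triangles S).card ≠ 0) :
    S.card ≤ (𝓑.triangles S).card + 4 ∧ (𝓑.triangles S).card + 2 ≤ S.card := by
  obtain ⟨N, s, t, e, hN, F⟩ := hB.frame_of_kernel h6 h
  have := F.card_le hB fun hl => hS (by rw [linearOn_iff.1 hl]; rfl)
  omega

open Classical in
/-- Few triangles share two points, unless there is a point whose removal leaves at least one, but
not too many, of them. -/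
theorem AlmostMetrizable.kernel_or_exists_erase (hB : 𝓑.AlmostMetrizable) {S : Finset 𝓑.carrier}
    (h7 : 7 ≤ S.card) (hm : (𝓑.triangles S).card + 11 ≤ 2 * S.card) :
    (∃ y ∈ S, ∃ z ∈ S, y ≠ z ∧ ∀ T ∈ 𝓑.triangles S, y ∈ T ∧ z ∈ T) ∨
    ∃ p ∈ S, (𝓑.triangles (S.erase p)).card ≠ 0 ∧
      (𝓑.triangles (S.erase p)).card + 13 ≤ 2 * S.card := by
  classical
  have deg_add : ∀ p, (𝓑.triangles (S.erase p)).card +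
      ({T ∈ 𝓑.triangles S | p ∈ T} : Finset _).card = (𝓑.triangles S).card := fun p => by
    rw [triangles_erase, add_comm]
    exact Finset.card_filter_add_card_filter_not _
  have mem_of : ∀ p, (𝓑.triangles (S.erase p)).card = 0 → ∀ T ∈ 𝓑.triangles S, p ∈ T := by
    intro p h T hT
    rw [triangles_erase, Finset.card_eq_zero, Finset.filter_eq_empty_iff] at h
    exact not_not.1 (h hT)
  have hT3 : ∀ T ∈ 𝓑.triangles S, T.card = 3 := fun T hT => hB.card_of_mem_triangles hT
  have hTS : ∀ T ∈ 𝓑.triangles S, T ⊆ S := fun T hT => (mem_triangles.1 hT).1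
  -- From here on, deleting a point either destroys all triangles or leaves at least 2|S| - 12 of
  -- them. As there are at most 2|S| - 11, a point of degree at least two must lie in every
  -- triangle.
  by_contra! hcon
  obtain ⟨hker, hdel⟩ := hcon
  have hm2 : 2 ≤ (𝓑.triangles S).card := by
    by_contra hlt
    have h1 : (𝓑.triangles S).card ≤ 1 := by omega
    rw [Finset.card_le_one] at h1
    rcases (𝓑.triangles S).eq_empty_or_nonempty with h0 | ⟨T, hT⟩
    · obtain ⟨y, hy, z, hz, hyz⟩ := Finset.one_lt_card.1 (by omega : 1 < S.card)
      obtain ⟨T, hT, -⟩ := hker y hy z hz hyz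
      rw [h0] at hT
      simp at hT
    · obtain ⟨y, hy, z, hz, hyz⟩ := Finset.one_lt_card.1 (by rw [hT3 T hT]; omega : 1 < T.card)
      obtain ⟨T', hT', h⟩ := hker y (hTS T hT hy) z (hTS T hT hz) hyz
      rw [h1 T' hT' T hT] at h
      exact h hy hz
  by_cases hq : ∃ q ∈ S, 2 ≤ ({T ∈ 𝓑.triangles S | q ∈ T} : Finset _).card
  · obtain ⟨q, hq, hq2⟩ := hq
    have := deg_add q
    have hq0 : (𝓑.triangles (S.erase q)).card = 0 := by
      by_contra h0
      have := hdel q hq h0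
      omega
    have hqT := mem_of q hq0
    have hdeg : ∀ r ∈ S, r ≠ q → ({T ∈ 𝓑.triangles S | r ∈ T} : Finset _).card ≤ 1 := by
      intro r hr hrq
      by_contra hr2
      have := deg_add r
      by_cases h0 : (𝓑.triangles (S.erase r)).card = 0
      · obtain ⟨T, hT, h⟩ := hker q hq r hr (Ne.symm hrq)
        exact h (hqT T hT) (mem_of r h0 T hT)
      · have := hdel r hr h0
        omega
    -- All triangles contain `q` and are disjoint otherwise, so 2m ≤ |S| - 1.
    have key := Finset.mul_card_le_of_le_card_inter (𝒯 := 𝓑.triangles S) (W := S.erase q) (k := 2)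
      (fun T hT => by
        have : (S.erase q) ∩ T = T.erase q := by
          ext v
          have := @hTS T hT v
          simp only [Finset.mem_inter, Finset.mem_erase]
          tauto
        rw [this, Finset.card_erase_of_mem (hqT T hT), hT3 T hT])
      (fun a ha => hdeg a (Finset.mem_erase.1 ha).2 (Finset.mem_erase.1 ha).1)
    rw [Finset.card_erase_of_mem hq] at key
    -- With one triangle to spare, deleting a point of degree one already keeps the bound. Otherwise
    -- m = 2|S| - 11, and 2m ≤ |S| - 1 gives |S| = 7 and m = 3.
    by_cases h : (𝓑.triangles S).card + 12 ≤ 2 * S.card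
    · obtain ⟨T, hT⟩ := Finset.card_pos.1 (by omega : 0 < (𝓑.triangles S).card)
      obtain ⟨r, hr, hrq⟩ := Finset.exists_mem_ne (by rw [hT3 T hT]; omega : 1 < T.card) q
      have h1 := hdeg r (hTS T hT hr) hrq
      have h2 := deg_add r
      have h3 : 0 < ({T ∈ 𝓑.triangles S | r ∈ T} : Finset _).card :=
        Finset.card_pos.2 ⟨T, Finset.mem_filter.2 ⟨hT, hr⟩⟩
      have h4 := hdel r (hTS T hT hr) (by omega)
      omega
    · exact hB.not_sunflower (by omega) (by omega) hq hqT hdeg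
  · push Not at hq
    -- Here the triangles are pairwise disjoint, so 3m ≤ |S|. Deleting a point of degree one then
    -- keeps the bound.
    have key := Finset.mul_card_le_of_le_card_inter (𝒯 := 𝓑.triangles S) (W := S) (k := 3)
      (fun T hT => by rw [Finset.inter_eq_right.2 (hTS T hT), hT3 T hT])
      (fun a ha => Nat.le_of_lt_succ (hq a ha))
    obtain ⟨T, hT⟩ := Finset.card_pos.1 (by omega : 0 < (𝓑.triangles S).card)
    obtain ⟨r, hr⟩ := Finset.card_pos.1 (by rw [hT3 T hT]; omega : 0 < T.card)
    have h1 := hq r (hTS T hT hr)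
    have h2 := deg_add r
    have h3 : 0 < ({T ∈ 𝓑.triangles S | r ∈ T} : Finset _).card :=
      Finset.card_pos.2 ⟨T, Finset.mem_filter.2 ⟨hT, hr⟩⟩
    have h4 := hdel r (hTS T hT hr) (by omega)
    omega

/-- The bound drops by two when a point is deleted, while `card_le_of_kernel` supplies about |S|
triangles once a common pair exists. The induction starts with six points, where there is at most
one triangle. -/
theorem AlmostMetrizable.exists_kernel (hB : 𝓑.AlmostMetrizable) (n : ℕ) :
    ∀ S : Finset 𝓑.carrier, S.card = n → 6 ≤ n → (𝓑.triangles S).card + 11 ≤ 2 * n →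
      ∃ y ∈ S, ∃ z ∈ S, y ≠ z ∧ ∀ T ∈ 𝓑.triangles S, y ∈ T ∧ z ∈ T := by
  classical
  induction n with
  | zero => intro S _ h; omega
  | succ n ih =>
    intro S hS h6 hm
    by_cases hn : n = 5
    · subst hn
      have h1 : (𝓑.triangles S).card ≤ 1 := by omega
      rw [Finset.card_le_one] at h1
      rcases (𝓑.triangles S).eq_empty_or_nonempty with h0 | ⟨T, hT⟩
      · obtain ⟨y, hy, z, hz, hyz⟩ := Finset.one_lt_card.1 (by omega : 1 < S.card)
        exact ⟨y, hy, z, hz, hyz, by simp [h0]⟩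
      · obtain ⟨y, hy, z, hz, hyz⟩ := Finset.one_lt_card.1
          (by rw [hB.card_of_mem_triangles hT]; omega : 1 < T.card)
        have hTS := (mem_triangles.1 hT).1
        exact ⟨y, hTS hy, z, hTS hz, hyz, fun T' hT' => by rw [h1 T' hT' T hT]; exact ⟨hy, hz⟩⟩
    rcases hB.kernel_or_exists_erase (S := S) (by omega) (by omega) with h | ⟨p, hp, h0, hle⟩
    · exact h
    have hcard : ∀ q ∈ S, (S.erase q).card = n := fun q hq => by
      rw [Finset.card_erase_of_mem hq]; omega
    have hker := ih _ (hcard p hp) (by omega) (by omega)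
    have hlow := (hB.card_le_of_kernel (by rw [hcard p hp]; omega) hker h0).1
    rw [hcard p hp] at hlow
    -- Here |S| = n + 1. A point `w` common to the triangles of `S.erase p` has degree at least n -
    -- 4, so deleting `w` leaves at most (2n - 9) - (n - 4) = n - 5 triangles. By induction a
    -- positive number would be at least n - 4, so none is left.
    have key : ∀ w ∈ S, (∀ T ∈ 𝓑.triangles (S.erase p), w ∈ T) → ∀ T ∈ 𝓑.triangles S, w ∈ T := by
      intro w hw hwT
      have h1 : (𝓑.triangles (S.erase p)).card ≤ ({T ∈ 𝓑.triangles S | w ∈ T} : Finset _).card := by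
        refine Finset.card_le_card fun T hT => Finset.mem_filter.2 ⟨?_, hwT T hT⟩
        rw [triangles_erase] at hT
        exact (Finset.mem_filter.1 hT).1
      have h2 : ({T ∈ 𝓑.triangles S | w ∈ T} : Finset _).card +
          (𝓑.triangles (S.erase w)).card = (𝓑.triangles S).card := by
        rw [triangles_erase]
        exact Finset.card_filter_add_card_filter_not _
      have h3 := ih _ (hcard w hw) (by omega) (by omega)
      have h4 : (𝓑.triangles (S.erase w)).card = 0 := by
        by_contra h0
        have := (hB.card_le_of_kernel (by rw [hcard w hw]; omega) h3 h0).1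
        rw [hcard w hw] at this
        omega
      rw [triangles_erase, Finset.card_eq_zero, Finset.filter_eq_empty_iff] at h4
      exact fun T hT => not_not.1 (h4 hT)
    obtain ⟨y, hy, z, hz, hyz, hT⟩ := hker
    have hy := Finset.mem_of_mem_erase hy
    have hz := Finset.mem_of_mem_erase hz
    exact ⟨y, hy, z, hz, hyz, fun T hT' =>
      ⟨key y hy (fun T hT'' => (hT T hT'').1) T hT', key z hz (fun T hT'' => (hT T hT'').2) T hT'⟩⟩

end BetweennessStructure

/-! ### A certificate for graph metrics -/

namespace WeightedGraph

variable {V : Type u}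

/-- A metric `d` with natural values that agrees with the graph metric of `W`. -/
structure IsMetric (W : WeightedGraph V) (d : V → V → ℕ) : Prop where
  eq_zero : ∀ a b, d a b = 0 ↔ a = b
  symm : ∀ a b, d a b = d b a
  triangle : ∀ a b c, d a c ≤ d a b + d b c
  le_weight : ∀ a b, W.graph.Adj a b → (d a b : ℝ) ≤ W.weight s(a, b)
  step : ∀ a c, a ≠ c → (∃ b, W.graph.Adj a b ∧ W.weight s(a, b) + d b c = d a c) ∨
    ∃ b, W.graph.Adj c b ∧ W.weight s(c, b) + d b a = d c a

namespace IsMetric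

variable {W : WeightedGraph V} {d : V → V → ℕ}

theorem le_walk (h : W.IsMetric d) {a b : V} (p : W.graph.Walk a b) :
    (d a b : ℝ) ≤ (p.edges.map W.weight).sum := by
  induction p with
  | nil => simp [(h.eq_zero _ _).2 rfl]
  | @cons a b c hab p ih =>
    have h1 := h.le_weight a b hab
    have h2 : (d a c : ℝ) ≤ d a b + d b c := by exact_mod_cast h.triangle a b c
    simp only [SimpleGraph.Walk.edges_cons, List.map_cons, List.sum_cons]
    linarith

/-- Each certified step has positive weight, so the remaining distance decreases. The step may start
from either end, and in the second case the walk is reversed. -/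
theorem exists_walk (h : W.IsMetric d) (n : ℕ) :
    ∀ a b, d a b = n → ∃ p : W.graph.Walk a b, (p.edges.map W.weight).sum = n := by
  induction n using Nat.strong_induction_on with
  | _ n ih =>
    have main : ∀ a b, d a b = n →
        (∃ c, W.graph.Adj a c ∧ W.weight s(a, c) + d c b = d a b) →
        ∃ p : W.graph.Walk a b, (p.edges.map W.weight).sum = n := by
      rintro a b rfl ⟨c, hac, hc⟩
      have hpos := W.weight_pos s(a, c) hac
      have hlt : d c b < d a b := by
        have : (d c b : ℝ) < d a b := by linarith
        exact_mod_cast this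
      obtain ⟨p, hp⟩ := ih _ hlt c b rfl
      exact ⟨.cons hac p, by simp [hp, hc]⟩
    intro a b hab
    by_cases hne : a = b
    · subst hne
      refine ⟨.nil, ?_⟩
      rw [(h.eq_zero a a).2 rfl] at hab
      simp [← hab]
    · rcases h.step a b hne with hs | hs
      · exact main a b hab hs
      · obtain ⟨p, hp⟩ := main b a ((h.symm b a).trans hab) hs
        exact ⟨p.reverse, by simp [List.sum_reverse, hp]⟩

theorem dist_eq (h : W.IsMetric d) (a b : V) : W.dist a b = d a b := by
  obtain ⟨p, hp⟩ := h.exists_walk _ a b rfl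
  have : Nonempty (W.graph.Walk a b) := ⟨p⟩
  refine le_antisymm ?_ (le_ciInf fun q => h.le_walk q)
  rw [← hp]
  exact ciInf_le ⟨(d a b : ℝ), by rintro _ ⟨q, rfl⟩; exact h.le_walk q⟩ p

variable [Finite V] [Nonempty V]

theorem btw_iff (h : W.IsMetric d) (a b c : V) :
    W.betweenness.Btw a b c ↔ d a c = d a b + d b c := by
  change W.dist a c = W.dist a b + W.dist b c ↔ _
  rw [h.dist_eq, h.dist_eq, h.dist_eq]
  exact_mod_cast Iff.rfl

theorem almostMetrizable (h : W.IsMetric d) : W.betweenness.AlmostMetrizable where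
  refl_left x z := by
    refine (h.btw_iff x x z).2 ?_
    have := (h.eq_zero x x).2 rfl
    omega
  symm x y z hx := by
    refine (h.btw_iff z y x).2 ?_
    have := (h.btw_iff x y z).1 hx
    have := h.symm x y
    have := h.symm y z
    have := h.symm x z
    omega
  antisymm x y z h1 h2 := by
    have := (h.btw_iff x y z).1 h1
    have := (h.btw_iff y x z).1 h2
    have := h.symm x y
    exact (h.eq_zero x y).1 (by omega)
  four_relations x y z w h1 h2 := by
    have h1 := (h.btw_iff x y z).1 h1
    have h2 := (h.btw_iff x w y).1 h2
    have h3 := h.triangle x w z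
    have h4 := h.triangle w y z
    exact ⟨(h.btw_iff x w z).2 (by omega), (h.btw_iff w y z).2 (by omega)⟩

end IsMetric

end WeightedGraph

/-! ### Metrics given by positions on a line and the distance of y and z -/

namespace PathVertex

variable {N : ℕ}

/-- The distance of the positions given by `P`, except for the pair `y`, `z`. -/
def dist (P : PathVertex N → ℕ) (δ : ℕ) : PathVertex N → PathVertex N → ℕ
  | .y, .z => δ
  | .z, .y => δ
  | a, b => (P a - P b) + (P b - P a)

/-- The pair `a`, `b` is not the pair `y`, `z`. -/
def Ordinary (a b : PathVertex N) : Prop := ¬ (a = .y ∧ b = .z) ∧ ¬ (a = .z ∧ b = .y)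

theorem dist_of_ordinary (P : PathVertex N → ℕ) (δ : ℕ) {a b : PathVertex N}
    (h : Ordinary a b) : dist P δ a b = (P a - P b) + (P b - P a) := by
  rcases a with _ | _ | _ <;> rcases b with _ | _ | _ <;> first | rfl | simp [Ordinary] at h

theorem dist_symm (P : PathVertex N → ℕ) (δ : ℕ) (a b : PathVertex N) :
    dist P δ a b = dist P δ b a := by
  rcases a with i | _ | _ <;> rcases b with j | _ | _ <;> simp [dist] <;> omega

theorem Ordinary.symm {a b : PathVertex N} (h : Ordinary a b) : Ordinary b a :=
  ⟨fun g => h.2 g.symm, fun g => h.1 g.symm⟩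

/-- Sufficient conditions for `PathVertex.dist` to be the graph metric of `W`. -/
structure Model (W : WeightedGraph (PathVertex N)) (P : PathVertex N → ℕ) (δ s t : ℕ) : Prop where
  le_left : s ≤ N
  le_right : t ≤ N
  le_iff_y : ∀ a b, a ≠ .z → b ≠ .z → (P a ≤ P b ↔ a.slot s ≤ b.slot s)
  le_iff_z : ∀ a b, a ≠ .y → b ≠ .y → (P a ≤ P b ↔ a.slot t ≤ b.slot t)
  pos : 0 < δ
  triangle : ∀ j, δ ≤ dist P δ .y (.x j) + dist P δ (.x j) .z ∧
    dist P δ .y (.x j) ≤ δ + dist P δ (.x j) .z ∧ dist P δ (.x j) .z ≤ dist P δ .y (.x j) + δ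
  le_weight : ∀ a b, W.graph.Adj a b → (dist P δ a b : ℝ) ≤ W.weight s(a, b)
  step_yz : ∃ b, W.graph.Adj .y b ∧ W.weight s(.y, b) + dist P δ b .z = δ
  step : ∀ a c, P a < P c → Ordinary a c →
    (∃ b, W.graph.Adj a b ∧ P a < P b ∧ P b ≤ P c ∧ Ordinary a b ∧ Ordinary b c ∧
      W.weight s(a, b) = P b - P a) ∨
    (∃ b, W.graph.Adj c b ∧ P a ≤ P b ∧ P b < P c ∧ Ordinary a b ∧ Ordinary b c ∧
      W.weight s(c, b) = P c - P b)

namespace Model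

variable {W : WeightedGraph (PathVertex N)} {P : PathVertex N → ℕ} {δ s t : ℕ}

theorem ne_of_ordinary (h : Model W P δ s t) {a b : PathVertex N} (hab : a ≠ b)
    (ho : Ordinary a b) : P a ≠ P b := by
  intro hP
  by_cases hz : a ≠ .z ∧ b ≠ .z
  · have h1 := h.le_iff_y a b hz.1 hz.2
    have h2 := h.le_iff_y b a hz.2 hz.1
    rcases a with i | _ | _ <;> rcases b with j | _ | _ <;> simp [slot, hP, Fin.ext_iff] at * <;> omega
  · have hy : a ≠ .y ∧ b ≠ .y := by
      rcases a with i | _ | _ <;> rcases b with j | _ | _ <;> simp [Ordinary] at *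
    have h1 := h.le_iff_z a b hy.1 hy.2
    have h2 := h.le_iff_z b a hy.2 hy.1
    rcases a with i | _ | _ <;> rcases b with j | _ | _ <;> simp [slot, hP, Fin.ext_iff] at * <;> omega

/-- Apart from the pair {y, z} the distance is the difference of positions. Hence only triples
containing both y and z need the separate triangle hypothesis. -/
theorem isMetric (h : Model W P δ s t) : W.IsMetric (dist P δ) where
  eq_zero a b := by
    by_cases ho : Ordinary a b
    · rw [dist_of_ordinary P δ ho]
      constructor
      · intro h0
        by_contra hab
        have := h.ne_of_ordinary hab ho
        omega
      · rintro rfl; omega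
    · have := h.pos
      rcases a with i | _ | _ <;> rcases b with j | _ | _ <;> simp [Ordinary, dist] at * <;> omega
  symm := dist_symm P δ
  triangle a b c := by
    have h1 := h.triangle
    have h2 := h.pos
    rcases a with i | _ | _ <;> rcases b with j | _ | _ <;> rcases c with k | _ | _ <;>
      simp only [dist] at * <;>
      first
      | omega
      | (have := h1 i; omega)
      | (have := h1 j; omega)
      | (have := h1 k; omega)
  le_weight := h.le_weight
  step := by
    have key : ∀ a c, P a < P c → Ordinary a c →
        (∃ b, W.graph.Adj a b ∧ W.weight s(a, b) + dist P δ b c = dist P δ a c) ∨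
        ∃ b, W.graph.Adj c b ∧ W.weight s(c, b) + dist P δ b a = dist P δ c a := by
      intro a c hac ho
      rcases h.step a c hac ho with ⟨b, hb, h1, h2, h3, h4, h5⟩ | ⟨b, hb, h1, h2, h3, h4, h5⟩
      · left
        refine ⟨b, hb, ?_⟩
        rw [h5, dist_of_ordinary P δ h4, dist_of_ordinary P δ ho, Nat.sub_eq_zero_of_le h2,
          Nat.sub_eq_zero_of_le hac.le, zero_add, zero_add, Nat.cast_sub h2, Nat.cast_sub hac.le]
        ring
      · right
        refine ⟨b, hb, ?_⟩
        rw [h5, dist_of_ordinary P δ h3.symm, dist_of_ordinary P δ ho.symm,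
          Nat.sub_eq_zero_of_le h1, Nat.sub_eq_zero_of_le hac.le, add_zero, add_zero,
          Nat.cast_sub h1, Nat.cast_sub hac.le]
        ring
    intro a c hac
    by_cases ho : Ordinary a c
    · rcases lt_or_gt_of_ne (h.ne_of_ordinary hac ho) with hlt | hlt
      · exact key a c hlt ho
      · exact (key c a hlt ho.symm).symm
    · have : (a = .y ∧ c = .z) ∨ (a = .z ∧ c = .y) := by
        unfold Ordinary at ho; tauto
      rcases this with ⟨rfl, rfl⟩ | ⟨rfl, rfl⟩
      · exact .inl h.step_yz
      · exact .inr h.step_yz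

theorem btw_iff_of_ne (h : Model W P δ s t) (a b c : PathVertex N)
    (ho : Ordinary a b ∧ Ordinary b c ∧ Ordinary a c) :
    W.betweenness.Btw a b c ↔ Nat.Between (P a) (P b) (P c) := by
  refine (h.isMetric.btw_iff a b c).trans ?_
  rw [dist_of_ordinary P δ ho.1, dist_of_ordinary P δ ho.2.1, dist_of_ordinary P δ ho.2.2]
  unfold Nat.Between
  omega

theorem hasType (h : Model W P δ s t) (S : Finset W.betweenness.carrier) (hS : ∀ a, a ∈ S) {A B C : ℕ → Prop}
    (hA : ∀ j, δ = dist P δ .y (.x j) + dist P δ (.x j) .z ↔ A j)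
    (hB : ∀ j, dist P δ (.x j) .z = dist P δ .y (.x j) + δ ↔ B j)
    (hC : ∀ j, dist P δ .y (.x j) = dist P δ (.x j) .z + δ ↔ C j) :
    W.betweenness.HasType S N s t A B C := by
  refine ⟨fun a => a, ⟨fun a b h => h, fun v => ⟨fun _ => ⟨v, rfl⟩, fun _ => hS v⟩, h.le_left,
    h.le_right, fun a b c ha hb hc => ?_, fun a b c ha hb hc => ?_⟩, fun j => ⟨?_, ?_, ?_⟩⟩
  · refine (h.btw_iff_of_ne a b c (by simp [Ordinary, ha, hb, hc])).trans ?_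
    simp only [Nat.Between, h.le_iff_y a b ha hb, h.le_iff_y b c hb hc, h.le_iff_y c b hc hb,
      h.le_iff_y b a hb ha]
  · refine (h.btw_iff_of_ne a b c (by simp [Ordinary, ha, hb, hc])).trans ?_
    simp only [Nat.Between, h.le_iff_z a b ha hb, h.le_iff_z b c hb hc, h.le_iff_z c b hc hb,
      h.le_iff_z b a hb ha]
  · exact (h.isMetric.btw_iff _ _ _).trans (hA j)
  · refine (h.isMetric.btw_iff _ _ _).trans ?_
    rw [← hB j, h.isMetric.symm (.x j) .y]
    rfl
  · refine (h.isMetric.btw_iff _ _ _).trans ?_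
    rw [← hC j, h.isMetric.symm (.x j) .y]
    rfl

end Model

end PathVertex

/-! ### Position functions and shortest steps -/

namespace PathVertex

variable {N : ℕ}

theorem isX_x (k : Fin N) (j : ℕ) : (x k).IsX j ↔ (k : ℕ) + 1 = j :=
  ⟨fun ⟨_, h, h'⟩ => by cases h; exact h', fun h => ⟨k, rfl, h⟩⟩

theorem isYZ_y : (y : PathVertex N).IsYZ := .inl rfl

theorem isYZ_z : (z : PathVertex N).IsYZ := .inr rfl

theorem exists_isX_isX {k l : Fin N} (h : (l : ℕ) = k + 1) :
    ∃ j, (x k).IsX j ∧ (x l).IsX (j + 1) :=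
  ⟨k + 1, ⟨k, rfl, rfl⟩, ⟨l, rfl, by omega⟩⟩

theorem exists_ne_isX_isX {i : ℕ} {k l : Fin N} (h : (l : ℕ) = k + 1) (hi : (l : ℕ) ≠ i) :
    ∃ j, j ≠ i ∧ (x k).IsX j ∧ (x l).IsX (j + 1) :=
  ⟨k + 1, by omega, ⟨k, rfl, rfl⟩, ⟨l, rfl, by omega⟩⟩

theorem le_weight_of_rel {P : PathVertex N → ℕ} {δ : ℕ} {r : PathVertex N → PathVertex N → Prop}
    {w : Sym2 (PathVertex N) → ℝ} (h : ∀ a b, r a b → (dist P δ a b : ℝ) ≤ w s(a, b))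
    (a b : PathVertex N) (hab : (SimpleGraph.fromRel r).Adj a b) :
    (dist P δ a b : ℝ) ≤ w s(a, b) := by
  rcases hab.2 with h' | h'
  · exact h a b h'
  · rw [dist_symm, Sym2.eq_swap]
    exact h b a h'

/-- Positions with `y` and `z` in front. -/
def frontPos : PathVertex N → ℕ
  | .x k => k + 1
  | .y => 0
  | .z => 0

/-- Positions with `y` and `z` one step behind `i` of the `x`s and `e` steps before the others. -/
def midPos (i e : ℕ) : PathVertex N → ℕ
  | .x k => if (k : ℕ) < i then k + 1 else k + 1 + e
  | .y => i + 1
  | .z => i + 1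

/-- Positions with `y` in front and `z` at the end, `e` steps behind the last `x`. -/
def endPos (e : ℕ) : PathVertex N → ℕ
  | .x k => k + 1
  | .y => 0
  | .z => N + e

/-- From the vertex with the larger position, one step towards the front shortens the distance. At
the first x the step goes to the target itself, which avoids ending at its partner among y and z. -/
theorem front_step {W : WeightedGraph (PathVertex N)}
    (h1 : ∀ k l : Fin N, (l : ℕ) = k + 1 →
      W.graph.Adj (.x l) (.x k) ∧ W.weight s(.x l, .x k) = 1)
    (h2 : ∀ k : Fin N, (k : ℕ) = 0 → (W.graph.Adj (.x k) .y ∧ W.weight s(.x k, .y) = 1) ∧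
      (W.graph.Adj (.x k) .z ∧ W.weight s(.x k, .z) = 1)) (a c : PathVertex N)
    (hac : frontPos a < frontPos c) :
    ∃ b, W.graph.Adj c b ∧ frontPos a ≤ frontPos b ∧ frontPos b < frontPos c ∧ Ordinary a b ∧
      Ordinary b c ∧ W.weight s(c, b) = frontPos c - frontPos b := by
  rcases c with l | _ | _ <;> simp only [frontPos, not_lt_zero] at hac
  by_cases hl : (l : ℕ) = 0
  · obtain ⟨h3, h4⟩ := h2 l hl
    rcases a with i | _ | _
    · simp only at hac; omega
    · exact ⟨.y, h3.1, by simp [frontPos], by simp [frontPos], by simp [Ordinary],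
        by simp [Ordinary], by rw [h3.2]; simp [frontPos, hl]⟩
    · exact ⟨.z, h4.1, by simp [frontPos], by simp [frontPos], by simp [Ordinary],
        by simp [Ordinary], by rw [h4.2]; simp [frontPos, hl]⟩
  · have hk : (l : ℕ) - 1 < N := by omega
    have h3 := h1 ⟨l - 1, hk⟩ l (by simp only; omega)
    refine ⟨.x ⟨l - 1, hk⟩, h3.1, ?_, ?_, by simp [Ordinary], by simp [Ordinary], ?_⟩
    · rcases a with i | _ | _ <;> simp only [frontPos] at * <;> omega
    · simp only [frontPos]; omega
    · rw [h3.2]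
      simp only [frontPos]
      rw [← Nat.cast_sub (by omega)]
      have : (l : ℕ) + 1 - (l - 1 + 1) = 1 := by omega
      rw [this, Nat.cast_one]

theorem frontPos_le_iff (a b : PathVertex N) : frontPos a ≤ frontPos b ↔ a.slot 0 ≤ b.slot 0 := by
  rcases a with i | _ | _ <;> rcases b with j | _ | _ <;> simp [frontPos, slot]

theorem midPos_le_iff {i e : ℕ} (he : 1 ≤ e) (a b : PathVertex N) :
    midPos i e a ≤ midPos i e b ↔ a.slot i ≤ b.slot i := by
  rcases a with k | _ | _ <;> rcases b with l | _ | _ <;> simp only [midPos, slot] <;>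
    (try split_ifs) <;> omega

/-- Upward steps when `y` and `z` are put between `x i` and `x (i + 1)`. -/
theorem mid_step {W : WeightedGraph (PathVertex N)} {i e : ℕ} (hiN : i < N)
    (he : 1 ≤ e)
    (h1 : ∀ k l : Fin N, (l : ℕ) = k + 1 → (l : ℕ) ≠ i →
      W.graph.Adj (.x k) (.x l) ∧ W.weight s(.x k, .x l) = 1)
    (h2 : ∀ (k : Fin N) (v : PathVertex N), (k : ℕ) + 1 = i → v.IsYZ →
      W.graph.Adj (.x k) v ∧ W.weight s(.x k, v) = 1)
    (h3 : ∀ (k : Fin N) (v : PathVertex N), (k : ℕ) = i → v.IsYZ →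
      W.graph.Adj v (.x k) ∧ W.weight s(v, .x k) = e) (a c : PathVertex N)
    (hac : midPos i e a < midPos i e c) :
    ∃ b, W.graph.Adj a b ∧ midPos i e a < midPos i e b ∧ midPos i e b ≤ midPos i e c ∧
      Ordinary a b ∧ Ordinary b c ∧ W.weight s(a, b) = midPos i e b - midPos i e a := by
  have up : ∀ v : PathVertex N, v.IsYZ → midPos i e v < midPos i e c →
      ∃ b, W.graph.Adj v b ∧ midPos i e v < midPos i e b ∧ midPos i e b ≤ midPos i e c ∧
        Ordinary v b ∧ Ordinary b c ∧ W.weight s(v, b) = midPos i e b - midPos i e v := by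
    intro v hv hvc
    obtain ⟨h4, h5⟩ := h3 ⟨i, hiN⟩ v rfl hv
    have hP : midPos i e (.x (⟨i, hiN⟩ : Fin N)) = i + 1 + e := by simp [midPos]
    have hPv : midPos i e v = i + 1 := by rcases hv with rfl | rfl <;> rfl
    refine ⟨.x ⟨i, hiN⟩, h4, by omega, ?_, by simp [Ordinary], by simp [Ordinary], ?_⟩
    · rw [hPv] at hvc
      rw [hP]
      rcases c with l | _ | _ <;> simp only [midPos] at * <;> split_ifs at * <;> omega
    · rw [h5, hP, hPv]
      push_cast
      ring
  rcases a with k | _ | _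
  · by_cases hk : (k : ℕ) + 1 = i
    · have hPk : midPos i e (.x k) = i := by simp only [midPos]; split_ifs <;> omega
      -- The path crosses the gap through y, except when z is the target.
      have main : ∀ v : PathVertex N, v.IsYZ → Ordinary v c → ∃ b, W.graph.Adj (.x k) b ∧
          midPos i e (.x k) < midPos i e b ∧ midPos i e b ≤ midPos i e c ∧ Ordinary (.x k) b ∧
          Ordinary b c ∧ W.weight s(.x k, b) = midPos i e b - midPos i e (.x k) := by
        intro v hv hvc
        obtain ⟨h4, h5⟩ := h2 k v hk hv
        have hPv : midPos i e v = i + 1 := by rcases hv with rfl | rfl <;> rfl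
        refine ⟨v, h4, by omega, by omega, by simp [Ordinary], hvc, ?_⟩
        rw [h5, hPv, hPk]
        push_cast
        ring
      rcases c with l | _ | _
      · exact main .y isYZ_y (by simp [Ordinary])
      · exact main .y isYZ_y (by simp [Ordinary])
      · exact main .z isYZ_z (by simp [Ordinary])
    · have hkN : (k : ℕ) + 1 < N := by
        by_contra hcon
        rcases c with l | _ | _ <;> simp only [midPos] at * <;> split_ifs at * <;> omega
      obtain ⟨h4, h5⟩ := h1 k ⟨k + 1, hkN⟩ rfl hk
      have hP : midPos i e (.x ⟨k + 1, hkN⟩) = midPos i e (.x k) + 1 := by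
        simp only [midPos]; split_ifs <;> omega
      refine ⟨.x ⟨k + 1, hkN⟩, h4, by omega, by omega, by simp [Ordinary], by simp [Ordinary], ?_⟩
      rw [h5, hP]
      push_cast
      ring
  · exact up .y isYZ_y hac
  · exact up .z isYZ_z hac

end PathVertex

/-! ### Graph metrics and types of the families Q, R and S -/

namespace BetweennessStructure

open PathVertex

theorem Q2_model (n : ℕ) : Model (WeightedGraph.ofSimple (SimpleGraph.fromRel
    fun a b : PathVertex (n - 2) => (∃ j, a.IsX j ∧ b.IsX (j + 1)) ∨ (a.IsYZ ∧ b.IsX 1) ∨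
      (a = y ∧ b = z))) frontPos 1 0 0 where
  le_left := Nat.zero_le _
  le_right := Nat.zero_le _
  le_iff_y a b _ _ := frontPos_le_iff a b
  le_iff_z a b _ _ := frontPos_le_iff a b
  pos := one_pos
  triangle j := by simp only [PathVertex.dist, frontPos]; omega
  le_weight := le_weight_of_rel (w := fun _ => 1) fun a b h => by
    suffices PathVertex.dist frontPos 1 a b ≤ 1 by exact_mod_cast this
    rcases h with ⟨_, ⟨k, rfl, hk⟩, l, rfl, hl⟩ | ⟨rfl | rfl, l, rfl, hl⟩ | ⟨rfl, rfl⟩ <;>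
      simp only [PathVertex.dist, frontPos] <;> omega
  step_yz := ⟨.z, ⟨by simp, .inl (.inr (.inr ⟨rfl, rfl⟩))⟩, by
    simp [WeightedGraph.ofSimple, PathVertex.dist, frontPos]⟩
  step a c hac _ := by
    refine .inr (front_step ?_ ?_ a c hac)
    · intro k l hkl
      exact ⟨⟨by simp [Fin.ext_iff, hkl], .inr (.inl (exists_isX_isX hkl))⟩, rfl⟩
    · intro k hk
      exact ⟨⟨⟨by simp, .inr (.inr (.inl ⟨isYZ_y, (isX_x _ _).2 (by omega)⟩))⟩, rfl⟩,
        ⟨⟨by simp, .inr (.inr (.inl ⟨isYZ_z, (isX_x _ _).2 (by omega)⟩))⟩, rfl⟩⟩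

theorem Q3_model (n : ℕ) (hn : 3 ≤ n) : Model (WeightedGraph.ofSimple (SimpleGraph.fromRel
    fun a b : PathVertex (n - 2) => (∃ j, a.IsX j ∧ b.IsX (j + 1)) ∨ (a.IsYZ ∧ b.IsX 1)))
    frontPos 2 0 0 where
  le_left := Nat.zero_le _
  le_right := Nat.zero_le _
  le_iff_y a b _ _ := frontPos_le_iff a b
  le_iff_z a b _ _ := frontPos_le_iff a b
  pos := two_pos
  triangle j := by simp only [PathVertex.dist, frontPos]; omega
  le_weight := le_weight_of_rel (w := fun _ => 1) fun a b h => by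
    suffices PathVertex.dist frontPos 2 a b ≤ 1 by exact_mod_cast this
    rcases h with ⟨_, ⟨k, rfl, hk⟩, l, rfl, hl⟩ | ⟨rfl | rfl, l, rfl, hl⟩ <;>
      simp only [PathVertex.dist, frontPos] <;> omega
  step_yz := ⟨.x ⟨0, by omega⟩, ⟨by simp, .inl (.inr ⟨isYZ_y, (isX_x _ _).2 rfl⟩)⟩, by
    simp only [WeightedGraph.ofSimple, PathVertex.dist, frontPos]; norm_num⟩
  step a c hac _ := by
    refine .inr (front_step ?_ ?_ a c hac)
    · intro k l hkl
      exact ⟨⟨by simp [Fin.ext_iff, hkl], .inr (.inl (exists_isX_isX hkl))⟩, rfl⟩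
    · intro k hk
      exact ⟨⟨⟨by simp, .inr (.inr ⟨isYZ_y, (isX_x _ _).2 (by omega)⟩)⟩, rfl⟩,
        ⟨⟨by simp, .inr (.inr ⟨isYZ_z, (isX_x _ _).2 (by omega)⟩)⟩, rfl⟩⟩

end BetweennessStructure

namespace PathVertex

variable {N : ℕ}

theorem IsYZ.ne_x {v : PathVertex N} (h : v.IsYZ) (k : Fin N) : v ≠ x k := by
  rcases h with rfl | rfl <;> simp

theorem endPos_le_iff_y {e : ℕ} (a b : PathVertex N) (ha : a ≠ .z) (hb : b ≠ .z) :
    endPos e a ≤ endPos e b ↔ a.slot 0 ≤ b.slot 0 := by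
  rcases a with k | _ | _ <;> rcases b with l | _ | _ <;> simp [endPos, slot] at *

theorem endPos_le_iff_z {e : ℕ} (he : 1 ≤ e) (a b : PathVertex N) (ha : a ≠ .y) (hb : b ≠ .y) :
    endPos e a ≤ endPos e b ↔ a.slot N ≤ b.slot N := by
  rcases a with k | _ | _ <;> rcases b with l | _ | _ <;> simp [endPos, slot] at * <;> omega

/-- Downward steps when `y` is put in front and `z` at the end. -/
theorem end_step {W : WeightedGraph (PathVertex N)} {e : ℕ} (he : 1 ≤ e) (hN : 1 ≤ N)
    (h1 : ∀ k l : Fin N, (l : ℕ) = k + 1 →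
      W.graph.Adj (.x l) (.x k) ∧ W.weight s(.x l, .x k) = 1)
    (h2 : ∀ k : Fin N, (k : ℕ) = 0 → W.graph.Adj (.x k) .y ∧ W.weight s(.x k, .y) = 1)
    (h3 : ∀ k : Fin N, (k : ℕ) + 1 = N → W.graph.Adj .z (.x k) ∧ W.weight s(.z, .x k) = e)
    (a c : PathVertex N) (hac : endPos e a < endPos e c) (ho : Ordinary a c) :
    ∃ b, W.graph.Adj c b ∧ endPos e a ≤ endPos e b ∧ endPos e b < endPos e c ∧ Ordinary a b ∧
      Ordinary b c ∧ W.weight s(c, b) = endPos e c - endPos e b := by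
  rcases c with l | _ | _
  · by_cases hl : (l : ℕ) = 0
    · obtain ⟨h4, h5⟩ := h2 l hl
      have ha : a = .y := by
        rcases a with k | _ | _ <;> simp only [endPos] at hac <;> first | rfl | omega
      subst ha
      exact ⟨.y, h4, le_rfl, by simp [endPos], by simp [Ordinary], by simp [Ordinary],
        by rw [h5]; simp [endPos, hl]⟩
    · have hk : (l : ℕ) - 1 < N := by omega
      obtain ⟨h4, h5⟩ := h1 ⟨l - 1, hk⟩ l (by simp only; omega)
      have hP : endPos e (.x l) = endPos e (.x (⟨l - 1, hk⟩ : Fin N)) + 1 := by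
        simp only [endPos]; omega
      refine ⟨.x ⟨l - 1, hk⟩, h4, by omega, by omega, by simp [Ordinary], by simp [Ordinary], ?_⟩
      rw [h5, hP]
      push_cast
      ring
  · simp [endPos] at hac
  · have hk : N - 1 < N := by omega
    obtain ⟨h4, h5⟩ := h3 ⟨N - 1, hk⟩ (by simp only; omega)
    have hP : endPos e (.x (⟨N - 1, hk⟩ : Fin N)) = N := by simp only [endPos]; omega
    have hz : endPos e (.z : PathVertex N) = N + e := rfl
    refine ⟨.x ⟨N - 1, hk⟩, h4, ?_, by omega, by simp [Ordinary], by simp [Ordinary], ?_⟩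
    · rw [hP]
      rcases a with k | _ | _
      · simp only [endPos]; omega
      · exact Nat.zero_le _
      · exact absurd hac (lt_irrefl _)
    · rw [h5, hP, hz]
      push_cast
      ring

end PathVertex

namespace BetweennessStructure

open PathVertex

theorem R2_model (n i : ℕ) (hin : i < n - 2) :
    Model (WeightedGraph.ofSimple (SimpleGraph.fromRel fun a b : PathVertex (n - 2) =>
      (∃ j, j ≠ i ∧ a.IsX j ∧ b.IsX (j + 1)) ∨ (a.IsYZ ∧ (b.IsX i ∨ b.IsX (i + 1))) ∨
      (a = y ∧ b = z))) (midPos i 1) 1 i i where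
  le_left := hin.le
  le_right := hin.le
  le_iff_y a b _ _ := midPos_le_iff le_rfl a b
  le_iff_z a b _ _ := midPos_le_iff le_rfl a b
  pos := one_pos
  triangle j := by simp only [PathVertex.dist, midPos]; split_ifs <;> omega
  le_weight := le_weight_of_rel (w := fun _ => 1) fun a b h => by
    suffices PathVertex.dist (midPos i 1) 1 a b ≤ 1 by exact_mod_cast this
    rcases h with ⟨_, hj, ⟨k, rfl, hk⟩, l, rfl, hl⟩ |
      ⟨rfl | rfl, ⟨l, rfl, hl⟩ | ⟨l, rfl, hl⟩⟩ | ⟨rfl, rfl⟩ <;>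
      simp only [PathVertex.dist, midPos] <;> (try split_ifs) <;> omega
  step_yz := ⟨.z, ⟨by simp, .inl (.inr (.inr ⟨rfl, rfl⟩))⟩, by
    simp [WeightedGraph.ofSimple, PathVertex.dist]⟩
  step a c hac _ := by
    refine .inl (mid_step hin le_rfl ?_ ?_ ?_ a c hac)
    · intro k l hkl hl
      exact ⟨⟨by simp [Fin.ext_iff, hkl], .inl (.inl (exists_ne_isX_isX hkl hl))⟩, rfl⟩
    · intro k v hk hv
      exact ⟨⟨(hv.ne_x k).symm, .inr (.inr (.inl ⟨hv, .inl ((isX_x _ _).2 hk)⟩))⟩, rfl⟩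
    · intro k v hk hv
      exact ⟨⟨hv.ne_x k, .inl (.inr (.inl ⟨hv, .inr ((isX_x _ _).2 (by omega))⟩))⟩,
        by simp [WeightedGraph.ofSimple]⟩

theorem R4_model (n i : ℕ) (hin : i < n - 2) :
    Model (WeightedGraph.ofSimple (SimpleGraph.fromRel fun a b : PathVertex (n - 2) =>
      (∃ j, j ≠ i ∧ a.IsX j ∧ b.IsX (j + 1)) ∨ (a.IsYZ ∧ (b.IsX i ∨ b.IsX (i + 1)))))
      (midPos i 1) 2 i i where
  le_left := hin.le
  le_right := hin.le
  le_iff_y a b _ _ := midPos_le_iff le_rfl a b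
  le_iff_z a b _ _ := midPos_le_iff le_rfl a b
  pos := two_pos
  triangle j := by simp only [PathVertex.dist, midPos]; split_ifs <;> omega
  le_weight := le_weight_of_rel (w := fun _ => 1) fun a b h => by
    suffices PathVertex.dist (midPos i 1) 2 a b ≤ 1 by exact_mod_cast this
    rcases h with ⟨_, hj, ⟨k, rfl, hk⟩, l, rfl, hl⟩ |
      ⟨rfl | rfl, ⟨l, rfl, hl⟩ | ⟨l, rfl, hl⟩⟩ <;>
      simp only [PathVertex.dist, midPos] <;> (try split_ifs) <;> omega
  step_yz := by
    refine ⟨.x ⟨i, hin⟩, ⟨by simp, .inl (.inr ⟨isYZ_y, .inr ((isX_x _ _).2 rfl)⟩)⟩, ?_⟩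
    have : PathVertex.dist (midPos i 1) 2 (.x ⟨i, hin⟩) .z = 1 := by
      simp [PathVertex.dist, midPos]
    rw [this]
    simp only [WeightedGraph.ofSimple]
    norm_num
  step a c hac _ := by
    refine .inl (mid_step hin le_rfl ?_ ?_ ?_ a c hac)
    · intro k l hkl hl
      exact ⟨⟨by simp [Fin.ext_iff, hkl], .inl (.inl (exists_ne_isX_isX hkl hl))⟩, rfl⟩
    · intro k v hk hv
      exact ⟨⟨(hv.ne_x k).symm, .inr (.inr ⟨hv, .inl ((isX_x _ _).2 hk)⟩)⟩, rfl⟩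
    · intro k v hk hv
      exact ⟨⟨hv.ne_x k, .inl (.inr ⟨hv, .inr ((isX_x _ _).2 (by omega))⟩)⟩,
        by simp [WeightedGraph.ofSimple]⟩

/-- The edges of weight 2 push the later x's two steps behind y and z. The distance 2 of y and z is
therefore attained through x_i but not through x_{i+1}, so a single x lies between them. -/
theorem R3_almostMetrizable_and_hasType (n i : ℕ) (hi : 1 ≤ i) (hin : i < n - 2) :
    (R3 n i).AlmostMetrizable ∧ ∀ S : Finset (R3 n i).carrier, (∀ a, a ∈ S) →
      (R3 n i).HasType S (n - 2) i i (fun j => j + 1 = i) (fun _ => False) (fun _ => False) := by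
  classical
  have hw : ∀ e : Sym2 (PathVertex (n - 2)), (1 : ℝ) ≤
      if ∃ a b, e = s(a, b) ∧ a.IsYZ ∧ b.IsX (i + 1) then 2 else 1 := fun e => by
    split_ifs <;> norm_num
  have hw1 : ∀ (k : Fin (n - 2)) (v : PathVertex (n - 2)), (k : ℕ) ≠ i ∨ ¬ v.IsYZ → ¬ v.IsX (i + 1) →
      ¬ ∃ a b, s(.x k, v) = s(a, b) ∧ a.IsYZ ∧ b.IsX (i + 1) := by
    rintro k v hk hv ⟨a, b, h, ha, hb⟩
    rcases Sym2.eq_iff.1 h with ⟨rfl, rfl⟩ | ⟨rfl, rfl⟩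
    · exact ha.ne_x k rfl
    · rw [isX_x] at hb
      rcases hk with hk | hk
      · omega
      · exact hk ha
  have M : Model (N := n - 2)
      { graph := SimpleGraph.fromRel fun a b =>
          (∃ j, j ≠ i ∧ a.IsX j ∧ b.IsX (j + 1)) ∨ (a.IsYZ ∧ (b.IsX i ∨ b.IsX (i + 1)))
        weight := fun e => if ∃ a b, e = s(a, b) ∧ a.IsYZ ∧ b.IsX (i + 1) then 2 else 1
        weight_pos := fun e _ => by split_ifs <;> norm_num } (midPos i 2) 2 i i :=
    { le_left := hin.le
      le_right := hin.le
      le_iff_y := fun a b _ _ => midPos_le_iff one_le_two a b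
      le_iff_z := fun a b _ _ => midPos_le_iff one_le_two a b
      pos := two_pos
      triangle := fun j => by simp only [PathVertex.dist, midPos]; split_ifs <;> omega
      le_weight := le_weight_of_rel fun a b h => by
        have key : PathVertex.dist (midPos i 2) 2 a b ≤ 1 ∨
            PathVertex.dist (midPos i 2) 2 a b ≤ 2 ∧ a.IsYZ ∧ b.IsX (i + 1) := by
          rcases h with ⟨_, hj, ⟨k, rfl, hk⟩, l, rfl, hl⟩ | ⟨ha, ⟨l, rfl, hl⟩ | ⟨l, rfl, hl⟩⟩
          · left
            simp only [PathVertex.dist, midPos]; split_ifs <;> omega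
          · left
            rcases ha with rfl | rfl <;> simp only [PathVertex.dist, midPos] <;> split_ifs <;> omega
          · refine .inr ⟨?_, ha, l, rfl, hl⟩
            rcases ha with rfl | rfl <;> simp only [PathVertex.dist, midPos] <;> split_ifs <;> omega
        rcases key with h1 | ⟨h1, ha, hb⟩
        · exact le_trans (by exact_mod_cast h1) (hw s(a, b))
        · dsimp only
          rw [if_pos ⟨a, b, rfl, ha, hb⟩]
          exact_mod_cast h1
      step_yz := by
        refine ⟨.x ⟨i - 1, by omega⟩,
          ⟨by simp, .inl (.inr ⟨isYZ_y, .inl ((isX_x _ _).2 (by simp only; omega))⟩)⟩, ?_⟩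
        have h1 : PathVertex.dist (midPos i 2) 2 (.x (⟨i - 1, by omega⟩ : Fin (n - 2))) .z = 1 := by
          simp only [PathVertex.dist, midPos]; split_ifs <;> omega
        rw [h1, Sym2.eq_swap]
        dsimp only
        rw [if_neg (hw1 _ _ (.inl (by simp only; omega)) (fun ⟨_, h, _⟩ => by cases h))]
        norm_num
      step := fun a c hac _ => by
        refine .inl (mid_step hin one_le_two ?_ ?_ ?_ a c hac)
        · intro k l hkl hl
          refine ⟨⟨by simp [Fin.ext_iff, hkl], .inl (.inl (exists_ne_isX_isX hkl hl))⟩, ?_⟩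
          exact if_neg (hw1 _ _ (.inr fun h => h.ne_x l rfl)
            (fun h => by rw [isX_x] at h; omega))
        · intro k v hk hv
          refine ⟨⟨(hv.ne_x k).symm, .inr (.inr ⟨hv, .inl ((isX_x _ _).2 hk)⟩)⟩, ?_⟩
          exact if_neg (hw1 _ _ (.inl (by omega)) (fun ⟨_, h, _⟩ => hv.ne_x _ h))
        · intro k v hk hv
          have hX : (PathVertex.x k).IsX (i + 1) := (isX_x _ _).2 (by omega)
          refine ⟨⟨hv.ne_x k, .inl (.inr ⟨hv, .inr hX⟩)⟩, ?_⟩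
          dsimp only
          rw [if_pos ⟨v, .x k, rfl, hv, hX⟩, Nat.cast_ofNat] }
  refine ⟨M.isMetric.almostMetrizable, fun S hS => M.hasType S hS ?_ ?_ ?_⟩ <;>
    (intro j; simp only [PathVertex.dist, midPos, iff_false]; split_ifs <;> omega)

end BetweennessStructure

namespace BetweennessStructure

open PathVertex

theorem Q2_almostMetrizable_and_hasType (n : ℕ) :
    (Q2 n).AlmostMetrizable ∧ ∀ S : Finset (Q2 n).carrier, (∀ a, a ∈ S) →
      (Q2 n).HasType S (n - 2) 0 0 (fun _ => False) (fun _ => False) (fun _ => False) := by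
  have M := Q2_model n
  refine ⟨M.isMetric.almostMetrizable, fun S hS => M.hasType S hS ?_ ?_ ?_⟩ <;>
    (intro j; simp only [PathVertex.dist, frontPos, iff_false]; omega)

theorem Q3_almostMetrizable_and_hasType (n : ℕ) (hn : 3 ≤ n) :
    (Q3 n).AlmostMetrizable ∧ ∀ S : Finset (Q3 n).carrier, (∀ a, a ∈ S) →
      (Q3 n).HasType S (n - 2) 0 0 (fun j => j = 0) (fun _ => False) (fun _ => False) := by
  have M := Q3_model n hn
  refine ⟨M.isMetric.almostMetrizable, fun S hS => M.hasType S hS ?_ ?_ ?_⟩ <;>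
    (intro j; simp only [PathVertex.dist, frontPos, iff_false]; omega)

theorem R2_almostMetrizable_and_hasType (n i : ℕ) (hin : i < n - 2) :
    (R2 n i).AlmostMetrizable ∧ ∀ S : Finset (R2 n i).carrier, (∀ a, a ∈ S) →
      (R2 n i).HasType S (n - 2) i i (fun _ => False) (fun _ => False) (fun _ => False) := by
  have M := R2_model n i hin
  refine ⟨M.isMetric.almostMetrizable, fun S hS => M.hasType S hS ?_ ?_ ?_⟩ <;>
    (intro j; simp only [PathVertex.dist, midPos, iff_false]; split_ifs <;> omega)

theorem R4_almostMetrizable_and_hasType (n i : ℕ) (hin : i < n - 2) :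
    (R4 n i).AlmostMetrizable ∧ ∀ S : Finset (R4 n i).carrier, (∀ a, a ∈ S) →
      (R4 n i).HasType S (n - 2) i i (fun j => j + 1 = i ∨ j = i) (fun _ => False)
        (fun _ => False) := by
  have M := R4_model n i hin
  refine ⟨M.isMetric.almostMetrizable, fun S hS => M.hasType S hS ?_ ?_ ?_⟩ <;>
    (intro j; simp only [PathVertex.dist, midPos, iff_false]; split_ifs <;> omega)

/-- One computation for the three graphs S. The weight δ of the edge yz is admissible if n - 4 + e ≤
δ. Equality means that y is between x_1 and z, which happens for S^3 and S^4. Likewise z is between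
x_{n-2} and y if δ = n - 2 - e, which happens for S^4 only. As δ ≤ n - 2, no x is between y and z.
-/
theorem end_model {n e δ : ℕ} (hn : 3 ≤ n) (he : 1 ≤ e) (he2 : e ≤ 2) (hδ : 0 < δ)
    (hδe : n + e ≤ δ + 4) (hδn : δ ≤ n - 2)
    {w : Sym2 (PathVertex (n - 2)) → ℝ} (hw)
    (hyz : w s(y, z) = δ) (hz : ∀ k : Fin (n - 2), (k : ℕ) + 1 = n - 2 → w s(.x k, .z) = e)
    (hxx : ∀ k l, w s(.x k, .x l) = 1) (hy : ∀ k, w s(.x k, y) = 1) :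
    Model (N := n - 2)
      { graph := SimpleGraph.fromRel fun a b =>
          (∃ j, a.IsX j ∧ b.IsX (j + 1)) ∨ (a.IsX 1 ∧ b = y) ∨ (a.IsX (n - 2) ∧ b = z) ∨
            (a = y ∧ b = z)
        weight := w
        weight_pos := hw } (endPos e) δ 0 (n - 2) where
  le_left := Nat.zero_le _
  le_right := le_rfl
  le_iff_y a b ha hb := endPos_le_iff_y a b ha hb
  le_iff_z a b ha hb := endPos_le_iff_z he a b ha hb
  pos := hδ
  triangle j := by simp only [PathVertex.dist, endPos]; omega
  le_weight := le_weight_of_rel fun a b h => by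
    dsimp only
    rcases h with ⟨_, ⟨k, rfl, hk⟩, l, rfl, hl⟩ | ⟨⟨k, rfl, hk⟩, rfl⟩ | ⟨⟨k, rfl, hk⟩, rfl⟩ |
      ⟨rfl, rfl⟩
    · rw [hxx, Nat.cast_le_one]
      simp only [PathVertex.dist, endPos]; omega
    · rw [hy, Nat.cast_le_one]
      simp only [PathVertex.dist, endPos]; omega
    · rw [hz k hk, Nat.cast_le]
      simp only [PathVertex.dist, endPos]; omega
    · rw [hyz, PathVertex.dist]
  step_yz := by
    refine ⟨.z, ⟨by simp, .inl (.inr (.inr (.inr ⟨rfl, rfl⟩)))⟩, ?_⟩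
    dsimp only
    rw [hyz]
    simp [PathVertex.dist]
  step a c hac ho := by
    refine .inr (end_step he (by omega) ?_ ?_ ?_ a c hac ho)
    · intro k l hkl
      exact ⟨⟨by simp [Fin.ext_iff, hkl], .inr (.inl (exists_isX_isX hkl))⟩, hxx _ _⟩
    · intro k hk
      exact ⟨⟨by simp, .inl (.inr (.inl ⟨(isX_x _ _).2 (by omega), rfl⟩))⟩, hy _⟩
    · intro k hk
      refine ⟨⟨by simp, .inr (.inr (.inr (.inl ⟨(isX_x _ _).2 hk, rfl⟩)))⟩, ?_⟩
      rw [Sym2.eq_swap]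
      exact hz k hk

theorem S2_almostMetrizable_and_hasType (n : ℕ) (hn : 3 ≤ n) :
    (S2 n hn).AlmostMetrizable ∧ ∀ S : Finset (S2 n hn).carrier, (∀ a, a ∈ S) →
      (S2 n hn).HasType S (n - 2) 0 (n - 2) (fun _ => False) (fun _ => False)
        (fun _ => False) := by
  classical
  have M := end_model (n := n) (e := 1) (δ := n - 2) hn le_rfl one_le_two (by omega) (by omega) le_rfl
    (w := fun e => if e = s(y, z) then (n : ℝ) - 2 else 1)
    (fun e _ => by
      have : (3 : ℝ) ≤ n := by exact_mod_cast hn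
      split_ifs <;> linarith)
    (by rw [if_pos rfl, Nat.cast_sub (by omega)]; norm_num)
    (fun k _ => by simp) (fun k l => by simp) (fun k => by simp)
  refine ⟨M.isMetric.almostMetrizable, fun S hS => M.hasType S hS ?_ ?_ ?_⟩ <;>
    (intro j; simp only [PathVertex.dist, endPos, iff_false]; omega)

theorem S3_almostMetrizable_and_hasType (n : ℕ) (hn : 4 ≤ n) :
    (S3 n hn).AlmostMetrizable ∧ ∀ S : Finset (S3 n hn).carrier, (∀ a, a ∈ S) →
      (S3 n hn).HasType S (n - 2) 0 (n - 2) (fun _ => False) (fun j => j = 0)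
        (fun _ => False) := by
  classical
  have M := end_model (n := n) (e := 2) (δ := n - 2) (by omega) one_le_two le_rfl (by omega) (by omega)
    le_rfl
    (w := fun e => if e = s(y, z) then (n : ℝ) - 2
        else if ∃ a, e = s(a, z) ∧ a.IsX (n - 2) then 2 else 1)
    (fun e _ => by
      have : (4 : ℝ) ≤ n := by exact_mod_cast hn
      split_ifs <;> linarith)
    (by rw [if_pos rfl, Nat.cast_sub (by omega)]; norm_num)
    (fun k hk => by
      rw [if_neg (by simp), if_pos ⟨.x k, rfl, (isX_x _ _).2 hk⟩, Nat.cast_ofNat])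
    (fun k l => by simp) (fun k => by simp)
  refine ⟨M.isMetric.almostMetrizable, fun S hS => M.hasType S hS ?_ ?_ ?_⟩ <;>
    (intro j; simp only [PathVertex.dist, endPos, iff_false]; omega)

theorem S4_almostMetrizable_and_hasType (n : ℕ) (hn : 5 ≤ n) :
    (S4 n hn).AlmostMetrizable ∧ ∀ S : Finset (S4 n hn).carrier, (∀ a, a ∈ S) →
      (S4 n hn).HasType S (n - 2) 0 (n - 2) (fun _ => False) (fun j => j = 0)
        (fun j => j + 1 = n - 2) := by
  classical
  have M := end_model (n := n) (e := 1) (δ := n - 3) (by omega) le_rfl one_le_two (by omega) (by omega)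
    (by omega)
    (w := fun e => if e = s(y, z) then (n : ℝ) - 3 else 1)
    (fun e _ => by
      have : (5 : ℝ) ≤ n := by exact_mod_cast hn
      split_ifs <;> linarith)
    (by rw [if_pos rfl, Nat.cast_sub (by omega)]; norm_num)
    (fun k _ => by simp) (fun k l => by simp) (fun k => by simp)
  refine ⟨M.isMetric.almostMetrizable, fun S hS => M.hasType S hS ?_ ?_ ?_⟩ <;>
    (intro j; simp only [PathVertex.dist, endPos, iff_false]; omega)

end BetweennessStructure

/-! ### The structures T with two pairs of twins -/

namespace TVertex

variable {N : ℕ}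

/-- Positions with `y`, `z` and then `u`, `v` inserted behind `i` of the `x`s. -/
def pos (i : ℕ) : TVertex N → ℕ
  | .x k => if (k : ℕ) < i then k + 1 else k + 3
  | .y => i + 1
  | .z => i + 1
  | .u => i + 2
  | .v => i + 2

/-- Different vertices with the same position. -/
def Twin (a b : TVertex N) : Prop :=
  (a = .y ∧ b = .z) ∨ (a = .z ∧ b = .y) ∨ (a = .u ∧ b = .v) ∨ (a = .v ∧ b = .u)

/-- The distance of positions, and `2` for twins. -/
def dist (i : ℕ) : TVertex N → TVertex N → ℕ
  | .y, .z => 2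
  | .z, .y => 2
  | .u, .v => 2
  | .v, .u => 2
  | a, b => (pos i a - pos i b) + (pos i b - pos i a)

theorem Twin.symm {a b : TVertex N} (h : Twin a b) : Twin b a := by
  unfold Twin at *; tauto

theorem Twin.dist_eq {i : ℕ} {a b : TVertex N} (h : Twin a b) : dist i a b = 2 := by
  rcases h with ⟨rfl, rfl⟩ | ⟨rfl, rfl⟩ | ⟨rfl, rfl⟩ | ⟨rfl, rfl⟩ <;> rfl

theorem Twin.pos_eq {i : ℕ} {a b : TVertex N} (h : Twin a b) : pos i a = pos i b := by
  rcases h with ⟨rfl, rfl⟩ | ⟨rfl, rfl⟩ | ⟨rfl, rfl⟩ | ⟨rfl, rfl⟩ <;> rfl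

theorem dist_of_not_twin {i : ℕ} {a b : TVertex N} (h : ¬ Twin a b) :
    dist i a b = (pos i a - pos i b) + (pos i b - pos i a) := by
  rcases a with _ | _ | _ | _ | _ <;> rcases b with _ | _ | _ | _ | _ <;>
    first | rfl | simp [Twin] at h

theorem pos_x (i : ℕ) (k : Fin N) :
    (k : ℕ) < i ∧ pos i (.x k) = k + 1 ∨ i ≤ k ∧ pos i (.x k) = k + 3 := by
  simp only [pos]
  split_ifs <;> omega

theorem pos_eq_iff {i : ℕ} {a b : TVertex N} : pos i a = pos i b ↔ a = b ∨ Twin a b := by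
  constructor
  · intro h
    rcases a with k | _ | _ | _ | _ <;> rcases b with l | _ | _ | _ | _ <;>
      simp only [Twin, reduceCtorEq, and_self, and_true, and_false, or_self, or_false, or_true,
        x.injEq] <;>
      (try have hk := pos_x i k) <;> (try have hl := pos_x i l) <;>
      (try simp only [show pos i (.y : TVertex N) = i + 1 from rfl,
        show pos i (.z : TVertex N) = i + 1 from rfl, show pos i (.u : TVertex N) = i + 2 from rfl,
        show pos i (.v : TVertex N) = i + 2 from rfl] at h) <;>
      (try rw [Fin.ext_iff]) <;> omega
  · rintro (rfl | h)
    · rfl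
    · exact h.pos_eq

theorem dist_symm (i : ℕ) (a b : TVertex N) : dist i a b = dist i b a := by
  by_cases h : Twin a b
  · rw [h.dist_eq, h.symm.dist_eq]
  · rw [dist_of_not_twin h, dist_of_not_twin fun h' => h h'.symm, add_comm]

/-- Twins share their position, so any third vertex is either the partner of one of them or at
distance at least one from both. For other pairs the inequality is that of positions, which never
exceed distances. -/
theorem dist_triangle (i : ℕ) (a b c : TVertex N) : dist i a c ≤ dist i a b + dist i b c := by
  have h0 : ∀ a b : TVertex N, dist i a b = 2 ∧ Twin a b ∧ pos i a = pos i b ∨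
      ¬ Twin a b ∧ dist i a b = (pos i a - pos i b) + (pos i b - pos i a) := fun a b => by
    by_cases h : Twin a b
    · exact .inl ⟨h.dist_eq, h, h.pos_eq⟩
    · exact .inr ⟨h, dist_of_not_twin h⟩
  have h1 := h0 a b
  have h2 := h0 b c
  rcases h0 a c with ⟨h3, h4, h5⟩ | ⟨h3, h4⟩
  · by_cases hab : pos i a = pos i b
    · rcases pos_eq_iff.1 hab with rfl | h
      · omega
      · rw [h.dist_eq]; omega
    · have : ¬ Twin a b := fun h => hab h.pos_eq
      have : ¬ Twin b c := fun h => hab (h5.trans h.pos_eq.symm)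
      omega
  · omega

/-- Some neighbour is one position higher. Where two are available, the one that is not the twin of
the target is chosen. -/
theorem step_up {i : ℕ} (hiN : i < N) {G : SimpleGraph (TVertex N)}
    (h1 : ∀ k l : Fin N, (l : ℕ) = k + 1 → (l : ℕ) ≠ i → G.Adj (.x k) (.x l))
    (h2 : ∀ k : Fin N, (k : ℕ) + 1 = i → G.Adj (.x k) .y ∧ G.Adj (.x k) .z)
    (h3 : ∀ a b : TVertex N, a = .y ∨ a = .z → b = .u ∨ b = .v → G.Adj a b)
    (h4 : ∀ k : Fin N, (k : ℕ) = i → G.Adj .u (.x k) ∧ G.Adj .v (.x k))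
    (a c : TVertex N) (hac : pos i a < pos i c) :
    ∃ b, G.Adj a b ∧ 1 + dist i b c = dist i a c := by
  have key : ∀ b, G.Adj a b → pos i b = pos i a + 1 → ¬ Twin b c →
      ∃ b, G.Adj a b ∧ 1 + dist i b c = dist i a c := by
    intro b hb hP hbc
    refine ⟨b, hb, ?_⟩
    rw [dist_of_not_twin hbc, dist_of_not_twin fun h => by have := h.pos_eq (i := i); omega]
    omega
  have e1 : pos i (.y : TVertex N) = i + 1 := rfl
  have e2 : pos i (.z : TVertex N) = i + 1 := rfl
  have e3 : pos i (.u : TVertex N) = i + 2 := rfl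
  have e4 : pos i (.v : TVertex N) = i + 2 := rfl
  have e5 := pos_x i (⟨i, hiN⟩ : Fin N)
  have hi4 := h4 ⟨i, hiN⟩ rfl
  simp only at e5
  rcases a with k | _ | _ | _ | _
  · have e6 := pos_x i k
    by_cases hk : (k : ℕ) + 1 = i
    · by_cases hc : c = .z
      · exact key .z (h2 k hk).2 (by omega) (by simp [Twin, hc])
      · exact key .y (h2 k hk).1 (by omega) (by simp [Twin, hc])
    · have hkN : (k : ℕ) + 1 < N := by
        by_contra hcon
        rcases c with l | _ | _ | _ | _
        · have := pos_x i l; omega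
        all_goals omega
      have e7 := pos_x i (⟨k + 1, hkN⟩ : Fin N)
      simp only at e7
      exact key _ (h1 k ⟨k + 1, hkN⟩ rfl hk) (by omega) (by simp [Twin])
  · by_cases hc : c = .v
    · exact key .v (h3 _ _ (.inl rfl) (.inr rfl)) (by omega) (by simp [Twin, hc])
    · exact key .u (h3 _ _ (.inl rfl) (.inl rfl)) (by omega) (by simp [Twin, hc])
  · by_cases hc : c = .v
    · exact key .v (h3 _ _ (.inr rfl) (.inr rfl)) (by omega) (by simp [Twin, hc])
    · exact key .u (h3 _ _ (.inr rfl) (.inl rfl)) (by omega) (by simp [Twin, hc])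
  · exact key _ hi4.1 (by omega) (by simp [Twin])
  · exact key _ hi4.2 (by omega) (by simp [Twin])

end TVertex

namespace BetweennessStructure

open TVertex

theorem T_isMetric (n i : ℕ) (hin : i < n - 4) :
    (WeightedGraph.ofSimple (SimpleGraph.fromRel fun a b : TVertex (n - 4) =>
      (∃ j, j ≠ i ∧ a.IsX j ∧ b.IsX (j + 1)) ∨
      (a.IsX i ∧ (b = .y ∨ b = .z)) ∨
      ((a = .y ∨ a = .z) ∧ (b = .u ∨ b = .v)) ∨
      ((a = .u ∨ a = .v) ∧ b.IsX (i + 1)))).IsMetric (TVertex.dist i) where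
  eq_zero a b := by
    by_cases h : Twin a b
    · rw [h.dist_eq]
      refine iff_of_false two_ne_zero ?_
      rintro rfl
      simp [Twin] at h
      rcases h with ⟨rfl, h⟩ | ⟨rfl, h⟩ | ⟨rfl, h⟩ | ⟨rfl, h⟩ <;> cases h
    · rw [dist_of_not_twin h]
      have := pos_eq_iff (i := i) (a := a) (b := b)
      constructor
      · intro h0
        exact (this.1 (by omega)).resolve_right h
      · rintro rfl; omega
  symm := TVertex.dist_symm i
  triangle := TVertex.dist_triangle i
  le_weight a b h := by
    suffices TVertex.dist i a b ≤ 1 by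
      change _ ≤ (1 : ℝ); exact_mod_cast this
    have key : ∀ a b : TVertex (n - 4), ((∃ j, j ≠ i ∧ a.IsX j ∧ b.IsX (j + 1)) ∨
      (a.IsX i ∧ (b = .y ∨ b = .z)) ∨
      ((a = .y ∨ a = .z) ∧ (b = .u ∨ b = .v)) ∨
      ((a = .u ∨ a = .v) ∧ b.IsX (i + 1))) → TVertex.dist i a b ≤ 1 := by
      rintro a b (⟨_, hj, ⟨k, rfl, hk⟩, l, rfl, hl⟩ | ⟨⟨k, rfl, hk⟩, rfl | rfl⟩ |
        ⟨rfl | rfl, rfl | rfl⟩ | ⟨rfl | rfl, k, rfl, hk⟩) <;>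
        simp only [TVertex.dist, TVertex.pos] <;> (try split_ifs) <;> omega
    rcases h.2 with h' | h'
    · exact key a b h'
    · rw [TVertex.dist_symm]; exact key b a h'
  step a c hac := by
    set G := SimpleGraph.fromRel fun a b : TVertex (n - 4) =>
      (∃ j, j ≠ i ∧ a.IsX j ∧ b.IsX (j + 1)) ∨
      (a.IsX i ∧ (b = .y ∨ b = .z)) ∨
      ((a = .y ∨ a = .z) ∧ (b = .u ∨ b = .v)) ∨
      ((a = .u ∨ a = .v) ∧ b.IsX (i + 1)) with hG
    have h3 : ∀ a b : TVertex (n - 4), a = .y ∨ a = .z → b = .u ∨ b = .v → G.Adj a b := by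
      intro a b ha hb
      refine ⟨?_, .inl (.inr (.inr (.inl ⟨ha, hb⟩)))⟩
      rcases ha with rfl | rfl <;> rcases hb with rfl | rfl <;> simp
    have up := step_up (G := G) hin
      (fun k l hkl hl => ⟨by simp [Fin.ext_iff, hkl],
        .inl (.inl ⟨k + 1, by omega, ⟨k, rfl, rfl⟩, l, rfl, by omega⟩)⟩)
      (fun k hk => ⟨⟨by simp, .inl (.inr (.inl ⟨⟨k, rfl, hk⟩, .inl rfl⟩))⟩,
        ⟨by simp, .inl (.inr (.inl ⟨⟨k, rfl, hk⟩, .inr rfl⟩))⟩⟩)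
      h3
      (fun k hk => ⟨⟨by simp, .inl (.inr (.inr (.inr ⟨.inl rfl, k, rfl, by omega⟩)))⟩,
        ⟨by simp, .inl (.inr (.inr (.inr ⟨.inr rfl, k, rfl, by omega⟩)))⟩⟩)
    have up' : ∀ a c : TVertex (n - 4), TVertex.pos i a < TVertex.pos i c → ∃ b, G.Adj a b ∧
        (1 : ℝ) + TVertex.dist i b c = TVertex.dist i a c := fun a c h => by
      obtain ⟨b, hb, hb'⟩ := up a c h
      exact ⟨b, hb, by exact_mod_cast hb'⟩
    rcases lt_trichotomy (TVertex.pos i a) (TVertex.pos i c) with h | h | h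
    · exact .inl (up' a c h)
    · left
      -- Twins are joined by a path of length two through the other pair of twins.
      have key : ∃ b, G.Adj a b ∧ 1 + TVertex.dist i b c = TVertex.dist i a c := by
        rcases (pos_eq_iff.1 h).resolve_left hac with ⟨rfl, rfl⟩ | ⟨rfl, rfl⟩ | ⟨rfl, rfl⟩ | ⟨rfl, rfl⟩
        · exact ⟨.u, h3 _ _ (.inl rfl) (.inl rfl), by simp [TVertex.dist, TVertex.pos]⟩
        · exact ⟨.u, h3 _ _ (.inr rfl) (.inl rfl), by simp [TVertex.dist, TVertex.pos]⟩
        · exact ⟨.y, (h3 _ _ (.inl rfl) (.inl rfl)).symm, by simp [TVertex.dist, TVertex.pos]⟩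
        · exact ⟨.y, (h3 _ _ (.inl rfl) (.inr rfl)).symm, by simp [TVertex.dist, TVertex.pos]⟩
      obtain ⟨b, hb, hb'⟩ := key
      exact ⟨b, hb, by
        change (1 : ℝ) + TVertex.dist i b c = TVertex.dist i a c
        exact_mod_cast hb'⟩
    · exact .inr (up' c a h)

theorem T_almostMetrizable (n i : ℕ) (hin : i < n - 4) : (T n i).AlmostMetrizable :=
  (T_isMetric n i hin).almostMetrizable

theorem T_tri_iff (n i : ℕ) (hin : i < n - 4) (a b c : TVertex (n - 4)) :
    (T n i).Tri a b c ↔ TVertex.dist i a c ≠ TVertex.dist i a b + TVertex.dist i b c ∧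
      TVertex.dist i b a ≠ TVertex.dist i b c + TVertex.dist i c a ∧
      TVertex.dist i c b ≠ TVertex.dist i c a + TVertex.dist i a b := by
  have h := (T_isMetric n i hin).btw_iff
  exact and_congr (not_congr (h a b c)) (and_congr (not_congr (h b c a)) (not_congr (h c a b)))

/-- Both twins are equally far from x_k, so the triple is collinear only if this distance is 1, half
of the distance of the twins. -/
theorem T_tri_yz (n i : ℕ) (hin : i < n - 4) (k : Fin (n - 4)) :
    (T n i).Tri (TVertex.y : TVertex (n - 4)) (TVertex.z : TVertex (n - 4)) (TVertex.x k) ↔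
      (k : ℕ) + 1 ≠ i := by
  rw [T_tri_iff n i hin]
  have := pos_x i k
  simp only [TVertex.dist, show pos i (.y : TVertex (n - 4)) = i + 1 from rfl,
    show pos i (.z : TVertex (n - 4)) = i + 1 from rfl]
  omega

theorem T_tri_uv (n i : ℕ) (hin : i < n - 4) (k : Fin (n - 4)) :
    (T n i).Tri (TVertex.u : TVertex (n - 4)) (TVertex.v : TVertex (n - 4)) (TVertex.x k) ↔
      (k : ℕ) ≠ i := by
  rw [T_tri_iff n i hin]
  have := pos_x i k
  simp only [TVertex.dist, show pos i (.u : TVertex (n - 4)) = i + 2 from rfl,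
    show pos i (.v : TVertex (n - 4)) = i + 2 from rfl]
  omega

/-- Without twins all three distances are differences of positions, and the triple is collinear. -/
theorem T_exists_twin (n i : ℕ) (hin : i < n - 4) (a b c : TVertex (n - 4))
    (h : (T n i).Tri a b c) : Twin a b ∨ Twin b c ∨ Twin c a := by
  by_contra! hcon
  obtain ⟨h1, h2, h3⟩ := hcon
  rw [T_tri_iff n i hin, TVertex.dist_symm i a c, TVertex.dist_symm i b a,
    TVertex.dist_symm i c b, dist_of_not_twin h1, dist_of_not_twin h2, dist_of_not_twin h3] at h
  omega

open Classical in
theorem T_eq_of_twin (n i : ℕ) (hin : i < n - 4) (a b c : TVertex (n - 4))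
    (h : (T n i).Tri a b c) (ht : Twin a b) : ∃ k : Fin (n - 4),
      ((k : ℕ) + 1 ≠ i ∧ ({a, b, c} : Finset (TVertex (n - 4))) = {.y, .z, .x k}) ∨
      ((k : ℕ) ≠ i ∧ ({a, b, c} : Finset (TVertex (n - 4))) = {.u, .v, .x k}) := by
  have hB := T_almostMetrizable n i hin
  have key : ∀ a b c : TVertex (n - 4), (T n i).Tri a b c → a = .y ∧ b = .z ∨ a = .u ∧ b = .v →
      ∃ k : Fin (n - 4),
        ((k : ℕ) + 1 ≠ i ∧ ({a, b, c} : Finset (TVertex (n - 4))) = {.y, .z, .x k}) ∨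
        ((k : ℕ) ≠ i ∧ ({a, b, c} : Finset (TVertex (n - 4))) = {.u, .v, .x k}) := by
    rintro a b c h (⟨rfl, rfl⟩ | ⟨rfl, rfl⟩)
    · rcases c with k | _ | _ | _ | _
      · exact ⟨k, .inl ⟨(T_tri_yz n i hin k).1 h, rfl⟩⟩
      all_goals
        rw [T_tri_iff n i hin] at h
        simp [TVertex.dist, TVertex.pos] at h
    · rcases c with k | _ | _ | _ | _
      · exact ⟨k, .inr ⟨(T_tri_uv n i hin k).1 h, rfl⟩⟩
      all_goals
        rw [T_tri_iff n i hin] at h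
        simp [TVertex.dist, TVertex.pos] at h
  rcases ht with ht | ht | ht | ht
  · exact key a b c h (.inl ht)
  · rw [Finset.insert_comm]; exact key b a c (h.swap hB) (.inl ht.symm)
  · exact key a b c h (.inr ht)
  · rw [Finset.insert_comm]; exact key b a c (h.swap hB) (.inr ht.symm)

open Classical in
theorem T_eq_of_tri (n i : ℕ) (hin : i < n - 4) (a b c : TVertex (n - 4))
    (h : (T n i).Tri a b c) : ∃ k : Fin (n - 4),
      ((k : ℕ) + 1 ≠ i ∧ ({a, b, c} : Finset (TVertex (n - 4))) = {.y, .z, .x k}) ∨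
      ((k : ℕ) ≠ i ∧ ({a, b, c} : Finset (TVertex (n - 4))) = {.u, .v, .x k}) := by
  rcases T_exists_twin n i hin a b c h with ht | ht | ht
  · exact T_eq_of_twin n i hin a b c h ht
  · have : ({a, b, c} : Finset (TVertex (n - 4))) = {b, c, a} := by
      ext; simp only [Finset.mem_insert, Finset.mem_singleton]; tauto
    rw [this]
    exact T_eq_of_twin n i hin b c a h.rotate ht
  · have : ({a, b, c} : Finset (TVertex (n - 4))) = {c, a, b} := by
      ext; simp only [Finset.mem_insert, Finset.mem_singleton]; tauto
    rw [this]
    exact T_eq_of_twin n i hin c a b h.rotate.rotate ht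

open Classical in
-- Each pair of twins forms a triangle with all but one of the n - 4 points x, and with nothing
-- else.
theorem T_card_triangles (n i : ℕ) (hi : 1 ≤ i) (hin : i < n - 4) (S : Finset (T n i).carrier)
    (hS : ∀ a, a ∈ S) : ((T n i).triangles S).card = 2 * (n - 5) := by
  have hB := T_almostMetrizable n i hin
  let J₁ : Finset (Fin (n - 4)) := Finset.univ.erase ⟨i - 1, by omega⟩
  let J₂ : Finset (Fin (n - 4)) := Finset.univ.erase ⟨i, hin⟩
  have hJ₁ : ∀ k, k ∈ J₁ ↔ (k : ℕ) + 1 ≠ i := fun k => by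
    simp only [J₁, Finset.mem_erase, Finset.mem_univ, and_true, ne_eq, Fin.ext_iff]; omega
  have hJ₂ : ∀ k, k ∈ J₂ ↔ (k : ℕ) ≠ i := fun k => by
    simp only [J₂, Finset.mem_erase, Finset.mem_univ, and_true, ne_eq, Fin.ext_iff]
  let f : Fin (n - 4) ⊕ Fin (n - 4) → Finset (TVertex (n - 4)) :=
    Sum.elim (fun k => {.y, .z, .x k}) (fun k => {.u, .v, .x k})
  have hf : Function.Injective f := by
    rintro (k | k) (l | l) h <;> simp only [f, Sum.elim_inl, Sum.elim_inr] at h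
    · have := Finset.ext_iff.1 h (.x k)
      simpa using this
    · have := Finset.ext_iff.1 h .y
      simp at this
    · have := Finset.ext_iff.1 h .y
      simp at this
    · have := Finset.ext_iff.1 h (.x k)
      simpa using this
  have hcard : (J₁.disjSum J₂).card = 2 * (n - 5) := by
    rw [Finset.card_disjSum, Finset.card_erase_of_mem (Finset.mem_univ _),
      Finset.card_erase_of_mem (Finset.mem_univ _), Finset.card_univ, Fintype.card_fin]
    omega
  rw [← hcard, ← Finset.card_map ⟨f, hf⟩]
  refine congrArg Finset.card (Finset.ext fun E => mem_triangles.trans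
    (Iff.trans ?_ Finset.mem_map.symm))
  constructor
  · rintro ⟨-, a, b, c, rfl, h⟩
    obtain ⟨k, ⟨hk, hk'⟩ | ⟨hk, hk'⟩⟩ := T_eq_of_tri n i hin a b c h
    · exact ⟨.inl k, by rwa [Finset.inl_mem_disjSum, hJ₁], hk'.symm⟩
    · exact ⟨.inr k, by rwa [Finset.inr_mem_disjSum, hJ₂], hk'.symm⟩
  · rintro ⟨k | k, hk, rfl⟩
    · rw [Finset.inl_mem_disjSum, hJ₁] at hk
      exact ⟨fun a _ => hS a, _, _, _, rfl, (T_tri_yz n i hin k).2 hk⟩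
    · rw [Finset.inr_mem_disjSum, hJ₂] at hk
      exact ⟨fun a _ => hS a, _, _, _, rfl, (T_tri_uv n i hin k).2 hk⟩

/-- The triangles {y, z, x_{i+1}} and {u, v, x_i} are disjoint, so a kernel would be empty. -/
theorem T_not_isTightStar (n i : ℕ) (hi : 1 ≤ i) (hin : i < n - 4) :
    ¬ (T n i).triangleHypergraph.IsTightStar := by
  rintro ⟨K, hK, -, hstar⟩
  have hB := T_almostMetrizable n i hin
  let E : Set (TVertex (n - 4)) := {.y, .z, .x ⟨i, hin⟩}
  let F : Set (TVertex (n - 4)) := {.u, .v, .x ⟨i - 1, by omega⟩}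
  have hE : E ∈ (T n i).triangleHypergraph.edgeSet := hB.mem_edgeSet_iff.2
    ⟨_, _, _, rfl, (T_tri_yz n i hin _).2 (by simp)⟩
  have hF : F ∈ (T n i).triangleHypergraph.edgeSet := hB.mem_edgeSet_iff.2
    ⟨_, _, _, rfl, (T_tri_uv n i hin _).2 (by simp only; omega)⟩
  have hEF : E ∩ F = ∅ := by
    ext a
    simp only [E, F, Set.mem_inter_iff, Set.mem_insert_iff, Set.mem_singleton_iff,
      Set.mem_empty_iff_false, iff_false]
    rintro ⟨rfl | rfl | rfl, h | h | h⟩ <;> first | cases h | skip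
    simp only [TVertex.x.injEq, Fin.mk.injEq] at h
    omega
  have hne : E ≠ F := by
    intro h
    have : (TVertex.y : TVertex (n - 4)) ∈ F := h ▸ (.inl rfl : _ ∈ E)
    simp [F] at this
  have hKe : ∅ = K := hEF.symm.trans (hstar E hE F hF hne)
  subst hKe
  exact two_ne_zero (hK.symm.trans (Set.ncard_empty _))

theorem T_order (n i : ℕ) (hn : 4 ≤ n) : (T n i).order = n := by
  let E : TVertex (n - 4) ≃ Fin (n - 4) ⊕ Fin 4 :=
    { toFun := fun a => match a with
        | .x j => .inl j | .y => .inr 0 | .z => .inr 1 | .u => .inr 2 | .v => .inr 3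
      invFun := Sum.elim .x ![.y, .z, .u, .v]
      left_inv := by rintro (j | _ | _ | _ | _) <;> rfl
      right_inv := by rintro (j | j) <;> [rfl; (fin_cases j <;> rfl)] }
  change Nat.card (TVertex (n - 4)) = n
  rw [Nat.card_congr E]
  simp
  omega

end BetweennessStructure

/-! ### Invariance under isomorphism; members of the classes B(n, m) -/

namespace BetweennessStructure

variable {𝓑 : BetweennessStructure.{u}}

theorem exists_forall_mem (𝓑 : BetweennessStructure.{u}) :
    ∃ S : Finset 𝓑.carrier, (∀ a, a ∈ S) ∧ S.card = 𝓑.order := by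
  have := Fintype.ofFinite 𝓑.carrier
  exact ⟨Finset.univ, Finset.mem_univ, by rw [order, Nat.card_eq_fintype_card, Finset.card_univ]⟩

theorem IsIsomorphic.tri_iff {𝓒 : BetweennessStructure.{v}} {e : 𝓑.carrier ≃ 𝓒.carrier}
    (he : ∀ x y z, 𝓑.Btw x y z ↔ 𝓒.Btw (e x) (e y) (e z)) (a b c : 𝓑.carrier) :
    𝓑.Tri a b c ↔ 𝓒.Tri (e a) (e b) (e c) := by
  simp only [Tri, he]

theorem IsIsomorphic.almostMetrizable {𝓒 : BetweennessStructure.{v}} (h : 𝓑.IsIsomorphic 𝓒)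
    (hC : 𝓒.AlmostMetrizable) : 𝓑.AlmostMetrizable := by
  obtain ⟨e, he⟩ := h
  constructor
  · exact fun x z => (he _ _ _).2 (hC.refl_left _ _)
  · exact fun x y z h => (he _ _ _).2 (hC.symm _ _ _ ((he _ _ _).1 h))
  · exact fun x y z h h' => e.injective (hC.antisymm _ _ _ ((he _ _ _).1 h) ((he _ _ _).1 h'))
  · intro x y z w h h'
    simp only [he] at *
    exact hC.four_relations _ _ _ _ h h'

theorem IsIsomorphic.order_eq {𝓒 : BetweennessStructure.{v}} (h : 𝓑.IsIsomorphic 𝓒) :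
    𝓑.order = 𝓒.order := by
  obtain ⟨e, -⟩ := h
  exact Nat.card_congr e

theorem IsIsomorphic.edgeSet_eq {𝓒 : BetweennessStructure.{v}} {e : 𝓑.carrier ≃ 𝓒.carrier}
    (he : ∀ x y z, 𝓑.Btw x y z ↔ 𝓒.Btw (e x) (e y) (e z)) (hB : 𝓑.AlmostMetrizable)
    (hC : 𝓒.AlmostMetrizable) :
    𝓒.triangleHypergraph.edgeSet = (fun T => e '' T) '' 𝓑.triangleHypergraph.edgeSet := by
  ext T
  rw [hC.mem_edgeSet_iff]
  constructor
  · rintro ⟨a, b, c, rfl, h⟩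
    obtain ⟨a, rfl⟩ := e.surjective a
    obtain ⟨b, rfl⟩ := e.surjective b
    obtain ⟨c, rfl⟩ := e.surjective c
    exact ⟨{a, b, c}, hB.mem_edgeSet_iff.2 ⟨a, b, c, rfl, (tri_iff he _ _ _).2 h⟩,
      by simp [Set.image_insert_eq]⟩
  · rintro ⟨T, hT, rfl⟩
    obtain ⟨a, b, c, rfl, h⟩ := hB.mem_edgeSet_iff.1 hT
    exact ⟨e a, e b, e c, by simp [Set.image_insert_eq], (tri_iff he _ _ _).1 h⟩

theorem IsIsomorphic.cosize_eq {𝓒 : BetweennessStructure.{v}} (h : 𝓑.IsIsomorphic 𝓒)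
    (hC : 𝓒.AlmostMetrizable) : 𝓑.cosize = 𝓒.cosize := by
  have hB := h.almostMetrizable hC
  obtain ⟨e, he⟩ := h
  rw [cosize, cosize, edgeSet_eq he hB hC,
    Set.ncard_image_of_injective _ (Set.image_injective.2 e.injective)]

theorem IsIsomorphic.mem_ofOrderCosize {𝓒 : BetweennessStructure.{v}} (h : 𝓑.IsIsomorphic 𝓒)
    {n : ℕ} {m : ℤ} (hC : 𝓒 ∈ ofOrderCosize n m) : 𝓑 ∈ ofOrderCosize n m :=
  ⟨h.almostMetrizable hC.1, h.order_eq.trans hC.2.1, by rw [h.cosize_eq hC.1]; exact hC.2.2⟩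

theorem IsIsomorphic.not_isTightStar {𝓒 : BetweennessStructure.{v}} (h : 𝓑.IsIsomorphic 𝓒)
    (hC : 𝓒.AlmostMetrizable) (hn : ¬ 𝓒.triangleHypergraph.IsTightStar) :
    ¬ 𝓑.triangleHypergraph.IsTightStar := by
  have hB := h.almostMetrizable hC
  obtain ⟨e, he⟩ := h
  rintro ⟨K, hK, -, hstar⟩
  refine hn ⟨e '' K, by rw [Set.ncard_image_of_injective _ e.injective, hK], Set.subset_univ _, ?_⟩
  rw [edgeSet_eq he hB hC]
  rintro _ ⟨E, hE, rfl⟩ _ ⟨F, hF, rfl⟩ hne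
  dsimp only
  rw [← Set.image_inter e.injective, hstar E hE F hF fun h => hne (by rw [h])]

/-- The explicit graphs live in the lowest universe; this carries them to the universe of the
classes. -/
theorem exists_isIsomorphic_lift (𝓒 : BetweennessStructure.{v}) :
    ∃ 𝓑 : BetweennessStructure.{max u v}, 𝓑.IsIsomorphic 𝓒 :=
  ⟨{ carrier := ULift.{u} 𝓒.carrier, Btw := fun x y z => 𝓒.Btw x.down y.down z.down },
    Equiv.ulift, fun _ _ _ => Iff.rfl⟩

theorem isLinear_iff : 𝓑.IsLinear ↔ 𝓑.cosize = 0 := by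
  rw [cosize, Set.ncard_eq_zero (Set.toFinite _), Set.eq_empty_iff_forall_notMem]
  exact forall_congr' fun T => by
    change (_ → _) ↔ ¬ (_ ∧ ¬ _)
    tauto

/-- The linearly ordered structure on `n + 1` points. -/
theorem exists_linear (n : ℕ) : ∃ 𝓑 : BetweennessStructure.{u},
    𝓑.AlmostMetrizable ∧ 𝓑.order = n + 1 ∧ 𝓑.IsLinear := by
  let 𝓑 : BetweennessStructure.{0} :=
    { carrier := Fin (n + 1), Btw := fun x y z => Nat.Between x y z }
  have hB : 𝓑.AlmostMetrizable :=
    { refl_left := fun x z => by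
        change Nat.Between (x : Fin (n + 1)) (x : Fin (n + 1)) (z : Fin (n + 1))
        unfold Nat.Between; omega
      symm := fun x y z h => Or.symm h
      antisymm := fun (x y z : Fin (n + 1)) (h : Nat.Between x y z) (h' : Nat.Between y x z) => by
        unfold Nat.Between at h h'
        exact Fin.ext (by omega)
      four_relations := fun (x y z w : Fin (n + 1)) (h : Nat.Between x y z)
          (h' : Nat.Between x w y) => by
        change Nat.Between x w z ∧ Nat.Between w y z
        unfold Nat.Between at *
        omega }
  have hlin : 𝓑.IsLinear := by
    intro T hT
    obtain ⟨a, b, c, hab, hac, hbc, rfl⟩ := Set.ncard_eq_three.1 hT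
    refine (hB.collinear_iff hab hac hbc).2 ?_
    rintro ⟨h1, h2, h3⟩
    change ¬ Nat.Between (a : Fin (n + 1)) (b : Fin (n + 1)) (c : Fin (n + 1)) at h1
    change ¬ Nat.Between (b : Fin (n + 1)) (c : Fin (n + 1)) (a : Fin (n + 1)) at h2
    change ¬ Nat.Between (c : Fin (n + 1)) (a : Fin (n + 1)) (b : Fin (n + 1)) at h3
    unfold Nat.Between at h1 h2 h3
    omega
  obtain ⟨𝓒, hC⟩ := exists_isIsomorphic_lift.{u} 𝓑
  have hC' := hC.almostMetrizable hB
  refine ⟨𝓒, hC', hC.order_eq.trans (by simp [order, 𝓑]), ?_⟩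
  rw [isLinear_iff, hC.cosize_eq hB, ← isLinear_iff]
  exact hlin

theorem nonempty_ofOrderCosize {n : ℕ} {m : ℤ} {𝓒 : BetweennessStructure.{0}}
    (h : 𝓒 ∈ ofOrderCosize n m) : (ofOrderCosize.{u} n m).Nonempty := by
  obtain ⟨𝓑, hB⟩ := exists_isIsomorphic_lift.{u} 𝓒
  exact ⟨𝓑, hB.mem_ofOrderCosize h⟩

/-- `J` collects the indices of the x's that are collinear with y and z; all others give the
triangles. -/
theorem mem_ofOrderCosize_of_hasType {N s t n : ℕ} {A B C : ℕ → Prop} {m : ℤ}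
    (h : 𝓑.AlmostMetrizable ∧ ∀ S : Finset 𝓑.carrier, (∀ a, a ∈ S) → 𝓑.HasType S N s t A B C)
    (hN : N + 2 = n) (J : Finset ℕ) (hJ : ∀ j < N, A j ∨ B j ∨ C j ↔ j ∈ J) (hJN : ∀ j ∈ J, j < N)
    (hm : m = N - J.card) : 𝓑 ∈ ofOrderCosize n m := by
  obtain ⟨S, hS, -⟩ := 𝓑.exists_forall_mem
  have hT := h.2 S hS
  refine ⟨h.1, (hT.order_eq hS).trans hN, ?_⟩
  rw [h.1.cosize_eq hS, hT.card_triangles_eq h.1 J hJ hJN, Nat.cast_sub, hm]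
  simpa using Finset.card_le_card fun j hj => Finset.mem_range.2 (hJN j hj)

theorem Q2_mem {n : ℕ} (hn : 2 ≤ n) : Q2 n ∈ ofOrderCosize n ((n : ℤ) - 2) :=
  mem_ofOrderCosize_of_hasType (Q2_almostMetrizable_and_hasType n) (by omega) ∅
    (by simp) (by simp) (by simp; omega)

theorem Q3_mem {n : ℕ} (hn : 3 ≤ n) : Q3 n ∈ ofOrderCosize n ((n : ℤ) - 3) :=
  mem_ofOrderCosize_of_hasType (Q3_almostMetrizable_and_hasType n hn) (by omega) {0}
    (by simp) (by simp; omega) (by simp; omega)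

theorem R2_mem {n i : ℕ} (hin : i < n - 2) : R2 n i ∈ ofOrderCosize n ((n : ℤ) - 2) :=
  mem_ofOrderCosize_of_hasType (R2_almostMetrizable_and_hasType n i hin) (by omega) ∅
    (by simp) (by simp) (by simp; omega)

theorem R3_mem {n i : ℕ} (hi : 1 ≤ i) (hin : i < n - 2) :
    R3 n i ∈ ofOrderCosize n ((n : ℤ) - 3) :=
  mem_ofOrderCosize_of_hasType (R3_almostMetrizable_and_hasType n i hi hin) (by omega)
    {i - 1} (by simp; omega) (by simp; omega) (by simp; omega)

theorem R4_mem {n i : ℕ} (hi : 1 ≤ i) (hin : i < n - 2) :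
    R4 n i ∈ ofOrderCosize n ((n : ℤ) - 4) :=
  mem_ofOrderCosize_of_hasType (R4_almostMetrizable_and_hasType n i hin) (by omega)
    {i - 1, i} (by simp; omega) (by simp; omega) (by rw [Finset.card_pair (by omega)]; omega)

theorem S2_mem {n : ℕ} (hn : 3 ≤ n) : S2 n hn ∈ ofOrderCosize n ((n : ℤ) - 2) :=
  mem_ofOrderCosize_of_hasType (S2_almostMetrizable_and_hasType n hn) (by omega) ∅
    (by simp) (by simp) (by simp; omega)

theorem S3_mem {n : ℕ} (hn : 4 ≤ n) : S3 n hn ∈ ofOrderCosize n ((n : ℤ) - 3) :=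
  mem_ofOrderCosize_of_hasType (S3_almostMetrizable_and_hasType n hn) (by omega) {0}
    (by simp) (by simp; omega) (by simp; omega)

theorem S4_mem {n : ℕ} (hn : 5 ≤ n) : S4 n hn ∈ ofOrderCosize n ((n : ℤ) - 4) :=
  mem_ofOrderCosize_of_hasType (S4_almostMetrizable_and_hasType n hn) (by omega)
    {0, n - 3} (by simp; omega) (by simp; omega) (by rw [Finset.card_pair (by omega)]; omega)

theorem T_mem {n i : ℕ} (hi : 1 ≤ i) (hin : i < n - 4) :
    T n i ∈ ofOrderCosize n (2 * (n : ℤ) - 10) := by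
  obtain ⟨S, hS, -⟩ := (T n i).exists_forall_mem
  have hB := T_almostMetrizable n i hin
  refine ⟨hB, T_order n i (by omega), ?_⟩
  rw [hB.cosize_eq hS, T_card_triangles n i hi hin S hS]
  omega

end BetweennessStructure

/-! ### Matching types with the listed structures -/

namespace BetweennessStructure

variable {𝓑 : BetweennessStructure.{u}}

theorem HasType.isIsomorphic {𝓒 : BetweennessStructure.{v}} {S : Finset 𝓑.carrier}
    {N s t : ℕ} {A B C : ℕ → Prop} (h : 𝓑.HasType S N s t A B C) (hB : 𝓑.AlmostMetrizable)
    (hS : ∀ a, a ∈ S) (hC : 𝓒.AlmostMetrizable ∧ ∀ S' : Finset 𝓒.carrier, (∀ a, a ∈ S') →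
      𝓒.HasType S' N s t A B C) : 𝓑.IsIsomorphic 𝓒 := by
  obtain ⟨S', hS', -⟩ := 𝓒.exists_forall_mem
  exact h.exists_isIsomorphic hB hC.1 (hC.2 S' hS') hS hS'

/-- A gap at either end of the line gives Q, an inner gap gives R. Reversing the line sends s to n -
2 - s and exchanges `α` and `β`. So half of the range suffices for the symmetric families R^2 and
R^4, whereas R^3 needs every i, reversal serving to make the preceding x the one between y and z. -/
theorem HasType.diagonal_isIsomorphic {S : Finset 𝓑.carrier} {n s : ℕ} {α β : Prop}
    (hB : 𝓑.AlmostMetrizable) (hS : ∀ a, a ∈ S) (hn : 3 ≤ n) (hs : s ≤ n - 2)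
    (h : 𝓑.HasType S (n - 2) s s (fun j => j + 1 = s ∧ α ∨ j = s ∧ β) (fun _ => False)
      (fun _ => False)) :
    𝓑.IsIsomorphic (Q2 n) ∨ 𝓑.IsIsomorphic (Q3 n) ∨
    (∃ i, 1 ≤ i ∧ 2 * i + 2 ≤ n ∧ 𝓑.IsIsomorphic (R2 n i)) ∨
    (∃ i, 1 ≤ i ∧ i + 3 ≤ n ∧ 𝓑.IsIsomorphic (R3 n i)) ∨
    (∃ i, 1 ≤ i ∧ 2 * i + 2 ≤ n ∧ 𝓑.IsIsomorphic (R4 n i)) := by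
  by_cases h0 : s = 0
  · by_cases hβ : β
    · exact .inr (.inl ((h.congr h0 h0 (fun j hj => by simp [hβ, h0]) (fun _ _ => Iff.rfl)
        (fun _ _ => Iff.rfl)).isIsomorphic hB hS (Q3_almostMetrizable_and_hasType n hn)))
    · exact .inl ((h.congr h0 h0 (fun j hj => by simp [hβ, h0]) (fun _ _ => Iff.rfl)
        (fun _ _ => Iff.rfl)).isIsomorphic hB hS (Q2_almostMetrizable_and_hasType n))
  by_cases hN : s = n - 2
  · have e : n - 2 - s = 0 := by omega
    by_cases hα : α
    · exact .inr (.inl ((h.reverse.congr e e (fun j hj => by simp [hα]; omega) (fun _ _ => Iff.rfl)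
        (fun _ _ => Iff.rfl)).isIsomorphic hB hS (Q3_almostMetrizable_and_hasType n hn)))
    · exact .inl ((h.reverse.congr e e (fun j hj => by simp [hα]; omega) (fun _ _ => Iff.rfl)
        (fun _ _ => Iff.rfl)).isIsomorphic hB hS (Q2_almostMetrizable_and_hasType n))
  right; right
  by_cases hα : α
  · by_cases hβ : β
    · right; right
      by_cases h2 : 2 * s + 2 ≤ n
      · exact ⟨s, by omega, h2, (h.congr rfl rfl (fun j hj => by simp [hα, hβ])
          (fun _ _ => Iff.rfl) (fun _ _ => Iff.rfl)).isIsomorphic hB hS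
          (R4_almostMetrizable_and_hasType n s (by omega))⟩
      · exact ⟨n - 2 - s, by omega, by omega, (h.reverse.congr rfl rfl
          (fun j hj => by simp only [hα, hβ, and_true]; omega)
          (fun _ _ => Iff.rfl) (fun _ _ => Iff.rfl)).isIsomorphic hB hS
          (R4_almostMetrizable_and_hasType n _ (by omega))⟩
    · exact .inr (.inl ⟨s, by omega, by omega, (h.congr rfl rfl (fun j hj => by simp [hα, hβ])
        (fun _ _ => Iff.rfl) (fun _ _ => Iff.rfl)).isIsomorphic hB hS
        (R3_almostMetrizable_and_hasType n s (by omega) (by omega))⟩)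
  · by_cases hβ : β
    · exact .inr (.inl ⟨n - 2 - s, by omega, by omega, (h.reverse.congr rfl rfl
        (fun j hj => by simp only [hα, hβ, and_true, and_false, false_or]; omega)
        (fun _ _ => Iff.rfl) (fun _ _ => Iff.rfl)).isIsomorphic hB hS
        (R3_almostMetrizable_and_hasType n _ (by omega) (by omega))⟩)
    · left
      by_cases h2 : 2 * s + 2 ≤ n
      · exact ⟨s, by omega, h2, (h.congr rfl rfl (fun j hj => by simp [hα, hβ])
          (fun _ _ => Iff.rfl) (fun _ _ => Iff.rfl)).isIsomorphic hB hS
          (R2_almostMetrizable_and_hasType n s (by omega))⟩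
      · exact ⟨n - 2 - s, by omega, by omega, (h.reverse.congr rfl rfl
          (fun j hj => by simp [hα, hβ])
          (fun _ _ => Iff.rfl) (fun _ _ => Iff.rfl)).isIsomorphic hB hS
          (R2_almostMetrizable_and_hasType n _ (by omega))⟩

/-- The number of end relations that hold selects S^2, S^3 or S^4. If only the one at z holds,
reversing the line and interchanging y and z brings it to y. -/
theorem HasType.end_isIsomorphic {S : Finset 𝓑.carrier} {n : ℕ} {α β : Prop}
    (hB : 𝓑.AlmostMetrizable) (hS : ∀ a, a ∈ S) (hn : 5 ≤ n)
    (h : 𝓑.HasType S (n - 2) 0 (n - 2) (fun _ => False) (fun j => j = 0 ∧ α)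
      (fun j => j + 1 = n - 2 ∧ β)) :
    𝓑.IsIsomorphic (S2 n (by omega)) ∨ 𝓑.IsIsomorphic (S3 n (by omega)) ∨
      𝓑.IsIsomorphic (S4 n hn) := by
  by_cases hα : α
  · by_cases hβ : β
    · exact .inr (.inr ((h.congr rfl rfl (fun _ _ => Iff.rfl) (fun j hj => by simp [hα])
        (fun j hj => by simp [hβ])).isIsomorphic hB hS (S4_almostMetrizable_and_hasType n hn)))
    · exact .inr (.inl ((h.congr rfl rfl (fun _ _ => Iff.rfl) (fun j hj => by simp [hα])
        (fun j hj => by simp [hβ])).isIsomorphic hB hS (S3_almostMetrizable_and_hasType n _)))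
  · by_cases hβ : β
    · exact .inr (.inl (((h.reverse.swap hB).congr (by omega) (by omega) (fun _ _ => Iff.rfl)
        (fun j hj => by simp only [hβ, and_true]; omega) (fun j hj => by simp [hα])).isIsomorphic
        hB hS (S3_almostMetrizable_and_hasType n _)))
    · exact .inl ((h.congr rfl rfl (fun _ _ => Iff.rfl) (fun j hj => by simp [hα])
        (fun j hj => by simp [hβ])).isIsomorphic hB hS (S2_almostMetrizable_and_hasType n _))

theorem AlmostMetrizable.cosize_bounds (hB : 𝓑.AlmostMetrizable) (h6 : 6 ≤ 𝓑.order)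
    (h0 : 𝓑.cosize ≠ 0) (hm : 𝓑.cosize + 11 ≤ 2 * 𝓑.order) :
    𝓑.order ≤ 𝓑.cosize + 4 ∧ 𝓑.cosize + 2 ≤ 𝓑.order := by
  obtain ⟨S, hS, hcard⟩ := 𝓑.exists_forall_mem
  rw [hB.cosize_eq hS] at h0 hm ⊢
  rw [← hcard] at h6 hm ⊢
  exact hB.card_le_of_kernel h6 (hB.exists_kernel _ S rfl h6 hm) h0

/-- Classification of the structures of small positive co-size. -/
theorem AlmostMetrizable.classification (hB : 𝓑.AlmostMetrizable) {n : ℕ} (hn : 𝓑.order = n)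
    (h6 : 6 ≤ n) (h0 : 𝓑.cosize ≠ 0) (hm : 𝓑.cosize + 11 ≤ 2 * n) :
    (𝓑.IsIsomorphic (Q2 n) ∨ 𝓑.IsIsomorphic (Q3 n) ∨
    (∃ i, 1 ≤ i ∧ 2 * i + 2 ≤ n ∧ 𝓑.IsIsomorphic (R2 n i)) ∨
    (∃ i, 1 ≤ i ∧ i + 3 ≤ n ∧ 𝓑.IsIsomorphic (R3 n i)) ∨
    (∃ i, 1 ≤ i ∧ 2 * i + 2 ≤ n ∧ 𝓑.IsIsomorphic (R4 n i))) ∨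
    𝓑.IsIsomorphic (S2 n (by omega)) ∨ 𝓑.IsIsomorphic (S3 n (by omega)) ∨
      𝓑.IsIsomorphic (S4 n (by omega)) := by
  obtain ⟨S, hS, hcard⟩ := 𝓑.exists_forall_mem
  rw [hn] at hcard
  rw [hB.cosize_eq hS] at h0 hm
  obtain ⟨N, s, t, e, hN, F⟩ := hB.frame_of_kernel (S := S) (by omega)
    (hB.exists_kernel n S hcard h6 hm)
  obtain rfl : N = n - 2 := by omega
  rcases F.hasType hB fun hl => h0 (by rw [linearOn_iff.1 hl]; rfl) with
    ⟨α, β, s, hs, h⟩ | ⟨α, β, h⟩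
  · exact .inl (h.diagonal_isIsomorphic hB hS (by omega) hs)
  · exact .inr (h.end_isIsomorphic hB hS (by omega))

end BetweennessStructure

/-! ### The theorem -/

open BetweennessStructure
theorem theorem4 (c : ℤ) :
    -- the case `c > 4`
    (4 < c →
      (∀ n : ℕ, (n : ℤ) ≠ c → ofOrderCosize.{u} n (n - c) = ∅) ∧
      (∀ n : ℕ, (n : ℤ) = c →
        (ofOrderCosize.{u} n (n - c)).Nonempty ∧
        ofOrderCosize.{u} n (n - c) =
          {𝓑 | 𝓑.AlmostMetrizable ∧ 𝓑.order = n ∧ 𝓑.IsLinear})) ∧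
    -- the case `2 ≤ c ≤ 4`
    (2 ≤ c → c ≤ 4 →
      (∀ n : ℕ, (ofOrderCosize.{u} n (n - c)).Nonempty ↔ c ≤ n) ∧
      (∀ n : ℕ, 11 - c ≤ n → ∀ 𝓑 : BetweennessStructure.{u},
        (c = 4 → (𝓑 ∈ ofOrderCosize n (n - c) ↔
          (∃ i : ℕ, 1 ≤ i ∧ (i : ℤ) ≤ ⌈((n : ℚ) - 3) / 2⌉ ∧ 𝓑.IsIsomorphic (R4 n i)) ∨
          (∃ hn : 5 ≤ n, 𝓑.IsIsomorphic (S4 n hn)))) ∧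
        (c = 3 → (𝓑 ∈ ofOrderCosize n (n - c) ↔
          𝓑.IsIsomorphic (Q3 n) ∨
          (∃ i : ℕ, 1 ≤ i ∧ (i : ℤ) ≤ (n : ℤ) - 3 ∧ 𝓑.IsIsomorphic (R3 n i)) ∨
          (∃ hn : 4 ≤ n, 𝓑.IsIsomorphic (S3 n hn)))) ∧
        (c = 2 → (𝓑 ∈ ofOrderCosize n (n - c) ↔
          𝓑.IsIsomorphic (Q2 n) ∨
          (∃ i : ℕ, 1 ≤ i ∧ (i : ℤ) ≤ ⌈((n : ℚ) - 3) / 2⌉ ∧ 𝓑.IsIsomorphic (R2 n i)) ∨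
          (∃ hn : 3 ≤ n, 𝓑.IsIsomorphic (S2 n hn)))))) ∧
    -- the case `c < 2`
    (c < 2 → ∀ n : ℕ, 11 - c ≤ n → ofOrderCosize.{u} n (n - c) = ∅) ∧
    -- sharpness of the threshold `11 - c`
    (c ≤ 4 → ∀ n : ℕ, (n : ℤ) = 11 - c - 1 →
      (ofOrderCosize.{u} n (n - c)).Nonempty ∧
      (∃ 𝓑 ∈ ofOrderCosize.{u} n (n - c), ¬ 𝓑.triangleHypergraph.IsTightStar) ∧
      (∃ i : ℕ, 1 ≤ i ∧ (i : ℤ) ≤ ⌈((n : ℚ) - 5) / 2⌉) ∧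
      (∀ i : ℕ, 1 ≤ i → (i : ℤ) ≤ ⌈((n : ℚ) - 5) / 2⌉ →
        T n i ∈ ofOrderCosize n (n - c) ∧ ¬ (T n i).triangleHypergraph.IsTightStar)) := by
  -- Replaces the ceilings by linear inequalities, as i ≤ ⌈q⌉ means i - 1 < q.
  have ceil_iff : ∀ (n k i : ℕ), (i : ℤ) ≤ ⌈((n : ℚ) - k) / 2⌉ ↔ 2 * (i : ℤ) ≤ n - k + 1 := by
    intro n k i
    rw [Int.le_ceil_iff, lt_div_iff₀ two_pos]
    have : (((i : ℤ) : ℚ) - 1) * 2 < (n : ℚ) - k ↔ ((i : ℤ) - 1) * 2 < (n : ℤ) - k := by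
      exact_mod_cast Iff.rfl
    rw [this]
    omega
  have ceil3 : ∀ n i : ℕ, (i : ℤ) ≤ ⌈((n : ℚ) - 3) / 2⌉ ↔ 2 * (i : ℤ) ≤ n - 3 + 1 := fun n i => by
    simpa using ceil_iff n 3 i
  have ceil5 : ∀ n i : ℕ, (i : ℤ) ≤ ⌈((n : ℚ) - 5) / 2⌉ ↔ 2 * (i : ℤ) ≤ n - 5 + 1 := fun n i => by
    simpa using ceil_iff n 5 i
  refine ⟨fun hc => ⟨fun n hn => ?_, fun n hn => ?_⟩, fun hc2 hc4 => ⟨fun n => ?_, fun n hn 𝓑 => ?_⟩,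
    fun hc n hn => ?_, fun hc n hn => ?_⟩
  · rw [Set.eq_empty_iff_forall_notMem]
    rintro 𝓑 ⟨hB, ho, hm⟩
    -- The co-size n - c is nonnegative and n ≠ c, so n > c > 4. Thus n ≥ 6, the co-size is positive
    -- and the bound holds.
    have := hB.cosize_bounds (by omega) (by omega) (by omega)
    omega
  · have heq : ofOrderCosize.{u} n (n - c) =
        {𝓑 | 𝓑.AlmostMetrizable ∧ 𝓑.order = n ∧ 𝓑.IsLinear} := by
      ext 𝓑
      constructor
      · rintro ⟨hB, ho, hm⟩
        exact ⟨hB, ho, isLinear_iff.2 (by omega)⟩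
      · rintro ⟨hB, ho, hl⟩
        have := isLinear_iff.1 hl
        exact ⟨hB, ho, by omega⟩
    refine ⟨?_, heq⟩
    obtain ⟨𝓑, hB, ho, hl⟩ := exists_linear.{u} (n - 1)
    rw [heq]
    exact ⟨𝓑, hB, by omega, hl⟩
  · constructor
    · rintro ⟨𝓑, -, -, hm⟩
      omega
    · intro hcn
      obtain rfl | rfl | rfl : c = 2 ∨ c = 3 ∨ c = 4 := by omega
      · exact nonempty_ofOrderCosize (Q2_mem (by omega))
      · exact nonempty_ofOrderCosize (Q3_mem (by omega))
      · exact nonempty_ofOrderCosize (R4_mem (i := 1) le_rfl (by omega))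
  · have key : 𝓑 ∈ ofOrderCosize n (n - c) → _ := fun h =>
      h.1.classification (n := n) h.2.1 (by omega) (by have := h.2.2; omega)
        (by have := h.2.2; omega)
    -- Co-size is an isomorphism invariant, so of the families in the classification only those of
    -- co-size n - c remain.
    have excl : ∀ (𝓒 : BetweennessStructure.{0}) (d : ℤ), 𝓒 ∈ ofOrderCosize n ((n : ℤ) - d) →
        𝓑 ∈ ofOrderCosize n (n - c) → 𝓑.IsIsomorphic 𝓒 → d = c := fun 𝓒 d hC h hi => by
      have h1 := (hi.mem_ofOrderCosize hC).2.2
      have h2 := h.2.2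
      omega
    refine ⟨?_, ?_, ?_⟩
    · rintro rfl
      constructor
      · intro h
        rcases key h with (hi | hi | ⟨i, h1, h2, hi⟩ | ⟨i, h1, h2, hi⟩ | ⟨i, h1, h2, hi⟩) | hi | hi | hi
        · have := excl _ _ (Q2_mem (by omega)) h hi; omega
        · have := excl _ _ (Q3_mem (by omega)) h hi; omega
        · have := excl _ _ (R2_mem (by omega)) h hi; omega
        · have := excl _ _ (R3_mem h1 (by omega)) h hi; omega
        · exact .inl ⟨i, h1, (ceil3 _ _).2 (by omega), hi⟩
        · have := excl _ _ (S2_mem _) h hi; omega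
        · have := excl _ _ (S3_mem _) h hi; omega
        · exact .inr ⟨by omega, hi⟩
      · rintro (⟨i, h1, h2, hi⟩ | ⟨_, hi⟩)
        · rw [ceil3] at h2
          exact hi.mem_ofOrderCosize (R4_mem h1 (by omega))
        · exact hi.mem_ofOrderCosize (S4_mem _)
    · rintro rfl
      constructor
      · intro h
        rcases key h with (hi | hi | ⟨i, h1, h2, hi⟩ | ⟨i, h1, h2, hi⟩ | ⟨i, h1, h2, hi⟩) | hi | hi | hi
        · have := excl _ _ (Q2_mem (by omega)) h hi; omega
        · exact .inl hi
        · have := excl _ _ (R2_mem (by omega)) h hi; omega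
        · exact .inr (.inl ⟨i, h1, by omega, hi⟩)
        · have := excl _ _ (R4_mem h1 (by omega)) h hi; omega
        · have := excl _ _ (S2_mem _) h hi; omega
        · exact .inr (.inr ⟨by omega, hi⟩)
        · have := excl _ _ (S4_mem _) h hi; omega
      · rintro (hi | ⟨i, h1, h2, hi⟩ | ⟨_, hi⟩)
        · exact hi.mem_ofOrderCosize (Q3_mem (by omega))
        · exact hi.mem_ofOrderCosize (R3_mem h1 (by omega))
        · exact hi.mem_ofOrderCosize (S3_mem _)
    · rintro rfl
      constructor
      · intro h
        rcases key h with (hi | hi | ⟨i, h1, h2, hi⟩ | ⟨i, h1, h2, hi⟩ | ⟨i, h1, h2, hi⟩) | hi | hi | hi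
        · exact .inl hi
        · have := excl _ _ (Q3_mem (by omega)) h hi; omega
        · exact .inr (.inl ⟨i, h1, (ceil3 _ _).2 (by omega), hi⟩)
        · have := excl _ _ (R3_mem h1 (by omega)) h hi; omega
        · have := excl _ _ (R4_mem h1 (by omega)) h hi; omega
        · exact .inr (.inr ⟨by omega, hi⟩)
        · have := excl _ _ (S3_mem _) h hi; omega
        · have := excl _ _ (S4_mem _) h hi; omega
      · rintro (hi | ⟨i, h1, h2, hi⟩ | ⟨_, hi⟩)
        · exact hi.mem_ofOrderCosize (Q2_mem (by omega))
        · rw [ceil3] at h2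
          exact hi.mem_ofOrderCosize (R2_mem (by omega))
        · exact hi.mem_ofOrderCosize (S2_mem _)
  · rw [Set.eq_empty_iff_forall_notMem]
    rintro 𝓑 ⟨hB, ho, hm⟩
    have := hB.cosize_bounds (by omega) (by omega) (by omega)
    omega
  · have hT : ∀ i : ℕ, 1 ≤ i → (i : ℤ) ≤ ⌈((n : ℚ) - 5) / 2⌉ →
        T n i ∈ ofOrderCosize n (n - c) ∧ ¬ (T n i).triangleHypergraph.IsTightStar := by
      intro i hi hi'
      rw [ceil5] at hi'
      refine ⟨?_, T_not_isTightStar n i hi (by omega)⟩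
      -- For n = 10 - c the co-size n - c is one above the bound 2n - 11.
      rw [show (n : ℤ) - c = 2 * n - 10 by omega]
      exact T_mem hi (by omega)
    have h1 : ((1 : ℕ) : ℤ) ≤ ⌈((n : ℚ) - 5) / 2⌉ := (ceil5 n 1).2 (by omega)
    obtain ⟨hm, hs⟩ := hT 1 le_rfl h1
    obtain ⟨𝓑, hB⟩ := exists_isIsomorphic_lift.{u} (T n 1)
    have hB' := hB.mem_ofOrderCosize hm
    exact ⟨⟨𝓑, hB'⟩, ⟨𝓑, hB', hB.not_isTightStar hm.1 hs⟩, ⟨1, le_rfl, h1⟩, hT⟩
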